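/- Let $R$ be a Dedekind domain with field of fractions $K$, let $n\ge 1$, and let $\omega$ be a symplectic form on $R^{2n}$, i.e. a bilinear form $\omega\colon R^{2n}\times R^{2n}\to R$ with $\omega(x,x)=0$ for all $x$ such that $x\mapsto\omega(x,-)$ and $y\mapsto\omega(-,y)$ are bijections from $R^{2n}$ to its dual module. Denote its extension to $K^{2n}$ also by $\omega$. For $D\in\{R,K\}$ let $T^\omega(D^{2n})$ be the poset, ordered by inclusion, of nonzero direct summands $U$ of $D^{2n}$ that are isotropic, i.e. $\omega(x,y)=0$ for all $x,y\in U$. For a poset $P$ let $\tilde H_*(P)$ be the reduced integral simplicial homology of its order complex (whose simplices are the finite chains of $P$). The symplectic Steinberg module is $\mathrm{St}^\omega:=\tilde H_{n-1}(T^\omega(K^{2n}))$. Let $\mathrm{cl}(R)$ be the ideal class group of $R$. For a finitely generated projective $R$-module $M$ of rank $r\ge 1$ let $[M]\in\mathrm{cl}(R)$ be the unique class such that $M\cong R^{r-1}\oplus I$ for an ideal $I$ in that class. Let $X_n(\mathrm{cl}(R))$ be the poset with underlying set $\{1,\dots,n\}\times\mathrm{cl}(R)$ and $(i,a)<(j,b)$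 if and only if $i<j$. Let $\psi\colon T^\omega(R^{2n})\to X_n(\mathrm{cl}(R))$ be the poset map $U\mapsto(\operatorname{rk}U,[U])$. Then: 1. The map $V\mapsto V\cap R^{2n}$ is an isomorphism of posets $T^\omega(K^{2n})\to T^\omega(R^{2n})$ and hence induces an isomorphism $\mathrm{St}^\omega\cong\tilde H_{n-1}(T^\omega(R^{2n}))$. 2. The induced map $\psi_*\colon \mathrm{St}^\omega\cong\tilde H_{n-1}(T^\omega(R^{2n}))\to\tilde H_{n-1}(X_n(\mathrm{cl}(R)))$ is surjective. 3. The group $\tilde H_{n-1}(X_n(\mathrm{cl}(R)))$ is isomorphic to $\mathbb Z^{(|\mathrm{cl}(R)|-1)^n}$. If $\mathrm{cl}(R)$ is infinite, this means that it is free abelian on the set of $n$-tuples of non-trivial elements of $\mathrm{cl}(R)$. -/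

import Mathlib

namespace SymplecticBuilding

/-! ### Reduced homology of the order complex of a poset -/

section OrderComplex

variable {P Q S : Type*} [PartialOrder P] [PartialOrder Q] [PartialOrder S]

/-- The simplices with `k` vertices of the order complex of `P`: chains `x₀ < ⋯ < x_{k-1}`.
There is exactly one such chain with `k = 0`, the empty simplex. -/
abbrev Flag (P : Type*) [PartialOrder P] (k : ℕ) : Type _ :=
  {c : Fin k → P // StrictMono c}

/-- The face of a chain obtained by deleting its `i`-th vertex. -/
def Flag.face {k : ℕ} (c : Flag P (k + 1)) (i : Fin (k + 1)) : Flag P k :=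
  ⟨c.1 ∘ i.succAbove, c.2.comp (Fin.strictMono_succAbove i)⟩

/-- The image of a chain under a strictly increasing map. -/
def Flag.map (f : P → Q) (hf : StrictMono f) {k : ℕ} (c : Flag P k) : Flag Q k :=
  ⟨f ∘ c.1, hf.comp c.2⟩

/-- The augmented simplicial chain groups of the order complex, indexed by the number `k` of
vertices: `OrderChain P k` sits in degree `k - 1`. -/
abbrev OrderChain (P : Type*) [PartialOrder P] (k : ℕ) : Type _ := Flag P k →₀ ℤ

/-- The simplicial boundary map `[x₀ < ⋯ < x_k] ↦ ∑ i, (-1)ⁱ [x₀ < ⋯ x̂ᵢ ⋯ < x_k]`. For `k = 0` this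
is the augmentation. -/
noncomputable def boundary (P : Type*) [PartialOrder P] (k : ℕ) :
    OrderChain P (k + 1) →ₗ[ℤ] OrderChain P k :=
  Finsupp.lsum ℤ fun c : Flag P (k + 1) =>
    LinearMap.toSpanSingleton ℤ (OrderChain P k)
      (∑ i : Fin (k + 1), Finsupp.single (c.face i) ((-1 : ℤ) ^ (i : ℕ)))

lemma boundary_single (k : ℕ) (c : Flag P (k + 1)) (a : ℤ) :
    boundary P k (Finsupp.single c a) =
      a • ∑ i : Fin (k + 1), Finsupp.single (c.face i) ((-1 : ℤ) ^ (i : ℕ)) := by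
  simp [boundary]

lemma boundary_boundary (k : ℕ) (x : OrderChain P (k + 2)) :
    boundary P k (boundary P (k + 1) x) = 0 := by
  induction x using Finsupp.induction_linear with
  | zero => simp
  | add x y hx hy => simp [hx, hy]
  | single c a =>
    have key : ∑ p : Fin (k + 2) × Fin (k + 1),
        (-1 : ℤ) ^ ((p.1 : ℕ) + (p.2 : ℕ)) •
          (Finsupp.single ((c.face p.1).face p.2) (1 : ℤ) : OrderChain P k) = 0 := by
      refine Finset.sum_involution (fun p _ => (p.1.succAbove p.2, p.2.predAbove p.1))
        ?_ ?_ ?_ ?_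
      · rintro ⟨i, j⟩ -
        have h1 : (c.face (i.succAbove j)).face (j.predAbove i) = (c.face i).face j := by
          apply Subtype.ext
          funext l
          simp only [Flag.face, Function.comp_apply]
          rw [Fin.succAbove_succAbove_succAbove_predAbove]
        simp only [h1, Fin.neg_one_pow_succAbove_add_predAbove, neg_smul, add_neg_cancel]
      · rintro ⟨i, j⟩ - - h
        exact Fin.succAbove_ne i j (congrArg Prod.fst h)
      · simp
      · rintro ⟨i, j⟩ -
        simp only [Fin.succAbove_succAbove_predAbove, Fin.predAbove_predAbove_succAbove]
    rw [boundary_single, map_smul, map_sum]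
    simp only [boundary_single]
    rw [Fintype.sum_prod_type] at key
    have : (∑ i : Fin (k + 2), (-1 : ℤ) ^ (i : ℕ) • ∑ j : Fin (k + 1),
        (Finsupp.single ((c.face i).face j) ((-1 : ℤ) ^ (j : ℕ)) : OrderChain P k)) = 0 := by
      rw [← key]
      refine Finset.sum_congr rfl fun i _ => ?_
      rw [Finset.smul_sum]
      refine Finset.sum_congr rfl fun j _ => ?_
      simp [pow_add]
    rw [this, smul_zero]

/-- The reduced cycles of degree `q` of the order complex. -/
noncomputable abbrev cycles (P : Type*) [PartialOrder P] (q : ℕ) :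
    Submodule ℤ (OrderChain P (q + 1)) :=
  LinearMap.ker (boundary P q)

/-- The boundary map from chains of degree `q + 1` to cycles of degree `q`. -/
noncomputable def toCycles (P : Type*) [PartialOrder P] (q : ℕ) :
    OrderChain P (q + 2) →ₗ[ℤ] cycles P q :=
  (boundary P (q + 1)).codRestrict (cycles P q) (boundary_boundary q)

/-- The reduced integral simplicial homology `H̃_q` (for `q ≥ 0`) of the order complex of `P`. -/
abbrev ReducedHomology (P : Type*) [PartialOrder P] (q : ℕ) : Type _ :=
  cycles P q ⧸ LinearMap.range (toCycles P q)

/-- The chain map induced by a strictly increasing map of posets. -/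
noncomputable def chainMap (f : P → Q) (hf : StrictMono f) (k : ℕ) :
    OrderChain P k →ₗ[ℤ] OrderChain Q k :=
  Finsupp.lmapDomain ℤ ℤ (Flag.map f hf)

lemma boundary_chainMap (f : P → Q) (hf : StrictMono f) (k : ℕ) (x : OrderChain P (k + 1)) :
    boundary Q k (chainMap f hf (k + 1) x) = chainMap f hf k (boundary P k x) := by
  induction x using Finsupp.induction_linear with
  | zero => simp
  | add x y hx hy => simp only [map_add, hx, hy]
  | single c a =>
    simp only [chainMap, Finsupp.lmapDomain_apply, Finsupp.mapDomain_single, boundary_single,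
      Finsupp.mapDomain_smul, Finsupp.mapDomain_finsetSum]
    rfl

/-- The map on cycles induced by a strictly increasing map of posets. -/
noncomputable def cyclesMap (f : P → Q) (hf : StrictMono f) (q : ℕ) :
    cycles P q →ₗ[ℤ] cycles Q q :=
  (chainMap f hf (q + 1)).restrict fun x hx => by
    rw [LinearMap.mem_ker] at hx ⊢
    rw [boundary_chainMap, hx, map_zero]

/-- The map on reduced homology induced by a strictly increasing map of posets (equivalently, by
a map of order complexes that is injective on every simplex). -/
noncomputable def homologyMap (f : P → Q) (hf : StrictMono f) (q : ℕ) :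
    ReducedHomology P q →ₗ[ℤ] ReducedHomology Q q :=
  Submodule.mapQ _ _ (cyclesMap f hf q) (by
    rintro _ ⟨x, rfl⟩
    refine ⟨chainMap f hf (q + 2) x, Subtype.ext ?_⟩
    exact boundary_chainMap f hf (q + 1) x)

end OrderComplex

/-! ### The poset `X_n(C)` -/

/-- The poset `X_n(C)` with underlying set `{1, …, n} × C`, ordered by
`(i, a) < (j, b) ↔ i < j`. -/
@[ext]
structure XPoset (n : ℕ) (C : Type*) where
  /-- the first coordinate, in `{1, …, n}` -/
  level : Set.Icc 1 n
  /-- the second coordinate -/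
  color : C

instance (n : ℕ) (C : Type*) : PartialOrder (XPoset n C) where
  le x y := x = y ∨ x.level < y.level
  lt x y := x.level < y.level
  le_refl _ := Or.inl rfl
  le_trans x y z := by
    rintro (rfl | h) (rfl | h')
    · exact Or.inl rfl
    · exact Or.inr h'
    · exact Or.inr h
    · exact Or.inr (h.trans h')
  lt_iff_le_not_ge x y := by
    constructor
    · intro h
      refine ⟨Or.inr h, ?_⟩
      rintro (rfl | h')
      · exact lt_irrefl _ h
      · exact lt_asymm h h'
    · rintro ⟨rfl | h, h'⟩
      · exact absurd (Or.inl rfl) h'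
      · exact h
  le_antisymm x y := by
    rintro (rfl | h) (h' | h')
    · rfl
    · rfl
    · exact h'.symm
    · exact absurd h' (lt_asymm h)

/-! ### Symplectic forms and isotropic summands -/

/-- A symplectic form on a `D`-module: an alternating bilinear form for which
`x ↦ ω(x, ·)` and `y ↦ ω(·, y)` are bijections onto the dual module. -/
structure IsSymplectic {D M : Type*} [CommRing D] [AddCommGroup M] [Module D M]
    (ω : LinearMap.BilinForm D M) : Prop where
  isAlt : ω.IsAlt
  isPerfPair : LinearMap.IsPerfPair ω

/-- The poset `T^ω(M)` of nonzero isotropic direct summands of `M`, ordered by inclusion. If `D` is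
a field then every subspace is a direct summand, so that this is the poset of nonzero
isotropic subspaces. -/
abbrev IsotropicPoset {D M : Type*} [CommRing D] [AddCommGroup M] [Module D M]
    (ω : LinearMap.BilinForm D M) : Type _ :=
  {U : Submodule D M // U ≠ ⊥ ∧ (∃ U', IsCompl U U') ∧ ∀ x ∈ U, ∀ y ∈ U, ω x y = 0}

/-- The extension of a bilinear form on `R^m` to `K^m`, with the same Gram matrix with respect to
the standard basis. -/
noncomputable def extendForm {R : Type*} (K : Type*) [CommRing R] [Field K] [Algebra R K] {m : ℕ}
    (ω : LinearMap.BilinForm R (Fin m → R)) : LinearMap.BilinForm K (Fin m → K) :=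
  Matrix.toBilin' ((LinearMap.BilinForm.toMatrix' ω).map (algebraMap R K))

/-- The inclusion `R^m → K^m`. -/
def latticeInclusion (R K : Type*) [CommRing R] [Field K] [Algebra R K] (m : ℕ) :
    (Fin m → R) →ₗ[R] (Fin m → K) :=
  (Algebra.linearMap R K).compLeft (Fin m)

/-! ### The class of a projective module and the map `ψ` -/

/-- `M ≅ R^{r-1} ⊕ I`, where `r` is the rank of `M` and `I` is a nonzero ideal in the class `c`. -/
def HasClass {R : Type*} [CommRing R] [IsDedekindDomain R] (M : Type*) [AddCommGroup M] [Module R M] (c : ClassGroup R) : Prop :=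
  ∃ I : nonZeroDivisors (Ideal R), ClassGroup.mk0 I = c ∧
    Nonempty (M ≃ₗ[R] (Fin (Module.finrank R M - 1) → R) × (I : Ideal R))

open Classical in
/-- The class `[M] ∈ cl(R)` of a finitely generated projective `R`-module `M` of rank `r ≥ 1`: the
unique class `c` such that `M ≅ R^{r-1} ⊕ I` with `I` in `c` (a junk value for all other `M`). -/
noncomputable def moduleClass (R : Type*) [CommRing R] [IsDedekindDomain R]
    (M : Type*) [AddCommGroup M] [Module R M] : ClassGroup R :=
  if h : ∃ c : ClassGroup R, HasClass M c then h.choose else 1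

lemma exists_smul_mem {R M : Type*} [CommRing R] [IsDomain R] [AddCommGroup M] [Module R M] [Module.Finite R M]
    (N : Submodule R M) (h : Module.finrank R N = Module.finrank R M) (x : M) :
    ∃ a : R, a ≠ 0 ∧ a • x ∈ N := by
  have h1 := N.finrank_quotient_add_finrank
  have h2 : Module.finrank R (M ⧸ N) = 0 := by omega
  rw [Module.finrank_eq_zero_iff] at h2
  obtain ⟨a, ha, hx⟩ := h2 (N.mkQ x)
  refine ⟨a, ha, ?_⟩
  rwa [← map_smul, Submodule.mkQ_apply, Submodule.Quotient.mk_eq_zero] at hx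

section Psi

variable {R : Type*} [CommRing R] [IsDedekindDomain R]

lemma finrank_pos_of_ne_bot {m : ℕ} {U : Submodule R (Fin m → R)} (hU : U ≠ ⊥) :
    1 ≤ Module.finrank R U := by
  have : Nontrivial U := (Submodule.nontrivial_iff_ne_bot).mpr hU
  exact Module.finrank_pos

/-- An isotropic submodule of a symplectic module of rank `2n` has rank at most `n`. -/
lemma finrank_le_of_isotropic {n : ℕ} {ω : LinearMap.BilinForm R (Fin (2 * n) → R)}
    (hω : IsSymplectic ω) {U : Submodule R (Fin (2 * n) → R)}
    (hU : ∀ x ∈ U, ∀ y ∈ U, ω x y = 0) : Module.finrank R U ≤ n := by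
  set r := Module.finrank R ((Fin (2 * n) → R) ⧸ U) with hr
  have h1 := U.finrank_quotient_add_finrank
  rw [Module.finrank_fin_fun, ← hr] at h1
  obtain ⟨v, hv⟩ := exists_linearIndependent_of_le_finrank (R := R)
    (M := (Fin (2 * n) → R) ⧸ U) (n := r) le_rfl
  choose w hw using fun i => U.mkQ_surjective (v i)
  have hspan : Module.finrank R (Submodule.span R (Set.range v)) = r := by
    rw [finrank_span_eq_card hv, Fintype.card_fin]
  let f : U →ₗ[R] (Fin r → R) := LinearMap.pi fun i => (ω.flip (w i)).comp U.subtype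
  have hf : Function.Injective f := by
    rw [← LinearMap.ker_eq_bot, LinearMap.ker_eq_bot']
    rintro ⟨u, hu⟩ h0
    have h0' : ∀ i, ω u (w i) = 0 := fun i => congrFun h0 i
    have hzero : ω u = 0 := by
      have hall : ∀ x, ω u x = 0 := by
        intro x
        obtain ⟨a, ha, hx⟩ := exists_smul_mem _ (hspan.trans hr) (U.mkQ x)
        have hle : Submodule.span R (Set.range v) ≤
            (LinearMap.ker (ω u)).map U.mkQ := by
          rw [Submodule.span_le]
          rintro _ ⟨i, rfl⟩
          exact ⟨w i, h0' i, hw i⟩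
        obtain ⟨y, hy, hyx⟩ := hle hx
        rw [← map_smul] at hyx
        have hmem : y - a • x ∈ U := by
          rw [← Submodule.Quotient.mk_eq_zero, Submodule.Quotient.mk_sub, sub_eq_zero]
          exact hyx
        have h2 := hU u hu _ hmem
        have hy' : ω u y = 0 := hy
        rw [map_sub, map_smul, hy', zero_sub, neg_eq_zero, smul_eq_mul] at h2
        exact (mul_eq_zero.mp h2).resolve_left ha
      exact LinearMap.ext hall
    have : u = 0 := hω.isPerfPair.bijective_left.1 (by rw [hzero, map_zero])
    exact Subtype.ext this
  have h3 := LinearMap.finrank_le_finrank_of_injective hf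
  rw [Module.finrank_fin_fun] at h3
  omega

/-- A proper inclusion of direct summands strictly increases the rank. -/
lemma finrank_lt_of_lt {m : ℕ} {U V : Submodule R (Fin m → R)} (hU : ∃ U', IsCompl U U')
    (h : U < V) : Module.finrank R U < Module.finrank R V := by
  obtain ⟨U', hU'⟩ := hU
  refine lt_of_le_of_ne (Submodule.finrank_mono h.le) fun heq => ?_
  refine h.not_ge fun x hx => ?_
  have h1 : Module.finrank R (U.submoduleOf V) = Module.finrank R V := by
    rw [← heq]
    exact (Submodule.submoduleOfEquivOfLe h.le).finrank_eq
  obtain ⟨a, ha, hax⟩ := exists_smul_mem _ h1 ⟨x, hx⟩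
  have hax' : a • x ∈ U := hax
  obtain ⟨u, hu, u', hu', rfl⟩ := Submodule.mem_sup.mp 
    (hU'.sup_eq_top ▸ Submodule.mem_top : x ∈ U ⊔ U')
  have h2 : a • u' ∈ U := by
    have := U.sub_mem hax' (U.smul_mem a hu)
    simpa [smul_add] using this
  have h3 : a • u' = 0 := by
    have : a • u' ∈ U ⊓ U' := ⟨h2, U'.smul_mem a hu'⟩
    rwa [hU'.inf_eq_bot] at this
  rw [(smul_eq_zero.mp h3).resolve_left ha, add_zero]
  exact hu

/-- The map `ψ : T^ω(R^{2n}) → X_n(cl(R))`, `U ↦ (rk U, [U])`. -/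
noncomputable def psi {n : ℕ} {ω : LinearMap.BilinForm R (Fin (2 * n) → R)}
    (hω : IsSymplectic ω) (U : IsotropicPoset ω) : XPoset n (ClassGroup R) where
  level := ⟨Module.finrank R U.1, finrank_pos_of_ne_bot U.2.1, finrank_le_of_isotropic hω U.2.2.2⟩
  color := moduleClass R U.1

/-- `ψ` is a map of posets, and it does not identify distinct comparable elements. -/
lemma psi_strictMono {n : ℕ} {ω : LinearMap.BilinForm R (Fin (2 * n) → R)}
    (hω : IsSymplectic ω) : StrictMono (psi hω) :=
  fun U _ h => finrank_lt_of_lt U.2.2.1 h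

end Psi

end SymplecticBuilding

open SymplecticBuilding

/-! A maximal chain of `X_n(C)` is an `n`-tuple of colours, and faces missing different levels
cannot cancel, so the top cycles are the finitely supported functions on `C^n` whose sums along
every coordinate line vanish (`IsCycle`). Such a function is determined by its values on the tuples
avoiding a base point `c₀`, and these values are arbitrary (`exists_cycleSubmodule_equiv`); this
gives the rank. The posets over `K` and `R` agree because `V ∩ R^m` spans `V` and has torsion-free,
hence projective, quotient (`latticeOrderIso`).

For surjectivity, every cycle of colours has to be lifted to a cycle supported on chains of
isotropic subspaces. By `isCycle_snoc_induction` it suffices to lift `y' × ([c] - [c₀])`, where `c₀`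
is the class of a fixed Lagrangian `U₀`. First `y'` is lifted to the Tits building of `U₀`
(`mem_liftable_isFlagIn`, by the same strategy and induction on the dimension). Given a Lagrangian
`L'` complementary to `U₀`, each lifted flag `(U_i)` is replaced by an alternating sum of `2^n`
chains through the spaces `U_i + (U_j^⊥ ∩ L')`, and the result is a cycle (`isCycle_wordPath`). One
of these chains ends in `U₀`; all others end in some `U_i + (U_i^⊥ ∩ L')` with `U_i ≠ U₀`. If all of
the latter have class `c`, the cycle condition alone determines the image (`IsCycle.eq_of_last`), so
the classes of the intermediate vertices never have to be known.

It remains to find `L'`. An arbitrary complementary Lagrangian is moved by symplectic transvections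
along vectors of `U₀`, which fix `U₀` pointwise. The class of a subspace is inverse to the class of
the ideal generated by an integral multiple of its Plücker vector (`isPrincipal_span_plucker_mul`).
A transvection with parameter `b / a` replaces an integral Plücker vector `p` by `a p + b q`, and if
`J = (a, b)` with `b` sufficiently divisible, this multiplies the ideal by `J`
(`span_range_pencil`), for finitely many subspaces at once (`transvectionProperty_moduleClass`). A
transvection along `v` does not move the subspaces containing `v`; generic choices of `v` in the
various `U_i`, combined with Möbius inversion, make all the required classes equal to `c`
(`exists_mem_transvectionMonoid_eq`). Generic vectors need `K` infinite, but for finite `K` the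
class group is trivial and the target vanishes. -/

/-! ### Cycles on tuples -/

namespace SymplecticBuilding

open Finsupp

section TupleCycles

variable {α β γ : Type*} {k l : ℕ}

/-- Forget the `s`-th entry of a tuple. -/
def dropAt (s : Fin k) (f : Fin k → α) : {j : Fin k // j ≠ s} → α := fun j => f j

/-- A finitely supported function on `k`-tuples whose sums along every coordinate direction
vanish. For the tuples of vertices of the top-dimensional simplices of a graded poset, these are
the top-dimensional reduced cycles. -/
def IsCycle (z : (Fin k → α) →₀ ℤ) : Prop := ∀ s, z.mapDomain (dropAt s) = 0

/-- The factorisation extends to a map on all of `β`, so the pushforward along `f` is a pushforward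
of the one along `g`. The extension needs a point of `γ`; without one there is nothing to prove. -/
lemma mapDomain_eq_zero_of_factorsThrough {f : α → γ} {g : α → β} {z : α →₀ ℤ}
    (h : f.FactorsThrough g) (hz : z.mapDomain g = 0) : z.mapDomain f = 0 := by
  rcases isEmpty_or_nonempty γ with hγ | hγ
  · exact Finsupp.ext fun c => (hγ.false c).elim
  · obtain ⟨e, rfl⟩ := (Function.factorsThrough_iff f).mp h
    rw [Finsupp.mapDomain_comp, hz, Finsupp.mapDomain_zero]

lemma IsCycle.mapDomain_comp {z : (Fin k → α) →₀ ℤ} (hz : IsCycle z) (φ : α → β) :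
    IsCycle (z.mapDomain (φ ∘ ·)) := by
  intro s
  rw [← Finsupp.mapDomain_comp]
  refine mapDomain_eq_zero_of_factorsThrough (fun f f' h => ?_) (hz s)
  funext j
  exact congrArg φ (congrFun h j)

lemma IsCycle.zero : IsCycle (0 : (Fin k → α) →₀ ℤ) := fun _ => Finsupp.mapDomain_zero

lemma IsCycle.add {z w : (Fin k → α) →₀ ℤ} (hz : IsCycle z) (hw : IsCycle w) :
    IsCycle (z + w) := fun s => by rw [Finsupp.mapDomain_add, hz s, hw s, add_zero]

lemma IsCycle.smul {z : (Fin k → α) →₀ ℤ} (hz : IsCycle z) (a : ℤ) : IsCycle (a • z) :=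
  fun s => by rw [Finsupp.mapDomain_smul, hz s, smul_zero]

lemma IsCycle.mapDomain_init {z : (Fin (k + 1) → α) →₀ ℤ} (hz : IsCycle z) :
    z.mapDomain (fun f => (Fin.init f : Fin k → α)) = 0 := by
  refine mapDomain_eq_zero_of_factorsThrough (fun f f' h => ?_) (hz (Fin.last k))
  funext j
  exact congrFun h ⟨j.castSucc, (Fin.castSucc_lt_last j).ne⟩

/-- A signed family of operations on tuples maps cycles to cycles if, for every position `s`, the
operations either do not see one of the entries away from `s`, or cancel in pairs away
from `s`. -/
lemma isCycle_sum_paths {E : Type*} [Fintype E] (sgn : E → ℤ)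
    (path : E → (Fin k → α) → (Fin l → β)) {z : (Fin k → α) →₀ ℤ} (hz : IsCycle z)
    (H : ∀ s : Fin l, ∃ ι : E → E, Function.Involutive ι ∧ ∀ ε,
      (∃ i : Fin k, ∀ f f', dropAt i f = dropAt i f' →
        dropAt s (path ε f) = dropAt s (path ε f')) ∨
      (sgn (ι ε) = - sgn ε ∧ ∀ f, dropAt s (path (ι ε) f) = dropAt s (path ε f))) :
    IsCycle (∑ ε, sgn ε • z.mapDomain (path ε)) := by
  intro s
  obtain ⟨ι, hι, h⟩ := H s
  set T : E → ({j : Fin l // j ≠ s} → β) →₀ ℤ :=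
    fun ε => sgn ε • z.mapDomain (fun f => dropAt s (path ε f)) with hT
  have hsum : (∑ ε, sgn ε • z.mapDomain (path ε)).mapDomain (dropAt s) = ∑ ε, T ε := by
    rw [Finsupp.mapDomain_finsetSum]
    refine Finset.sum_congr rfl fun ε _ => ?_
    rw [Finsupp.mapDomain_smul, ← Finsupp.mapDomain_comp]
    rfl
  have h1 : ∀ ε, T ε = 0 ∨ T (ι ε) = - T ε := by
    intro ε
    rcases h ε with ⟨i, hi⟩ | ⟨h2, h3⟩
    · left
      have := mapDomain_eq_zero_of_factorsThrough (f := fun f => dropAt s (path ε f))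
        (fun f f' h => hi f f' h) (hz i)
      simp only [hT, this, smul_zero]
    · right
      simp only [hT, h2, neg_smul, h3]
  -- The two alternatives may differ at `ε` and `ι ε`; since `ι` is an involution, cancellation at
  -- either one suffices.
  have h2 : ∀ ε, T ε + T (ι ε) = 0 := by
    intro ε
    rcases h1 ε with h3 | h3
    · rcases h1 (ι ε) with h4 | h4
      · rw [h3, h4, add_zero]
      · rw [hι ε] at h4
        rw [h4]
        simp [h3] at h4 ⊢
    · rw [h3, add_neg_cancel]
  rw [hsum]
  -- At a fixed point of `ι` the relation reads `2 • T ε = 0`, so nonzero terms are never fixed.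
  refine Finset.sum_involution (fun ε _ => ι ε) (fun ε _ => h2 ε) (fun ε _ hne heq => hne ?_)
    (fun _ _ => Finset.mem_univ _) (fun ε _ => hι ε)
  have := h2 ε
  rw [heq, ← two_smul ℤ] at this
  exact (smul_eq_zero.mp this).resolve_left two_ne_zero

/-- A cycle whose tuples end in `c`, up to a part ending in `c₀` that is known. -/
lemma IsCycle.eq_of_last {Z : (Fin (k + 1) → γ) →₀ ℤ} (hZ : IsCycle Z) (y : (Fin k → γ) →₀ ℤ)
    (σ : ℤ) (c₀ c : γ)
    (hr : ∀ f ∈ (Z - σ • y.mapDomain (fun f => (Fin.snoc f c₀ : Fin (k + 1) → γ))).support,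
      f (Fin.last k) = c) :
    Z = σ • (y.mapDomain (fun f => (Fin.snoc f c₀ : Fin (k + 1) → γ)) -
      y.mapDomain (fun f => (Fin.snoc f c : Fin (k + 1) → γ))) := by
  set r := Z - σ • y.mapDomain (fun f => (Fin.snoc f c₀ : Fin (k + 1) → γ)) with hrdef
  -- Dropping the last entry kills the cycle `Z`, so it sends the remainder `r` to `-σ • y`. As all
  -- tuples in `r` end in `c`, this determines `r`.
  have h1 : r.mapDomain (fun f => (Fin.init f : Fin k → γ)) = - (σ • y) := by
    rw [hrdef, sub_eq_add_neg, Finsupp.mapDomain_add, hZ.mapDomain_init, zero_add, ← neg_smul,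
      Finsupp.mapDomain_smul, ← Finsupp.mapDomain_comp, neg_smul]
    congr 2
    convert Finsupp.mapDomain_id
    funext f
    simp
  have h2 : (r.mapDomain (fun f => (Fin.init f : Fin k → γ))).mapDomain
      (fun f => (Fin.snoc f c : Fin (k + 1) → γ)) = r := by
    rw [← Finsupp.mapDomain_comp]
    conv_rhs => rw [← Finsupp.mapDomain_id (v := r)]
    refine Finsupp.mapDomain_congr fun f hf => ?_
    have h3 := hr f hf
    simp only [Function.comp_apply, id]
    rw [← h3, Fin.snoc_init_self]
  rw [h1, ← neg_smul, Finsupp.mapDomain_smul] at h2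
  have h3 : Z = r + σ • y.mapDomain (fun f => (Fin.snoc f c₀ : Fin (k + 1) → γ)) := by
    rw [hrdef, sub_add_cancel]
  rw [h3, ← h2, smul_sub, neg_smul]
  abel

lemma filter_mapDomain (g : α → β) (p : β → Prop) [DecidablePred p] [DecidablePred fun a => p (g a)]
    (y : α →₀ ℤ) : (y.mapDomain g).filter p = (y.filter fun a => p (g a)).mapDomain g := by
  induction y using Finsupp.induction_linear with
  | zero => rw [Finsupp.filter_zero, Finsupp.mapDomain_zero, Finsupp.filter_zero]
  | add x y hx hy => simp only [Finsupp.filter_add, Finsupp.mapDomain_add, hx, hy]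
  | single f a =>
    rw [Finsupp.mapDomain_single]
    by_cases hf : p (g f)
    · rw [Finsupp.filter_single_of_pos (p := p) (b := a) hf,
        Finsupp.filter_single_of_pos (p := fun a => p (g a)) (b := a) hf,
        Finsupp.mapDomain_single]
    · rw [Finsupp.filter_single_of_neg (p := p) (b := a) hf,
        Finsupp.filter_single_of_neg (p := fun a => p (g a)) (b := a) hf, Finsupp.mapDomain_zero]

/-- The cycles on `(k+1)`-tuples are generated by the differences of two extensions by a constant
of a cycle on `k`-tuples. -/
lemma isCycle_snoc_induction (S : AddSubgroup ((Fin (k + 1) → γ) →₀ ℤ)) (c₀ : γ)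
    (hS : ∀ (c : γ) (y : (Fin k → γ) →₀ ℤ), IsCycle y →
      y.mapDomain (fun f => (Fin.snoc f c : Fin (k + 1) → γ)) -
        y.mapDomain (fun f => (Fin.snoc f c₀ : Fin (k + 1) → γ)) ∈ S)
    {y : (Fin (k + 1) → γ) →₀ ℤ} (hy : IsCycle y) : y ∈ S := by
  classical
  -- Slice `y` by the last entry. Each slice is a cycle in the other directions, since fixing the
  -- last entry commutes with dropping an earlier one. The slices sum to zero because `y` is a cycle
  -- in the last direction, so subtracting their extensions by `c₀` changes nothing.
  let part : γ → (Fin (k + 1) → γ) →₀ ℤ := fun c => y.filter fun f => f (Fin.last k) = c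
  let yc : γ → (Fin k → γ) →₀ ℤ := fun c => (part c).mapDomain fun f => Fin.init f
  have hyc : ∀ c, IsCycle (yc c) := by
    intro c s
    have h0 := hy s.castSucc
    have h1 : (part c).mapDomain (dropAt s.castSucc) = 0 := by
      have h2 : (part c).mapDomain (dropAt s.castSucc) =
          (y.mapDomain (dropAt s.castSucc)).filter
            (fun g => g ⟨Fin.last k, (Fin.castSucc_lt_last s).ne'⟩ = c) := by
        exact (filter_mapDomain (dropAt s.castSucc)
          (fun g => g ⟨Fin.last k, (Fin.castSucc_lt_last s).ne'⟩ = c) y).symm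
      rw [h2, h0, Finsupp.filter_zero]
    rw [← Finsupp.mapDomain_comp]
    refine mapDomain_eq_zero_of_factorsThrough (fun f f' h => ?_) h1
    funext j
    exact congrFun h ⟨j.1.castSucc, fun h => j.2 (Fin.castSucc_injective k h)⟩
  let A : Finset γ := y.support.image fun f => f (Fin.last k)
  have hsum : y = ∑ c ∈ A, part c := by
    ext f
    rw [Finsupp.finsetSum_apply]
    simp only [part, Finsupp.filter_apply]
    rw [Finset.sum_ite_eq]
    split_ifs with h
    · rfl
    · by_contra hf
      exact h (Finset.mem_image_of_mem _ (Finsupp.mem_support_iff.mpr hf))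
  have hsnoc : ∀ c, (yc c).mapDomain (fun f => (Fin.snoc f c : Fin (k + 1) → γ)) = part c := by
    intro c
    simp only [yc]
    rw [← Finsupp.mapDomain_comp]
    conv_rhs => rw [← Finsupp.mapDomain_id (v := part c)]
    refine Finsupp.mapDomain_congr fun f hf => ?_
    have h3 : f (Fin.last k) = c := by
      by_contra h
      exact (Finsupp.mem_support_iff.mp hf) (Finsupp.filter_apply_neg _ _ h)
    simp only [Function.comp_apply, id]
    rw [← h3, Fin.snoc_init_self]
  have hzero : ∑ c ∈ A, yc c = 0 := by
    simp only [yc]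
    rw [← Finsupp.mapDomain_finsetSum, ← hsum]
    exact hy.mapDomain_init
  have hfin : y = ∑ c ∈ A, ((yc c).mapDomain (fun f => (Fin.snoc f c : Fin (k + 1) → γ)) -
      (yc c).mapDomain (fun f => (Fin.snoc f c₀ : Fin (k + 1) → γ))) := by
    rw [Finset.sum_sub_distrib, ← Finsupp.mapDomain_finsetSum (s := A) (v := yc), hzero,
      Finsupp.mapDomain_zero, sub_zero]
    simp only [hsnoc]
    exact hsum
  rw [hfin]
  exact sum_mem fun c _ => hS c _ (hyc c)

/-- The colours of the cycle obtained from a family of paths, if one of the paths appends `v` and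
all other ones end in the colour `c`. -/
lemma exists_isCycle_of_paths {E : Type*} [Fintype E] (sgn : E → ℤ) (ε₀ : E)
    (hsgn : IsUnit (sgn ε₀)) (path : E → (Fin k → α) → (Fin (k + 1) → α))
    (col : α → γ) (v : α) (c : γ) {z : (Fin k → α) →₀ ℤ}
    (hZ : IsCycle (∑ ε, sgn ε • z.mapDomain (path ε)))
    (h0 : ∀ f ∈ z.support, path ε₀ f = Fin.snoc f v)
    (h1 : ∀ ε ≠ ε₀, ∀ f ∈ z.support, col (path ε f (Fin.last k)) = c) :
    ∃ Z : (Fin (k + 1) → α) →₀ ℤ, IsCycle Z ∧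
      (∀ F ∈ Z.support, ∃ ε, ∃ f ∈ z.support, F = path ε f) ∧
      Z.mapDomain (col ∘ ·) =
        (z.mapDomain (col ∘ ·)).mapDomain (fun f => (Fin.snoc f c : Fin (k + 1) → γ)) -
        (z.mapDomain (col ∘ ·)).mapDomain (fun f => (Fin.snoc f (col v) : Fin (k + 1) → γ)) := by
  classical
  set Z := ∑ ε, sgn ε • z.mapDomain (path ε) with hZdef
  have hsq : sgn ε₀ * sgn ε₀ = 1 := Int.isUnit_mul_self hsgn
  refine ⟨(- sgn ε₀) • Z, hZ.smul _, fun F hF => ?_, ?_⟩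
  · have hF1 := Finsupp.support_smul hF
    obtain ⟨ε, -, hε⟩ := Finset.mem_biUnion.mp (Finsupp.support_finsetSum hF1)
    obtain ⟨f, hf, rfl⟩ := Finset.mem_image.mp (Finsupp.mapDomain_support (Finsupp.support_smul hε))
    exact ⟨ε, f, hf, rfl⟩
  · have key := (hZ.mapDomain_comp col).eq_of_last (z.mapDomain (col ∘ ·)) (sgn ε₀) (col v) c ?_
    · rw [Finsupp.mapDomain_smul, key, smul_smul, neg_mul, hsq, neg_one_smul, neg_sub]
    · have h2 : (z.mapDomain (col ∘ ·)).mapDomain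
          (fun f => (Fin.snoc f (col v) : Fin (k + 1) → γ)) =
          (z.mapDomain (path ε₀)).mapDomain (col ∘ ·) := by
        rw [← Finsupp.mapDomain_comp, ← Finsupp.mapDomain_comp]
        refine Finsupp.mapDomain_congr fun f hf => ?_
        simp only [Function.comp_apply]
        rw [h0 f hf, Fin.comp_snoc]
      have h3 : Z.mapDomain (col ∘ ·) - sgn ε₀ • (z.mapDomain (col ∘ ·)).mapDomain
          (fun f => (Fin.snoc f (col v) : Fin (k + 1) → γ)) =
          ∑ ε ∈ Finset.univ.erase ε₀, sgn ε • (z.mapDomain (path ε)).mapDomain (col ∘ ·) := by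
        rw [h2, hZdef, Finsupp.mapDomain_finsetSum,
          ← Finset.add_sum_erase _ _ (Finset.mem_univ ε₀)]
        simp only [Finsupp.mapDomain_smul]
        rw [add_sub_cancel_left]
      intro F hF
      rw [h3] at hF
      obtain ⟨ε, hε, hF⟩ := Finset.mem_biUnion.mp (Finsupp.support_finsetSum hF)
      obtain ⟨g, hg, rfl⟩ :=
        Finset.mem_image.mp (Finsupp.mapDomain_support (Finsupp.support_smul hF))
      obtain ⟨f, hf, rfl⟩ := Finset.mem_image.mp (Finsupp.mapDomain_support hg)
      exact h1 ε (Finset.ne_of_mem_erase hε) f hf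

/-! ### Cycles on longer tuples: prisms and words. -/

/-- The sequence `b, f 0, …, f (k - 1), v, v, …`. -/
def extendTuple (b v : α) (f : Fin k → α) (i : ℕ) : α :=
  if i = 0 then b else if h : i - 1 < k then f ⟨i - 1, h⟩ else v

lemma extendTuple_zero (b v : α) (f : Fin k → α) : extendTuple b v f 0 = b := by
  simp [extendTuple]

lemma extendTuple_succ (b v : α) (f : Fin k → α) (i : Fin k) :
    extendTuple b v f (i + 1) = f i := by
  simp [extendTuple]

lemma extendTuple_of_lt (b v : α) (f : Fin k → α) {i : ℕ} (hi : k < i) :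
    extendTuple b v f i = v := by
  have h1 : i ≠ 0 := by omega
  have h2 : ¬ i - 1 < k := by omega
  simp [extendTuple, h1, h2]

lemma extendTuple_congr (b v : α) {f f' : Fin k → α} {i : Fin k} (h : dropAt i f = dropAt i f')
    {j : ℕ} (hj : j ≠ i + 1) : extendTuple b v f j = extendTuple b v f' j := by
  unfold extendTuple
  split_ifs with h1 h2
  · rfl
  · refine congrFun h ⟨⟨j - 1, h2⟩, fun h3 => hj ?_⟩
    have := congrArg Fin.val h3
    simp only at this
    omega
  · rfl

lemma snoc_eq_extendTuple (b v : α) (f : Fin k → α) :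
    (Fin.snoc f v : Fin (k + 1) → α) = fun t : Fin (k + 1) => extendTuple b v f (t + 1) := by
  funext t
  refine Fin.lastCases ?_ (fun i => ?_) t
  · rw [Fin.snoc_last, extendTuple_of_lt]
    simp
  · rw [Fin.snoc_castSucc]
    exact (extendTuple_succ b v f i).symm

/-- The prism paths `f 0, …, f (a - 1), g (f (a - 1)), …, g (f (k - 1))`. -/
def prismPath (b v : α) (g : α → α) (a : Fin (k + 2)) (f : Fin k → α) : Fin (k + 1) → α :=
  fun t => if (t : ℕ) < a then extendTuple b v f (t + 1) else g (extendTuple b v f t)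

/-- Away from position `s`, the terms `a = s` and `a = s + 1` coincide and have opposite signs. In
every other term some entry of `f` occurs at position `s` only, namely `f (s - 1)` if `a < s` and `f
s` if `a > s + 1`, so the cycle condition on `z` in that direction kills it. -/
lemma isCycle_prismPath (b v : α) (g : α → α) {z : (Fin k → α) →₀ ℤ} (hz : IsCycle z) :
    IsCycle (∑ a : Fin (k + 2), (-1 : ℤ) ^ (a : ℕ) • z.mapDomain (prismPath b v g a)) := by
  refine isCycle_sum_paths (fun a : Fin (k + 2) => (-1 : ℤ) ^ (a : ℕ)) _ hz fun s =>
    ⟨Equiv.swap s.castSucc s.succ, Equiv.swap_apply_self _ _, fun a => ?_⟩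
  rcases lt_trichotomy (a : ℕ) s with h | h | h
  · left
    refine ⟨⟨s - 1, by omega⟩, fun f f' hf => ?_⟩
    funext ⟨t, ht⟩
    have ht' : (t : ℕ) ≠ s := fun h => ht (Fin.ext h)
    simp only [dropAt, prismPath]
    split_ifs with h1
    · exact extendTuple_congr b v hf (by simp only; omega)
    · rw [extendTuple_congr b v hf (by simp only; omega)]
  · right
    have ha : a = s.castSucc := Fin.ext h
    subst ha
    rw [Equiv.swap_apply_left]
    refine ⟨by simp [pow_succ], fun f => ?_⟩
    funext ⟨t, ht⟩
    have ht' : (t : ℕ) ≠ s := fun h => ht (Fin.ext h)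
    simp only [dropAt, prismPath, Fin.val_succ, Fin.val_castSucc]
    have : ((t : ℕ) < s + 1) ↔ (t : ℕ) < s := by omega
    simp only [this]
  · rcases eq_or_ne (a : ℕ) (s + 1) with h' | h'
    · right
      have ha : a = s.succ := Fin.ext h'
      subst ha
      rw [Equiv.swap_apply_right]
      refine ⟨by simp [pow_succ], fun f => ?_⟩
      funext ⟨t, ht⟩
      have ht' : (t : ℕ) ≠ s := fun h => ht (Fin.ext h)
      simp only [dropAt, prismPath, Fin.val_succ, Fin.val_castSucc]
      have : ((t : ℕ) < s + 1) ↔ (t : ℕ) < s := by omega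
      simp only [this]
    · left
      refine ⟨⟨s, by omega⟩, fun f f' hf => ?_⟩
      funext ⟨t, ht⟩
      have ht' : (t : ℕ) ≠ s := fun h => ht (Fin.ext h)
      simp only [dropAt, prismPath]
      split_ifs with h1
      · exact extendTuple_congr b v hf (by simp only; omega)
      · rw [extendTuple_congr b v hf (by simp only; omega)]

/-- The number of steps down among the first `t` letters of a word. -/
def downSteps (ε : Fin (k + 1) → Bool) (t : ℕ) : ℕ :=
  ∑ j : Fin (k + 1), if (j : ℕ) < t ∧ ε j = true then 1 else 0

lemma downSteps_zero (ε : Fin (k + 1) → Bool) : downSteps ε 0 = 0 := by simp [downSteps]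

lemma downSteps_succ (ε : Fin (k + 1) → Bool) (t : Fin (k + 1)) :
    downSteps ε (t + 1) = downSteps ε t + if ε t = true then 1 else 0 := by
  have : (if ε t = true then 1 else 0) =
      ∑ j : Fin (k + 1), if j = t then (if ε t = true then 1 else 0) else 0 := by simp
  rw [downSteps, downSteps, this, ← Finset.sum_add_distrib]
  refine Finset.sum_congr rfl fun j _ => ?_
  rcases eq_or_ne j t with rfl | h
  · simp
  · have h' : (j : ℕ) ≠ t := fun h' => h (Fin.ext h')
    have : (j : ℕ) < t + 1 ↔ (j : ℕ) < t := by omega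
    simp [h, this]

lemma downSteps_mono (ε : Fin (k + 1) → Bool) {t t' : ℕ} (h : t ≤ t') :
    downSteps ε t ≤ downSteps ε t' := by
  refine Finset.sum_le_sum fun j _ => ?_
  split_ifs with h1 h2
  · exact le_rfl
  · exact absurd ⟨h1.1.trans_le h, h1.2⟩ h2
  · exact zero_le_one
  · exact le_rfl

lemma downSteps_le_add (ε : Fin (k + 1) → Bool) {t d : ℕ} (h : t + d ≤ k + 1) :
    downSteps ε (t + d) ≤ downSteps ε t + d := by
  induction d with
  | zero => simp
  | succ d ih =>
    have h1 := downSteps_succ ε ⟨t + d, by omega⟩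
    simp only at h1
    rw [← add_assoc, h1]
    have := ih (by omega)
    split_ifs <;> omega

lemma downSteps_le (ε : Fin (k + 1) → Bool) {t : ℕ} (h : t ≤ k + 1) : downSteps ε t ≤ t := by
  have := downSteps_le_add ε (t := 0) (d := t) (by omega)
  simpa [downSteps_zero] using this

lemma downSteps_swap (ε : Fin (k + 1) → Bool) {s s' : Fin (k + 1)} (hs : (s' : ℕ) = s + 1) {t : ℕ}
    (ht : t ≠ s + 1) : downSteps (ε ∘ Equiv.swap s s') t = downSteps ε t := by
  rw [downSteps, ← Equiv.sum_comp (Equiv.swap s s')]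
  refine Finset.sum_congr rfl fun j _ => ?_
  have : ((Equiv.swap s s' j : Fin (k + 1)) : ℕ) < t ↔ (j : ℕ) < t := by
    rcases eq_or_ne j s with rfl | h1
    · rw [Equiv.swap_apply_left]; omega
    · rcases eq_or_ne j s' with rfl | h2
      · rw [Equiv.swap_apply_right]; omega
      · rw [Equiv.swap_apply_of_ne_of_ne h1 h2]
  simp only [Function.comp_apply, Equiv.swap_apply_self, this]

/-- The sign of a word, seen as a signed permutation of minimal length. -/
def wordSign (ε : Fin (k + 1) → Bool) : ℤ :=
  ∏ j : Fin (k + 1), if ε j = true then (-1 : ℤ) ^ (k + 1 - (j : ℕ)) else 1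

/-- A down letter at position `j` contributes `k + 1 - j` to the exponent, so moving a single one by
one place changes the parity. -/
lemma wordSign_swap (ε : Fin (k + 1) → Bool) {s s' : Fin (k + 1)} (hs : (s' : ℕ) = s + 1)
    (h : ε s ≠ ε s') : wordSign (ε ∘ Equiv.swap s s') = - wordSign ε := by
  have hne : s ≠ s' := fun h' => by simp [h'] at hs
  have key : ∀ j, (if ε j = true then (-1 : ℤ) ^ (k + 1 - (Equiv.swap s s' j : ℕ)) else 1) =
      (if ε j = true then (-1 : ℤ) ^ (k + 1 - (j : ℕ)) else 1) *
        (if ε j = true ∧ (j = s ∨ j = s') then -1 else 1) := by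
    intro j
    by_cases hj : ε j = true
    · rcases eq_or_ne j s with rfl | h1
      · have h2 : k + 1 - (j : ℕ) = (k + 1 - (s' : ℕ)) + 1 := by omega
        simp [hj, h2, pow_succ]
      · rcases eq_or_ne j s' with rfl | h2
        · have h2 : k + 1 - (s : ℕ) = (k + 1 - (j : ℕ)) + 1 := by omega
          simp [hj, h2, pow_succ]
        · simp [hj, h1, h2, Equiv.swap_apply_of_ne_of_ne h1 h2]
    · simp [hj]
  rw [wordSign, ← Equiv.prod_comp (Equiv.swap s s')]
  simp only [Function.comp_apply, Equiv.swap_apply_self, key]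
  rw [Finset.prod_mul_distrib]
  have : (∏ j : Fin (k + 1), if ε j = true ∧ (j = s ∨ j = s') then (-1 : ℤ) else 1) = -1 := by
    cases h1 : ε s
    · have h2 : ε s' = true := by simpa [h1] using h
      rw [Finset.prod_eq_single s']
      · simp [h2]
      · intro j _ hj
        rw [if_neg]
        rintro ⟨h3, rfl | rfl⟩
        · simp [h1] at h3
        · exact hj rfl
      · simp
    · have h2 : ε s' = false := by simpa [h1] using h
      rw [Finset.prod_eq_single s]
      · simp [h1]
      · intro j _ hj
        rw [if_neg]
        rintro ⟨h3, rfl | rfl⟩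
        · exact hj rfl
        · simp [h2] at h3
      · simp
  rw [this, wordSign]
  ring

lemma wordSign_update_last (ε : Fin (k + 1) → Bool) :
    wordSign (Function.update ε (Fin.last k) (!ε (Fin.last k))) = - wordSign ε := by
  simp only [wordSign, Fin.prod_univ_castSucc]
  have h : ∀ j : Fin k, Function.update ε (Fin.last k) (!ε (Fin.last k)) j.castSucc =
      ε j.castSucc := fun j => Function.update_of_ne (Fin.castSucc_lt_last j).ne _ _
  simp only [h, Function.update_self, Fin.val_last]
  cases ε (Fin.last k) <;> simp

lemma downSteps_update_last (ε : Fin (k + 1) → Bool) (x : Bool) {t : ℕ} (ht : t ≤ k) :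
    downSteps (Function.update ε (Fin.last k) x) t = downSteps ε t := by
  refine Finset.sum_congr rfl fun j _ => ?_
  rcases eq_or_ne j (Fin.last k) with rfl | h
  · simp [ht.not_gt]
  · simp [h]

/-- The path from `b` that, along the word `ε`, moves `i` up or `j` down, starting with `(0, k+1)`,
through the elements `op (U i) (U j)` where `U` is the sequence `b, f 0, …, f (k - 1), v`. -/
def wordPath (b v : α) (op : α → α → α) (ε : Fin (k + 1) → Bool) (f : Fin k → α) :
    Fin (k + 1) → α :=
  fun t => op (extendTuple b v f (t + 1 - downSteps ε (t + 1)))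
    (extendTuple b v f (k + 1 - downSteps ε (t + 1)))

/-- The last vertex is the only one that sees the last letter, so flipping that letter cancels terms
there. At an earlier position `s`, exchanging the letters `s` and `s + 1` changes only vertex `s`,
and reverses the sign if they differ. If they agree, two consecutive steps move the same index, and
its intermediate value occurs at vertex `s` only: the indices `i` and `j` end at a common value, so
the other index never gets that far. Away from `s` an entry of `f` is then invisible. -/
lemma isCycle_wordPath (b v : α) (op : α → α → α) {z : (Fin k → α) →₀ ℤ} (hz : IsCycle z) :
    IsCycle (∑ ε : Fin (k + 1) → Bool, wordSign ε • z.mapDomain (wordPath b v op ε)) := by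
  refine isCycle_sum_paths wordSign _ hz fun s => ?_
  rcases eq_or_ne s (Fin.last k) with rfl | hs
  · refine ⟨fun ε => Function.update ε (Fin.last k) (!ε (Fin.last k)), fun ε => by simp,
      fun ε => Or.inr ⟨wordSign_update_last ε, fun f => ?_⟩⟩
    funext ⟨t, ht⟩
    have ht' : (t : ℕ) < k := Fin.val_lt_last ht
    simp only [dropAt, wordPath]
    rw [downSteps_update_last _ _ (by omega)]
  · have hsk : (s : ℕ) < k := Fin.val_lt_last hs
    set s' : Fin (k + 1) := ⟨s + 1, by omega⟩ with hs'
    have hss' : (s' : ℕ) = s + 1 := rfl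
    refine ⟨fun ε => ε ∘ Equiv.swap s s', fun ε => by funext j; simp, fun ε => ?_⟩
    have e1 := downSteps_succ ε s
    have e2 := downSteps_succ ε s'
    rw [hss'] at e2
    have e3 : downSteps ε (k + 1) ≤ downSteps ε (s + 1 + 1) + (k - 1 - s) := by
      have := downSteps_le_add ε (t := s + 1 + 1) (d := k - 1 - s) (by omega)
      rwa [show (s : ℕ) + 1 + 1 + (k - 1 - s) = k + 1 by omega] at this
    have e4 := downSteps_le ε (t := s) (by omega)
    have e5 := downSteps_mono ε (t := s + 1 + 1) (t' := k + 1) (by omega)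
    have e8 := downSteps_le ε (t := k + 1) le_rfl
    by_cases heq : ε s = ε s'
    · left
      cases hε : ε s
      · rw [hε] at heq
        simp only [hε, ← heq, Bool.false_eq_true, if_false] at e1 e2
        -- Two steps up: `i` takes the value `s + 1 - downSteps ε s` at vertex `s` only; the entry
        -- of `f` there is one lower, because the extended sequence starts with `b`.
        refine ⟨⟨s - downSteps ε s, by omega⟩, fun f f' hf => ?_⟩
        funext ⟨t, ht⟩
        have ht' : (t : ℕ) ≠ s := fun h => ht (Fin.ext h)
        have e6 := downSteps_mono ε (t := t + 1) (t' := k + 1) (by omega)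
        have e7 := downSteps_le ε (t := t + 1) (by omega)
        simp only [dropAt, wordPath]
        rw [extendTuple_congr b v hf (j := k + 1 - downSteps ε (t + 1)) (by simp only; omega),
          extendTuple_congr b v hf]
        simp only
        rcases lt_or_gt_of_ne ht' with h | h
        · have := downSteps_le_add ε (t := t + 1) (d := s - (t + 1)) (by omega)
          rw [show (t : ℕ) + 1 + (s - (t + 1)) = s by omega] at this
          have := downSteps_mono ε (t := t + 1) (t' := s) (by omega)
          omega
        · have := downSteps_le_add ε (t := s + 1 + 1) (d := t - (s + 1)) (by omega)
          rw [show (s : ℕ) + 1 + 1 + (t - (s + 1)) = t + 1 by omega] at this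
          omega
      · rw [hε] at heq
        simp only [hε, ← heq, if_true] at e1 e2
        -- Two steps down: `j` takes the value `k - downSteps ε s` at vertex `s` only.
        refine ⟨⟨k - 1 - downSteps ε s, by omega⟩, fun f f' hf => ?_⟩
        funext ⟨t, ht⟩
        have ht' : (t : ℕ) ≠ s := fun h => ht (Fin.ext h)
        have e6 := downSteps_mono ε (t := t + 1) (t' := k + 1) (by omega)
        have e7 := downSteps_le ε (t := t + 1) (by omega)
        have e9 : downSteps ε (k + 1) ≤ downSteps ε (t + 1) + (k - t) := by
          have := downSteps_le_add ε (t := t + 1) (d := k - t) (by omega)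
          rwa [show (t : ℕ) + 1 + (k - t) = k + 1 by omega] at this
        simp only [dropAt, wordPath]
        rw [extendTuple_congr b v hf (j := t + 1 - downSteps ε (t + 1)) (by simp only; omega),
          extendTuple_congr b v hf]
        simp only
        rcases lt_or_gt_of_ne ht' with h | h
        · have := downSteps_mono ε (t := t + 1) (t' := s) (by omega)
          omega
        · have := downSteps_mono ε (t := s + 1 + 1) (t' := t + 1) (by omega)
          omega
    · right
      refine ⟨wordSign_swap ε hss' heq, fun f => ?_⟩
      funext ⟨t, ht⟩
      have ht' : (t : ℕ) ≠ s := fun h => ht (Fin.ext h)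
      simp only [dropAt, wordPath]
      rw [downSteps_swap ε hss' (by omega)]

lemma downSteps_const_false (t : ℕ) : downSteps (fun _ : Fin (k + 1) => false) t = 0 := by
  simp [downSteps]

lemma downSteps_pos {ε : Fin (k + 1) → Bool} (h : ε ≠ fun _ => false) :
    0 < downSteps ε (k + 1) := by
  obtain ⟨j, hj⟩ := Function.ne_iff.mp h
  refine Finset.sum_pos' (fun _ _ => Nat.zero_le _) ⟨j, Finset.mem_univ _, ?_⟩
  have : ε j = true := by simpa using hj
  simp [this, j.2]

lemma wordSign_const_false : wordSign (fun _ : Fin (k + 1) => false) = 1 := by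
  simp [wordSign]

end TupleCycles

end SymplecticBuilding

/-! ### Top homology of `X_n(C)` -/

namespace SymplecticBuilding

open Finsupp

section RestrictTuples

variable {C : Type*} {n : ℕ}

/-- The tuples without entry `c₀`, as tuples of elements different from `c₀`. -/
def avoidEmb (c₀ : C) (n : ℕ) : (Fin n → {c : C // c ≠ c₀}) ↪ (Fin n → C) :=
  ⟨fun g i => g i, fun g g' h => by
    funext i
    exact Subtype.ext (congrFun h i)⟩

/-- Induction on the number of entries equal to `c₀`: if `f s = c₀`, every other tuple on the line
through `f` in direction `s` has fewer such entries, so the vanishing sum along that line reduces to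
`y f`. -/
lemma eq_zero_of_comapDomain_avoidEmb {c₀ : C} {y : (Fin n → C) →₀ ℤ} (hy : IsCycle y)
    (h : y.comapDomain (avoidEmb c₀ n) (avoidEmb c₀ n).injective.injOn = 0) : y = 0 := by
  classical
  have key : ∀ (m : ℕ) (f : Fin n → C), (Finset.univ.filter fun i => f i = c₀).card = m →
      y f = 0 := by
    intro m
    induction m using Nat.strong_induction_on with
    | _ m ih =>
      intro f hf
      by_cases hs : ∃ s, f s = c₀
      · obtain ⟨s, hs⟩ := hs
        have h0 := DFunLike.congr_fun (hy s) (dropAt s f)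
        rw [Finsupp.mapDomain, Finsupp.sum_apply, Finsupp.zero_apply, Finsupp.sum] at h0
        by_contra hne
        rw [Finset.sum_eq_single_of_mem f (Finsupp.mem_support_iff.mpr hne)] at h0
        · rw [Finsupp.single_eq_same] at h0
          exact hne h0
        · intro g hg hgf
          rw [Finsupp.single_apply, if_neg]
          intro heq
          have hoff : ∀ j ≠ s, g j = f j := fun j hj => congrFun heq ⟨j, hj⟩
          have hgs : g s ≠ c₀ := by
            intro h2
            refine hgf (funext fun j => ?_)
            rcases eq_or_ne j s with rfl | hj
            · rw [h2, hs]
            · exact hoff j hj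
          refine (Finsupp.mem_support_iff.mp hg) (ih _ ?_ g rfl)
          rw [← hf]
          refine Finset.card_lt_card ⟨fun j hj => ?_, fun hsub => ?_⟩
          · simp only [Finset.mem_filter, Finset.mem_univ, true_and] at hj ⊢
            rcases eq_or_ne j s with rfl | hjs
            · exact hs
            · rw [← hoff j hjs, hj]
          · have : s ∈ Finset.univ.filter fun i => g i = c₀ := hsub (by simp [hs])
            simp only [Finset.mem_filter, Finset.mem_univ, true_and] at this
            exact hgs this
      · push Not at hs
        exact DFunLike.congr_fun h (fun i => (⟨f i, hs i⟩ : {c : C // c ≠ c₀}))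
  exact Finsupp.ext fun f => key _ f rfl

/-- The tuple `g` with the entries in `S` replaced by `c₀`. -/
def replaceOn [DecidableEq (Fin n)] (c₀ : C) (g : Fin n → C) (S : Finset (Fin n)) : Fin n → C :=
  fun i => if i ∈ S then c₀ else g i

/-- The fundamental cycle `⨂ᵢ ([g i] - [c₀])`. -/
noncomputable def crossCycle (c₀ : C) (g : Fin n → C) : (Fin n → C) →₀ ℤ :=
  ∑ S : Finset (Fin n), Finsupp.single (replaceOn c₀ g S) ((-1 : ℤ) ^ S.card)

/-- Toggling whether `s` belongs to `S` changes the sign and affects the `s`-th entry only. -/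
lemma isCycle_crossCycle (c₀ : C) (g : Fin n → C) : IsCycle (crossCycle c₀ g) := by
  classical
  intro s
  rw [crossCycle, Finsupp.mapDomain_finsetSum]
  simp only [Finsupp.mapDomain_single]
  refine Finset.sum_involution (fun S _ => if s ∈ S then S.erase s else insert s S)
    (fun S _ => ?_) (fun S _ _ h => ?_) (fun _ _ => Finset.mem_univ _) (fun S _ => ?_)
  · have h1 : dropAt s (replaceOn c₀ g (if s ∈ S then S.erase s else insert s S)) =
        dropAt s (replaceOn c₀ g S) := by
      funext ⟨j, hj⟩
      simp only [dropAt, replaceOn]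
      split_ifs with h2 <;> simp_all
    rw [h1, ← Finsupp.single_add]
    split_ifs with h2
    · rw [← Finset.card_erase_add_one h2, pow_succ]
      simp
    · rw [Finset.card_insert_of_notMem h2, pow_succ]
      simp
  · split_ifs at h with h2
    · exact (Finset.erase_eq_self.mp h) h2
    · exact h2 (Finset.insert_eq_self.mp h)
  · by_cases h2 : s ∈ S <;> simp [h2]

lemma comapDomain_crossCycle (c₀ : C) (g : Fin n → {c : C // c ≠ c₀}) :
    (crossCycle c₀ (avoidEmb c₀ n g)).comapDomain (avoidEmb c₀ n)
      (avoidEmb c₀ n).injective.injOn = Finsupp.single g 1 := by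
  classical
  ext g'
  rw [Finsupp.comapDomain_apply, crossCycle, Finsupp.finsetSum_apply,
    Finset.sum_eq_single_of_mem ∅ (Finset.mem_univ _)]
  · have : replaceOn c₀ (avoidEmb c₀ n g) ∅ = avoidEmb c₀ n g := by
      funext i
      simp [replaceOn]
    rw [this, Finsupp.single_apply, Finsupp.single_apply]
    simp only [(avoidEmb c₀ n).injective.eq_iff, Finset.card_empty, pow_zero]
  · intro S _ hS
    rw [Finsupp.single_apply, if_neg]
    intro h
    obtain ⟨s, hs⟩ := Finset.nonempty_iff_ne_empty.mpr hS
    have := congrFun h s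
    simp only [replaceOn, hs, if_true] at this
    exact (g' s).2 this.symm

/-- The submodule of cycles. -/
def cycleSubmodule (C : Type*) (n : ℕ) : Submodule ℤ ((Fin n → C) →₀ ℤ) where
  carrier := {y | IsCycle y}
  zero_mem' := IsCycle.zero
  add_mem' := IsCycle.add
  smul_mem' a _ h := h.smul a

/-- Cycles are determined by their values on the tuples avoiding `c₀`, which are arbitrary. -/
lemma exists_cycleSubmodule_equiv (c₀ : C) (n : ℕ) :
    Nonempty (cycleSubmodule C n ≃ₗ[ℤ] ((Fin n → {c : C // c ≠ c₀}) →₀ ℤ)) := by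
  let res : ((Fin n → C) →₀ ℤ) →ₗ[ℤ] ((Fin n → {c : C // c ≠ c₀}) →₀ ℤ) :=
    Finsupp.lcomapDomain (avoidEmb c₀ n) (avoidEmb c₀ n).injective
  refine ⟨LinearEquiv.ofBijective (res.comp (cycleSubmodule C n).subtype) ⟨?_, ?_⟩⟩
  · rw [← LinearMap.ker_eq_bot, LinearMap.ker_eq_bot']
    rintro ⟨y, hy⟩ h
    exact Subtype.ext (eq_zero_of_comapDomain_avoidEmb hy h)
  · rw [← LinearMap.range_eq_top, eq_top_iff]
    rintro x -
    induction x using Finsupp.induction_linear with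
    | zero => exact zero_mem _
    | add x y hx hy => exact add_mem hx hy
    | single g a =>
      have : Finsupp.single g a = a • Finsupp.single g (1 : ℤ) := by simp
      rw [this]
      exact Submodule.smul_mem _ _ ⟨⟨_, isCycle_crossCycle c₀ (avoidEmb c₀ n g)⟩,
        comapDomain_crossCycle c₀ g⟩

end RestrictTuples

/-! ### Chains of posets and cycles on tuples. -/

section Glue

variable {P Q C : Type*} [PartialOrder P] [PartialOrder Q] {q : ℕ}

lemma boundary_apply (q : ℕ) (z : OrderChain P (q + 1)) :
    boundary P q z = ∑ i : Fin (q + 1), (-1 : ℤ) ^ (i : ℕ) • z.mapDomain fun c => c.face i := by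
  induction z using Finsupp.induction_linear with
  | zero => simp
  | add x y hx hy =>
    simp only [map_add, hx, hy, Finsupp.mapDomain_add, smul_add, Finset.sum_add_distrib]
  | single c a =>
    simp only [boundary_single, Finsupp.mapDomain_single, Finset.smul_sum, Finsupp.smul_single,
      smul_eq_mul, mul_comm]

/-- The restriction of a `(q+1)`-tuple away from `s` determines the tuple with `s`-th entry
removed, and conversely. -/
lemma dropAt_eq_iff {α : Type*} {s : Fin (q + 1)} {f f' : Fin (q + 1) → α} :
    dropAt s f = dropAt s f' ↔ f ∘ s.succAbove = f' ∘ s.succAbove := by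
  constructor
  · intro h
    funext j
    exact congrFun h ⟨s.succAbove j, Fin.succAbove_ne s j⟩
  · intro h
    funext ⟨j, hj⟩
    obtain ⟨i, rfl⟩ := Fin.exists_succAbove_eq hj
    exact congrFun h i

lemma mapDomain_face_eq_zero_iff (z : OrderChain P (q + 1)) (s : Fin (q + 1)) :
    (z.mapDomain fun c => c.face s) = 0 ↔
      (z.mapDomain (fun c => c.1)).mapDomain (dropAt s) = 0 := by
  rw [← Finsupp.mapDomain_comp]
  constructor
  · refine mapDomain_eq_zero_of_factorsThrough fun c c' h => ?_
    exact dropAt_eq_iff.mpr (congrArg Subtype.val h)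
  · refine mapDomain_eq_zero_of_factorsThrough fun c c' h => ?_
    exact Subtype.ext (dropAt_eq_iff.mp h)

/-- Only this direction holds for a general poset: there, faces obtained by deleting different
vertices might cancel against each other, whereas a cycle on tuples kills each deletion separately.
-/
lemma boundary_eq_zero_of_isCycle {z : OrderChain P (q + 1)}
    (hz : IsCycle (z.mapDomain fun c => c.1)) : boundary P q z = 0 := by
  rw [boundary_apply]
  refine Finset.sum_eq_zero fun s _ => ?_
  rw [(mapDomain_face_eq_zero_iff z s).mpr (hz s), smul_zero]

/-- A chain of `n` vertices meets each of the `n` levels: climbing from the bottom bounds the level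
from below, descending from the top bounds it from above. -/
lemma xposet_level_eq {n : ℕ} (c : Flag (XPoset n C) n) (i : Fin n) :
    ((c.1 i).level : ℕ) = i + 1 := by
  have hc : ∀ {i j : Fin n}, i < j → ((c.1 i).level : ℕ) < (c.1 j).level := fun h => c.2 h
  have h1 : ∀ m (hm : m < n), m + 1 ≤ ((c.1 ⟨m, hm⟩).level : ℕ) := by
    intro m
    induction m with
    | zero => exact fun hm => (c.1 ⟨0, hm⟩).level.2.1
    | succ m ih =>
      intro hm
      have h2 := ih (by omega)
      have h3 := hc (i := ⟨m, by omega⟩) (j := ⟨m + 1, hm⟩) (by simp)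
      omega
  have h2 : ∀ d m (hm : m < n), m + 1 + d = n → ((c.1 ⟨m, hm⟩).level : ℕ) ≤ m + 1 := by
    intro d
    induction d with
    | zero =>
      intro m hm h
      have := (c.1 ⟨m, hm⟩).level.2.2
      omega
    | succ d ih =>
      intro m hm h
      have h2 := ih (m + 1) (by omega) (by omega)
      have h3 := hc (i := ⟨m, hm⟩) (j := ⟨m + 1, by omega⟩) (by simp)
      omega
  exact le_antisymm (h2 (n - 1 - i) i i.2 (by omega)) (h1 i i.2)

/-- The maximal chains of `X_n(C)` are the `n`-tuples of elements of `C`. -/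
def xposetFlagEquiv (n : ℕ) (C : Type*) : Flag (XPoset n C) n ≃ (Fin n → C) where
  toFun c i := (c.1 i).color
  invFun f := ⟨fun i => ⟨⟨i + 1, by simp⟩, f i⟩, fun i j h => by
    change (⟨(i : ℕ) + 1, _⟩ : Set.Icc 1 n) < ⟨(j : ℕ) + 1, _⟩
    exact Subtype.mk_lt_mk.mpr (Nat.succ_lt_succ h)⟩
  left_inv c := by
    refine Subtype.ext (funext fun i => XPoset.ext (Subtype.ext ?_) rfl)
    exact (xposet_level_eq c i).symm
  right_inv f := rfl

lemma xposet_face_index {c c' : Flag (XPoset (q + 1) C) (q + 1)} {s s' : Fin (q + 1)}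
    (h : c.face s = c'.face s') : s = s' := by
  refine Fin.succAbove_left_injective (funext fun j => Fin.ext ?_)
  have h1 : (c.1 (s.succAbove j)) = c'.1 (s'.succAbove j) := congrFun (congrArg Subtype.val h) j
  have h2 := xposet_level_eq c (s.succAbove j)
  have h3 := xposet_level_eq c' (s'.succAbove j)
  rw [h1] at h2
  omega

/-- The levels occurring in a face of a maximal chain reveal which vertex was deleted, so the
summands of the boundary have disjoint supports and must vanish separately. -/
lemma isCycle_xposet_iff (z : OrderChain (XPoset (q + 1) C) (q + 1)) :
    boundary _ q z = 0 ↔ IsCycle (z.mapDomain (xposetFlagEquiv (q + 1) C)) := by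
  have hcol : z.mapDomain (xposetFlagEquiv (q + 1) C) =
      (z.mapDomain fun c => c.1).mapDomain (XPoset.color ∘ ·) := by
    rw [← Finsupp.mapDomain_comp]
    rfl
  constructor
  · intro h
    rw [hcol]
    refine IsCycle.mapDomain_comp (fun s => ?_) _
    rw [← mapDomain_face_eq_zero_iff]
    ext d
    by_contra hd
    rw [Finsupp.zero_apply] at hd
    classical
    obtain ⟨c, -, rfl⟩ := Finset.mem_image.mp
      (Finsupp.mapDomain_support (Finsupp.mem_support_iff.mpr hd))
    have h1 := DFunLike.congr_fun h (c.face s)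
    rw [boundary_apply, Finsupp.finsetSum_apply, Finset.sum_eq_single_of_mem s (Finset.mem_univ _)]
      at h1
    · simp only [Finsupp.smul_apply, Finsupp.zero_apply, smul_eq_mul, mul_eq_zero] at h1
      exact hd (h1.resolve_left (by simp))
    · intro s' _ hs'
      rw [Finsupp.smul_apply]
      convert smul_zero _
      refine Finsupp.mapDomain_of_notMem_range _ _ ?_
      rintro ⟨c', hc'⟩
      exact hs' (xposet_face_index hc')
  · intro h
    rw [boundary_apply]
    refine Finset.sum_eq_zero fun s _ => ?_
    have h1 : (z.mapDomain fun c => c.face s) = 0 := by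
      have h2 := h s
      rw [← Finsupp.mapDomain_comp] at h2
      refine mapDomain_eq_zero_of_factorsThrough (fun c c' hcc => ?_) h2
      refine Subtype.ext (funext fun j => XPoset.ext (Subtype.ext ?_) ?_)
      · exact (xposet_level_eq c _).trans (xposet_level_eq c' _).symm
      · exact congrFun hcc ⟨s.succAbove j, Fin.succAbove_ne s j⟩
    rw [h1, smul_zero]

lemma isEmpty_flag_xposet (n : ℕ) : IsEmpty (Flag (XPoset n C) (n + 1)) := by
  constructor
  intro c
  have h1 := xposet_level_eq (⟨c.1 ∘ Fin.castSucc, c.2.comp Fin.strictMono_castSucc⟩ :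
    Flag (XPoset n C) n)
  rcases n with _ | n
  · have := (c.1 0).level.2
    simp at this
  · have h2 := h1 (Fin.last n)
    have h3 : ((c.1 (Fin.last n).castSucc).level : ℕ) < (c.1 (Fin.last (n + 1))).level :=
      c.2 (Fin.castSucc_lt_last _)
    have h4 := (c.1 (Fin.last (n + 1))).level.2.2
    simp only [Function.comp_apply, Fin.val_last] at h2
    omega

lemma range_toCycles_xposet (q : ℕ) :
    LinearMap.range (toCycles (XPoset (q + 1) C) q) = ⊥ := by
  have := isEmpty_flag_xposet (C := C) (q + 1)
  rw [LinearMap.range_eq_bot]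
  ext c
  exact (this.false c).elim

/-- The top homology of `X_n(C)` is the group of cycles on `n`-tuples. -/
lemma exists_homology_xposet_equiv (q : ℕ) (C : Type*) :
    Nonempty (ReducedHomology (XPoset (q + 1) C) q ≃ₗ[ℤ] cycleSubmodule C (q + 1)) := by
  let e : OrderChain (XPoset (q + 1) C) (q + 1) ≃ₗ[ℤ] ((Fin (q + 1) → C) →₀ ℤ) :=
    Finsupp.domLCongr (xposetFlagEquiv (q + 1) C)
  have he : ∀ z, e z = z.mapDomain (xposetFlagEquiv (q + 1) C) := fun z =>
    Finsupp.equivMapDomain_eq_mapDomain _ _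
  refine ⟨(Submodule.quotEquivOfEqBot _ (range_toCycles_xposet q)).trans
    (e.ofSubmodules _ _ ?_)⟩
  ext y
  rw [Submodule.mem_map_equiv, LinearMap.mem_ker, isCycle_xposet_iff, ← he, e.apply_symm_apply]
  rfl

lemma homologyMap_comp {S : Type*} [PartialOrder S] (f : P → Q) (hf : StrictMono f) (g : Q → S)
    (hg : StrictMono g) (q : ℕ) (x : ReducedHomology P q) :
    homologyMap (g ∘ f) (hg.comp hf) q x = homologyMap g hg q (homologyMap f hf q x) := by
  obtain ⟨⟨z, hz⟩, rfl⟩ := Submodule.mkQ_surjective _ x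
  refine congrArg (Submodule.mkQ (LinearMap.range (toCycles S q))) (Subtype.ext ?_)
  exact Finsupp.mapDomain_comp (v := z) (f := Flag.map f hf) (g := Flag.map g hg)

lemma homologyMap_id (q : ℕ) (x : ReducedHomology P q) :
    homologyMap id strictMono_id q x = x := by
  obtain ⟨⟨z, hz⟩, rfl⟩ := Submodule.mkQ_surjective _ x
  refine congrArg (Submodule.mkQ (LinearMap.range (toCycles P q))) (Subtype.ext ?_)
  exact Finsupp.mapDomain_id

lemma bijective_homologyMap_orderIso (Φ : P ≃o Q) (q : ℕ) :
    Function.Bijective (homologyMap Φ Φ.strictMono q) := by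
  have h1 : ∀ x, homologyMap Φ.symm Φ.symm.strictMono q (homologyMap Φ Φ.strictMono q x) = x := by
    intro x
    rw [← homologyMap_comp]
    convert homologyMap_id q x
    funext y
    simp
  have h2 : ∀ x, homologyMap Φ Φ.strictMono q (homologyMap Φ.symm Φ.symm.strictMono q x) = x := by
    intro x
    rw [← homologyMap_comp]
    convert homologyMap_id q x
    funext y
    simp
  exact ⟨Function.LeftInverse.injective h1, Function.RightInverse.surjective h2⟩

/-- A strictly increasing map to `X_n(C)` is surjective on top homology if every cycle on tuples
of colours lifts to a cycle on tuples of vertices that is supported on chains. -/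
lemma surjective_homologyMap_of_lift (ψ : P → XPoset (q + 1) C) (hψ : StrictMono ψ)
    (h : ∀ y : (Fin (q + 1) → C) →₀ ℤ, IsCycle y → ∃ z : (Fin (q + 1) → P) →₀ ℤ, IsCycle z ∧
      (∀ f ∈ z.support, StrictMono f) ∧ z.mapDomain ((fun p => (ψ p).color) ∘ ·) = y) :
    Function.Surjective (homologyMap ψ hψ q) := by
  intro x
  obtain ⟨⟨y, hy⟩, rfl⟩ := Submodule.mkQ_surjective _ x
  rw [LinearMap.mem_ker, isCycle_xposet_iff] at hy
  obtain ⟨z, hz, hsupp, hzy⟩ := h _ hy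
  let w : OrderChain P (q + 1) := z.comapDomain (fun c : Flag P (q + 1) => c.1)
    Subtype.val_injective.injOn
  have hw : (w.mapDomain fun c => c.1) = z := by
    refine Finsupp.mapDomain_comapDomain _ Subtype.val_injective _ fun f hf => ?_
    exact ⟨⟨f, hsupp f hf⟩, rfl⟩
  have hw0 : boundary P q w = 0 := boundary_eq_zero_of_isCycle (by rwa [hw])
  refine ⟨Submodule.Quotient.mk ⟨w, hw0⟩, ?_⟩
  refine congrArg (Submodule.mkQ (LinearMap.range (toCycles (XPoset (q + 1) C) q)))
    (Subtype.ext ?_)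
  refine Finsupp.mapDomain_injective (xposetFlagEquiv (q + 1) C).injective ?_
  rw [← hzy, ← hw, ← Finsupp.mapDomain_comp]
  exact Finsupp.mapDomain_comp.symm

end Glue

end SymplecticBuilding

/-! ### Ideals of a Dedekind domain -/

namespace SymplecticBuilding

open Module

section Ideals

variable {R : Type*} [CommRing R] [IsDedekindDomain R]

/-- Every ideal class contains an ideal `J = (a, b)` with `b ∈ β J`. -/
lemma exists_two_generators {β : R} (hβ : β ≠ 0) (x : ClassGroup R) :
    ∃ (J : nonZeroDivisors (Ideal R)) (a b : R), ClassGroup.mk0 J = x ∧ a ≠ 0 ∧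
      Ideal.span {a} ⊔ Ideal.span {b} = (J : Ideal R) ∧ b ∈ Ideal.span {β} * (J : Ideal R) := by
  obtain ⟨J, rfl⟩ := ClassGroup.mk0_surjective x
  have hJ : (J : Ideal R) ≠ 0 := mem_nonZeroDivisors_iff_ne_zero.mp J.2
  have hβJ : Ideal.span {β} * (J : Ideal R) ≠ 0 :=
    mul_ne_zero (by simpa using hβ) hJ
  -- Modulo `βJ` the ideal `J` is generated by one element `a`. If that element is zero, then `J =
  -- βJ`, and any nonzero element of `βJ` serves instead.
  obtain ⟨a, ha0, ha⟩ : ∃ a, a ≠ 0 ∧ Ideal.span {β} * (J : Ideal R) ⊔ Ideal.span {a} = J := by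
    obtain ⟨a, ha⟩ := IsDedekindDomain.exists_sup_span_eq (Ideal.mul_le_right) hβJ
    by_cases h : a = 0
    · obtain ⟨a', ha', ha'0⟩ := Submodule.exists_mem_ne_zero_of_ne_bot hβJ
      refine ⟨a', ha'0, ?_⟩
      rw [h] at ha
      have h2 : Ideal.span {β} * (J : Ideal R) = J := by simpa using ha
      rw [sup_eq_left.mpr ((Ideal.span_singleton_le_iff_mem _).mpr ha'), h2]
    · exact ⟨a, h, ha⟩
  have hle : Ideal.span {a} * (Ideal.span {β} * (J : Ideal R)) ≤ Ideal.span {β} * J :=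
    Ideal.mul_le_right
  -- The same again inside `βJ`: from `βJ = aβJ + (b)` follows `J = (a) + aβJ + (b) = (a, b)`.
  obtain ⟨b, hb⟩ := IsDedekindDomain.exists_sup_span_eq hle
    (mul_ne_zero (by simpa using ha0) hβJ)
  refine ⟨J, a, b, rfl, ha0, ?_, ?_⟩
  · conv_rhs => rw [← ha, ← hb]
    rw [sup_comm _ (Ideal.span {a}), ← sup_assoc, sup_eq_left.mpr
      (Ideal.mul_le_left : Ideal.span {a} * (Ideal.span {β} * (J : Ideal R)) ≤ _)]
  · rw [← hb]
    exact Ideal.mem_sup_right (Ideal.mem_span_singleton_self b)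

/-- The content of a general member of a pencil spanned by two vectors. -/
lemma span_range_pencil {N : Type*} {p q : N → R} {β : R} {i j : N}
    (hm : p i * q j - p j * q i ∣ β) {J : Ideal R} {a b : R}
    (hJ : Ideal.span {a} ⊔ Ideal.span {b} = J) (hb : b ∈ Ideal.span {β} * J) :
    Ideal.span (Set.range fun k => a * p k + b * q k) = J * Ideal.span (Set.range p) := by
  set D := Ideal.span (Set.range fun k => a * p k + b * q k) with hD
  have haJ : a ∈ J := hJ ▸ Ideal.mem_sup_left (Ideal.mem_span_singleton_self a)
  obtain ⟨b', hb', rfl⟩ := Ideal.mem_span_singleton_mul.mp hb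
  obtain ⟨d, hd⟩ := hm
  have hp : ∀ k, p k ∈ Ideal.span (Set.range p) := fun k => Ideal.subset_span ⟨k, rfl⟩
  have hgen : ∀ k, a * p k + β * b' * q k ∈ D := fun k => Ideal.subset_span ⟨k, rfl⟩
  have hβp : β ∈ Ideal.span (Set.range p) := by
    rw [hd]
    exact Ideal.mul_mem_right _ _
      (sub_mem (Ideal.mul_mem_right _ _ (hp i)) (Ideal.mul_mem_right _ _ (hp j)))
  -- Cramer's rule in the coordinates `i` and `j` puts `a` and `b`, each multiplied by the minor,
  -- into `D`, and `β` is a multiple of the minor.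
  have hJβ : ∀ c ∈ J, c * β ∈ D := by
    intro c hc
    rw [← hJ, Ideal.span_singleton_eq_span_singleton.mpr (Associated.refl a)] at hc
    obtain ⟨c1, h1, c2, h2, rfl⟩ := Submodule.mem_sup.mp hc
    obtain ⟨r1, rfl⟩ := Ideal.mem_span_singleton'.mp h1
    obtain ⟨r2, rfl⟩ := Ideal.mem_span_singleton'.mp h2
    have e1 : (a * p i + β * b' * q i) * (q j * d) - (a * p j + β * b' * q j) * (q i * d) =
        a * β := by
      linear_combination (-a) * hd
    have e2 : (a * p j + β * b' * q j) * (p i * d) - (a * p i + β * b' * q i) * (p j * d) =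
        β * b' * β := by
      linear_combination (-β * b') * hd
    have h3 : a * β ∈ D := e1 ▸ sub_mem (Ideal.mul_mem_right _ _ (hgen i))
      (Ideal.mul_mem_right _ _ (hgen j))
    have h4 : β * b' * β ∈ D := e2 ▸ sub_mem (Ideal.mul_mem_right _ _ (hgen j))
      (Ideal.mul_mem_right _ _ (hgen i))
    rw [add_mul, mul_assoc, mul_assoc]
    exact add_mem (Ideal.mul_mem_left _ _ h3) (Ideal.mul_mem_left _ _ h4)
  -- Here `b = β * b'` with `b' ∈ J` is used: `b` itself lies in `D`, so the `q`-part of each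
  -- generator can be subtracted, leaving `a * p k`.
  have hβb : β * b' ∈ D := by
    rw [mul_comm]
    exact hJβ b' hb'
  refine le_antisymm (Ideal.span_le.mpr ?_) (Ideal.mul_le.mpr ?_)
  · rintro _ ⟨k, rfl⟩
    refine add_mem (Ideal.mul_mem_mul haJ (hp k)) ?_
    rw [mul_comm β b']
    exact Ideal.mul_mem_right _ _ (Ideal.mul_mem_mul hb' hβp)
  · intro c hc x hx
    have hle : Ideal.span (Set.range p) ≤ Submodule.comap (LinearMap.mulLeft R c) D := by
      refine Ideal.span_le.mpr ?_
      rintro _ ⟨k, rfl⟩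
      change c * p k ∈ D
      rw [← hJ] at hc
      obtain ⟨c1, h1, c2, h2, rfl⟩ := Submodule.mem_sup.mp hc
      obtain ⟨r1, rfl⟩ := Ideal.mem_span_singleton'.mp h1
      obtain ⟨r2, rfl⟩ := Ideal.mem_span_singleton'.mp h2
      have h3 : a * p k ∈ D := by
        have := sub_mem (hgen k) (Ideal.mul_mem_right (q k) _ hβb)
        rwa [add_sub_cancel_right] at this
      rw [add_mul, mul_assoc, mul_assoc]
      exact add_mem (Ideal.mul_mem_left _ _ h3)
        (Ideal.mul_mem_left _ _ (Ideal.mul_mem_right _ _ hβb))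
    exact hle hx

/-- Nonzero ideals in the same class are isomorphic modules. -/
lemma nonempty_linearEquiv_of_mk0_eq {I J : nonZeroDivisors (Ideal R)}
    (h : ClassGroup.mk0 I = ClassGroup.mk0 J) :
    Nonempty ((I : Ideal R) ≃ₗ[R] (J : Ideal R)) := by
  obtain ⟨x, y, hx, hy, hxy⟩ := ClassGroup.mk0_eq_mk0_iff.mp h
  have key : ∀ (A : Ideal R) (z : R), z ≠ 0 →
      Nonempty (A ≃ₗ[R] (Ideal.span {z} * A : Ideal R)) := by
    intro A z hz
    let f : A →ₗ[R] (Ideal.span {z} * A : Ideal R) :=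
      ((LinearMap.mulLeft R z).comp A.subtype).codRestrict _ fun c =>
        Ideal.mul_mem_mul (Ideal.mem_span_singleton_self z) c.2
    refine ⟨LinearEquiv.ofBijective f ⟨?_, ?_⟩⟩
    · intro c c' hcc
      exact Subtype.ext (mul_left_cancel₀ hz (congrArg Subtype.val hcc))
    · rintro ⟨c, hc⟩
      obtain ⟨d, hd, rfl⟩ := Ideal.mem_span_singleton_mul.mp hc
      exact ⟨⟨d, hd⟩, rfl⟩
  obtain ⟨e1⟩ := key I x hx
  obtain ⟨e2⟩ := key J y hy
  exact ⟨e1.trans ((LinearEquiv.ofEq _ _ hxy).trans e2.symm)⟩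

/-- `I × J ≅ R × IJ` up to a change of ideals. -/
lemma exists_prod_ideal_equiv (I J : nonZeroDivisors (Ideal R)) :
    ∃ L : nonZeroDivisors (Ideal R),
      Nonempty ((↥(I : Ideal R) × ↥(J : Ideal R)) ≃ₗ[R] R × ↥(L : Ideal R)) := by
  -- With `A` in the inverse class of `I` and `AJ + (a) = A`, the factorisation `(a) = AB` provides
  -- an ideal `B` coprime to `J` that lies in the class of `I` when it is nonzero. If `B = 0`,
  -- coprimality says `J = R`.
  obtain ⟨A, hA⟩ := ClassGroup.mk0_surjective (ClassGroup.mk0 I)⁻¹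
  have hA0 : (A : Ideal R) ≠ 0 := mem_nonZeroDivisors_iff_ne_zero.mp A.2
  have hJ0 : (J : Ideal R) ≠ 0 := mem_nonZeroDivisors_iff_ne_zero.mp J.2
  obtain ⟨a, ha⟩ := IsDedekindDomain.exists_sup_span_eq
    (Ideal.mul_le_left : (A : Ideal R) * J ≤ A) (mul_ne_zero hA0 hJ0)
  have haA : a ∈ (A : Ideal R) := ha ▸ Ideal.mem_sup_right (Ideal.mem_span_singleton_self a)
  obtain ⟨B, hB⟩ := Ideal.dvd_span_singleton.mpr haA
  have hcop : (J : Ideal R) ⊔ B = ⊤ := by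
    have : (A : Ideal R) * ((J : Ideal R) ⊔ B) = A * ⊤ := by
      rw [Ideal.mul_sup, ← hB, ha, Ideal.mul_top]
    exact mul_left_cancel₀ hA0 this
  by_cases hB0 : B = 0
  · have hJ : (J : Ideal R) = ⊤ := by simpa [hB0] using hcop
    exact ⟨I, ⟨(LinearEquiv.prodComm R _ _).trans
      (((LinearEquiv.ofEq _ _ hJ).trans Submodule.topEquiv).prodCongr (LinearEquiv.refl R _))⟩⟩
  let B' : nonZeroDivisors (Ideal R) := ⟨B, mem_nonZeroDivisors_iff_ne_zero.mpr hB0⟩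
  have hclass : ClassGroup.mk0 I = ClassGroup.mk0 B' := by
    have h1 : ClassGroup.mk0 (A * B') = 1 :=
      (ClassGroup.mk0_eq_one_iff (A * B').2).mpr ⟨⟨a, hB.symm⟩⟩
    rw [map_mul, hA, inv_mul_eq_one] at h1
    exact h1
  obtain ⟨e⟩ := nonempty_linearEquiv_of_mk0_eq hclass
  have hBJ0 : B * (J : Ideal R) ≠ 0 := mul_ne_zero hB0 hJ0
  refine ⟨⟨B * J, mem_nonZeroDivisors_iff_ne_zero.mpr hBJ0⟩,
    ⟨(e.prodCongr (LinearEquiv.refl R (J : Ideal R))).trans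
      (?_ : (↥B × ↥(J : Ideal R)) ≃ₗ[R] R × ↥(B * (J : Ideal R)))⟩⟩
  have hone : (1 : R) ∈ (J : Ideal R) ⊔ B := hcop ▸ Submodule.mem_top
  choose j hj b hb hjb using Submodule.mem_sup.mp hone
  -- Since `j + b = 1`, the map `(x, y) ↦ (x + y, jx - by)` is inverse to `(r, l) ↦ (br + l, jr -
  -- l)`.
  let f : (↥B × ↥(J : Ideal R)) →ₗ[R] ↥(B * (J : Ideal R)) :=
    (j • B.subtype.comp (LinearMap.fst R _ _) -
      b • (J : Ideal R).subtype.comp (LinearMap.snd R _ _)).codRestrict _ fun x => by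
    change j * (x.1 : R) - b * (x.2 : R) ∈ B * (J : Ideal R)
    rw [mul_comm j]
    exact sub_mem (Ideal.mul_mem_mul x.1.2 hj) (Ideal.mul_mem_mul hb x.2.2)
  let g : (R × ↥(B * (J : Ideal R))) →ₗ[R] B :=
    (b • LinearMap.fst R R _ + (B * (J : Ideal R)).subtype.comp
      (LinearMap.snd R R _)).codRestrict B fun x => by
    change b * x.1 + (x.2 : R) ∈ B
    exact add_mem (Ideal.mul_mem_right _ _ hb) (Ideal.mul_le_left x.2.2)
  let h : (R × ↥(B * (J : Ideal R))) →ₗ[R] (J : Ideal R) :=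
    (j • LinearMap.fst R R _ - (B * (J : Ideal R)).subtype.comp
      (LinearMap.snd R R _)).codRestrict (J : Ideal R) fun x => by
    change j * x.1 - (x.2 : R) ∈ (J : Ideal R)
    exact sub_mem (Ideal.mul_mem_right _ _ hj) (Ideal.mul_le_right x.2.2)
  refine LinearEquiv.ofLinearMap (LinearMap.prod (B.subtype.comp (LinearMap.fst R _ _) +
    (J : Ideal R).subtype.comp (LinearMap.snd R _ _)) f) (LinearMap.prod g h) ?_ ?_
  · refine LinearMap.ext fun ⟨r, l⟩ => Prod.ext ?_ (Subtype.ext ?_)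
    · change (b * r + (l : R)) + (j * r - (l : R)) = r
      linear_combination r * hjb
    · change j * (b * r + (l : R)) - b * (j * r - (l : R)) = l
      linear_combination (l : R) * hjb
  · refine LinearMap.ext fun ⟨x, y⟩ => Prod.ext (Subtype.ext ?_) (Subtype.ext ?_)
    · change b * ((x : R) + y) + (j * (x : R) - b * (y : R)) = x
      linear_combination (x : R) * hjb
    · change j * ((x : R) + y) - (j * (x : R) - b * (y : R)) = y
      linear_combination (y : R) * hjb

end Ideals

end SymplecticBuilding

/-! ### The theorem of Steinitz, and lattices in subspaces -/

namespace SymplecticBuilding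

open Module

section Steinitz

variable {R : Type*} [CommRing R] [IsDedekindDomain R]

lemma projective_of_isTorsionFree (M : Type*) [AddCommGroup M] [Module R M] [Module.Finite R M]
    [IsTorsionFree R M] : Projective R M := by
  have := Module.finitePresentation_of_finite R M
  exact Module.Flat.projective_of_finitePresentation

lemma finrank_ideal {J : Ideal R} (hJ : J ≠ ⊥) : finrank R J = 1 := by
  refine le_antisymm ((Submodule.finrank_le J).trans (finrank_self R).le) ?_
  have : Nontrivial J := (Submodule.nontrivial_iff_ne_bot).mpr hJ
  exact finrank_pos

/-- A linear map with a section splits its source. -/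
def equivKerProd {M N : Type*} [AddCommGroup M] [Module R M] [AddCommGroup N] [Module R N]
    (f : M →ₗ[R] N) (s : N →ₗ[R] M) (hs : f.comp s = LinearMap.id) :
    M ≃ₗ[R] LinearMap.ker f × N :=
  have hfs : ∀ x, f (s x) = x := fun x => LinearMap.congr_fun hs x
  LinearEquiv.ofLinearMap
    (LinearMap.prod ((LinearMap.id - s.comp f).codRestrict (LinearMap.ker f) fun x => by
      simp [hfs]) f)
    (LinearMap.coprod (LinearMap.ker f).subtype s)
    (LinearMap.ext fun ⟨x, y⟩ => by
      have hx : f x = 0 := x.2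
      refine Prod.ext (Subtype.ext ?_) ?_
      · simp [hfs, hx]
      · simp [hfs, hx])
    (LinearMap.ext fun x => by simp)

/-- Steinitz: a finitely generated torsion-free module of rank `n + 1` is isomorphic
to `R^n ⊕ I`. -/
lemma exists_equiv_pi_prod_ideal (n : ℕ) : ∀ (M : Type*) [AddCommGroup M] [Module R M]
    [Module.Finite R M] [IsTorsionFree R M], finrank R M = n + 1 →
    ∃ I : nonZeroDivisors (Ideal R), Nonempty (M ≃ₗ[R] (Fin n → R) × ↥(I : Ideal R)) := by
  induction n with
  | zero =>
    intro M _ _ _ _ hM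
    have := projective_of_isTorsionFree (R := R) M
    have : Nontrivial M := nontrivial_of_finrank_pos (R := R) (by omega)
    obtain ⟨x, hx⟩ := exists_ne (0 : M)
    obtain ⟨f, hf⟩ : ∃ f : Dual R M, f x ≠ 0 := by
      by_contra! h
      exact hx ((forall_dual_apply_eq_zero_iff R x).mp h)
    have hJ : LinearMap.range f ≠ ⊥ := fun h => hf (by simp [LinearMap.range_eq_bot.mp h])
    have h1 := (LinearMap.ker f).finrank_quotient_add_finrank
    rw [f.quotKerEquivRange.finrank_eq, finrank_ideal hJ, hM] at h1
    have h2 : LinearMap.ker f = ⊥ := by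
      have h3 : finrank R (LinearMap.ker f) = 0 := by omega
      by_contra h4
      have : Nontrivial (LinearMap.ker f) := (Submodule.nontrivial_iff_ne_bot).mpr h4
      have : 0 < finrank R (LinearMap.ker f) := finrank_pos
      omega
    exact ⟨⟨LinearMap.range f, mem_nonZeroDivisors_iff_ne_zero.mpr hJ⟩,
      ⟨(LinearEquiv.ofInjective f (LinearMap.ker_eq_bot.mp h2)).trans
        (LinearEquiv.uniqueProd (M₂ := Fin 0 → R)).symm⟩⟩
  | succ n ih =>
    intro M _ _ _ _ hM
    have := projective_of_isTorsionFree (R := R) M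
    have : Nontrivial M := nontrivial_of_finrank_pos (R := R) (by omega)
    obtain ⟨x, hx⟩ := exists_ne (0 : M)
    obtain ⟨f, hf⟩ : ∃ f : Dual R M, f x ≠ 0 := by
      by_contra! h
      exact hx ((forall_dual_apply_eq_zero_iff R x).mp h)
    have hJ : LinearMap.range f ≠ ⊥ := fun h => hf (by simp [LinearMap.range_eq_bot.mp h])
    have h1 := (LinearMap.ker f).finrank_quotient_add_finrank
    rw [f.quotKerEquivRange.finrank_eq, finrank_ideal hJ, hM] at h1
    obtain ⟨I, ⟨e⟩⟩ := ih (LinearMap.ker f) (by omega)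
    have := projective_of_isTorsionFree (R := R) (LinearMap.range f)
    obtain ⟨s, hs⟩ := f.rangeRestrict.exists_rightInverse_of_surjective f.range_rangeRestrict
    let J : nonZeroDivisors (Ideal R) :=
      ⟨LinearMap.range f, mem_nonZeroDivisors_iff_ne_zero.mpr hJ⟩
    -- A nonzero functional splits off its image `J`, and induction turns its kernel into `R^n ⊕ I`;
    -- only the two ideals have to be merged.
    obtain ⟨L, ⟨e'⟩⟩ := exists_prod_ideal_equiv I J
    let e1 : M ≃ₗ[R] LinearMap.ker f × LinearMap.range f :=
      (equivKerProd f.rangeRestrict s hs).trans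
        ((LinearEquiv.ofEq _ _ f.ker_rangeRestrict).prodCongr (LinearEquiv.refl R _))
    let e2 : (LinearMap.ker f × LinearMap.range f) ≃ₗ[R]
        ((Fin n → R) × ↥(I : Ideal R)) × LinearMap.range f := e.prodCongr (LinearEquiv.refl R _)
    let e3 : (((Fin n → R) × ↥(I : Ideal R)) × LinearMap.range f) ≃ₗ[R]
        (Fin n → R) × (R × ↥(L : Ideal R)) :=
      (LinearEquiv.prodAssoc R _ _ _).trans ((LinearEquiv.refl R _).prodCongr e')
    let e4 : ((Fin n → R) × (R × ↥(L : Ideal R))) ≃ₗ[R] ((Fin n → R) × R) × ↥(L : Ideal R) :=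
      (LinearEquiv.prodAssoc R _ _ _).symm
    let e5 : ((Fin n → R) × R) ≃ₗ[R] (Fin (n + 1) → R) :=
      (LinearEquiv.prodComm R _ _).trans (Fin.consLinearEquiv R (fun _ => R))
    exact ⟨L, ⟨e1.trans (e2.trans (e3.trans (e4.trans (e5.prodCongr (LinearEquiv.refl R _)))))⟩⟩

lemma hasClass_moduleClass (M : Type*) [AddCommGroup M] [Module R M] [Module.Finite R M]
    [IsTorsionFree R M] [Nontrivial M] : HasClass M (moduleClass R M) := by
  have h : ∃ c : ClassGroup R, HasClass M c := by
    have h1 : 0 < finrank R M := finrank_pos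
    obtain ⟨I, hI⟩ := exists_equiv_pi_prod_ideal (R := R) (finrank R M - 1) M (by omega)
    exact ⟨_, I, rfl, hI⟩
  rw [moduleClass, dif_pos h]
  exact h.choose_spec

end Steinitz

/-! ### The lattice `V ∩ R^m` in a subspace `V` of `K^m`. -/

section Lattice

variable {R K : Type*} [CommRing R] [Field K] [Algebra R K] {m : ℕ}

/-- The intersection of a subspace of `K^m` with `R^m`. -/
abbrev lattice (R : Type*) {K : Type*} [CommRing R] [Field K] [Algebra R K] {m : ℕ}
    (V : Submodule K (Fin m → K)) : Submodule R (Fin m → R) :=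
  (V.restrictScalars R).comap (latticeInclusion R K m)

lemma latticeInclusion_apply (x : Fin m → R) (i : Fin m) :
    latticeInclusion R K m x i = algebraMap R K (x i) := rfl

lemma latticeInclusion_smul (a : R) (x : Fin m → R) :
    latticeInclusion R K m (a • x) = algebraMap R K a • latticeInclusion R K m x := by
  funext i
  simp [latticeInclusion_apply]

lemma mem_lattice {V : Submodule K (Fin m → K)} {x : Fin m → R} :
    x ∈ lattice R V ↔ latticeInclusion R K m x ∈ V := Iff.rfl

variable [IsFractionRing R K]

lemma latticeInclusion_injective : Function.Injective (latticeInclusion R K m) := fun _ _ h =>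
  funext fun i => IsFractionRing.injective R K (congrFun h i)

lemma exists_smul_eq_latticeInclusion [IsDomain R] (x : Fin m → K) :
    ∃ d : R, d ≠ 0 ∧ ∃ y, latticeInclusion R K m y = algebraMap R K d • x := by
  obtain ⟨b, hb⟩ := IsLocalization.exist_integer_multiples_of_finite (nonZeroDivisors R) x
  choose y hy using hb
  refine ⟨b, nonZeroDivisors.coe_ne_zero b, y, funext fun i => ?_⟩
  rw [latticeInclusion_apply, hy, Pi.smul_apply, smul_eq_mul]
  exact Algebra.smul_def _ _

lemma algebraMap_ne_zero {d : R} (hd : d ≠ 0) : algebraMap R K d ≠ 0 := by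
  rwa [Ne, FaithfulSMul.algebraMap_eq_zero_iff R K]

lemma span_latticeInclusion_lattice [IsDomain R] (V : Submodule K (Fin m → K)) :
    Submodule.span K (latticeInclusion R K m '' (lattice R V)) = V := by
  refine le_antisymm (Submodule.span_le.mpr ?_) fun x hx => ?_
  · rintro _ ⟨y, hy, rfl⟩
    exact hy
  · obtain ⟨d, hd, y, hy⟩ := exists_smul_eq_latticeInclusion (R := R) x
    have hd' : algebraMap R K d ≠ 0 := algebraMap_ne_zero hd
    have : x = (algebraMap R K d)⁻¹ • latticeInclusion R K m y := by
      rw [hy, smul_smul, inv_mul_cancel₀ hd', one_smul]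
    rw [this]
    refine Submodule.smul_mem _ _ (Submodule.subset_span ⟨y, ?_, rfl⟩)
    change latticeInclusion R K m y ∈ V
    rw [hy]
    exact V.smul_mem _ hx

lemma lattice_ne_bot [IsDomain R] {V : Submodule K (Fin m → K)} (hV : V ≠ ⊥) :
    lattice R V ≠ ⊥ := by
  intro h
  have := span_latticeInclusion_lattice (R := R) V
  rw [h] at this
  apply hV
  rw [← this]
  simp

/-- A nonzero scalar is invertible in `K`, so the quotient by the lattice is torsion-free. It is
therefore projective, and the quotient map splits. -/
lemma exists_isCompl_lattice [IsDedekindDomain R] (V : Submodule K (Fin m → K)) :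
    ∃ U', IsCompl (lattice R V) U' := by
  have htf : IsTorsionFree R ((Fin m → R) ⧸ lattice R V) := by
    refine .of_smul_eq_zero fun r x hrx => ?_
    obtain ⟨x, rfl⟩ := Submodule.mkQ_surjective _ x
    by_cases hr : r = 0
    · exact Or.inl hr
    · right
      rw [← map_smul, Submodule.mkQ_apply, Submodule.Quotient.mk_eq_zero, mem_lattice,
        latticeInclusion_smul] at hrx
      rw [Submodule.mkQ_apply, Submodule.Quotient.mk_eq_zero, mem_lattice]
      exact (V.smul_mem_iff (algebraMap_ne_zero hr)).mp hrx
  have := projective_of_isTorsionFree (R := R) ((Fin m → R) ⧸ lattice R V)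
  obtain ⟨s, hs⟩ := (lattice R V).mkQ.exists_rightInverse_of_surjective
    (LinearMap.range_eq_top.mpr (Submodule.mkQ_surjective _))
  have hs' : ∀ q, (lattice R V).mkQ (s q) = q := fun q => LinearMap.congr_fun hs q
  refine ⟨LinearMap.range s, IsCompl.of_eq ?_ ?_⟩
  · rw [eq_bot_iff]
    rintro _ ⟨hx, q, rfl⟩
    have h1 := hs' q
    rw [Submodule.mkQ_apply, (Submodule.Quotient.mk_eq_zero _).mpr hx] at h1
    rw [← h1, map_zero]
    exact zero_mem _
  · rw [eq_top_iff]
    intro x _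
    refine Submodule.mem_sup.mpr ⟨x - s ((lattice R V).mkQ x), ?_, _, ⟨_, rfl⟩, sub_add_cancel _ _⟩
    rw [← Submodule.Quotient.mk_eq_zero, ← Submodule.mkQ_apply, map_sub, hs', sub_self]

end Lattice

end SymplecticBuilding

/-! ### Plücker coordinates and the class of a lattice -/

namespace SymplecticBuilding

open Module

section Plucker

variable {K ι : Type*} [Field K] [Fintype ι] [DecidableEq ι] {m : ℕ}

/-- The Plücker coordinates of a family of vectors of `K^m`, indexed by all maps to `Fin m`. -/
def plucker (u : ι → Fin m → K) (S : ι → Fin m) : K :=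
  (Matrix.of fun k j => u j (S k)).det

/-- Cauchy–Binet before sorting: with all maps `S` as indices, it is just the multilinear expansion
in the rows, and no order on `ι` is needed. -/
lemma det_mul_eq_sum_plucker (A : Matrix ι (Fin m) K) (u : ι → Fin m → K) :
    (A * Matrix.of fun i j => u j i).det =
      ∑ S : ι → Fin m, (∏ k, A k (S k)) * plucker u S := by
  have h : (A * Matrix.of fun i j => u j i) =
      Matrix.of fun k => ∑ i, A k i • fun j => u j i := by
    ext k j
    simp [Matrix.mul_apply, Finset.sum_apply]
  rw [h]
  have h2 := (Matrix.detRowAlternating (R := K) (n := ι)).toMultilinearMap.map_sum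
    (fun k (i : Fin m) => A k i • fun j => u j i)
  refine h2.trans (Finset.sum_congr rfl fun S _ => ?_)
  exact (Matrix.detRowAlternating (R := K) (n := ι)).toMultilinearMap.map_smul_univ
    (fun k => A k (S k)) (fun k j => u j (S k))

lemma plucker_comp_equiv {ι' : Type*} [Fintype ι'] [DecidableEq ι'] (σ : ι ≃ ι')
    (u : ι' → Fin m → K) (S : ι → Fin m) : plucker (u ∘ σ) S = plucker u (S ∘ σ.symm) := by
  rw [plucker, plucker, ← Matrix.det_submatrix_equiv_self σ]
  congr 1
  ext k j
  simp

lemma exists_plucker_eq_mul {u u' : ι → Fin m → K} (hu : LinearIndependent K u)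
    (hu' : LinearIndependent K u')
    (h : Submodule.span K (Set.range u) = Submodule.span K (Set.range u')) :
    ∃ μ : K, μ ≠ 0 ∧ ∀ S, plucker u S = μ * plucker u' S := by
  let b' := Basis.span hu'
  let b := (Basis.span hu).map (LinearEquiv.ofEq _ _ h)
  have hb' : ∀ i, (b' i : Fin m → K) = u' i := fun i => by rw [Basis.span_apply]
  have hb : ∀ i, (b i : Fin m → K) = u i := fun i => by
    simp only [b, Basis.map_apply, LinearEquiv.coe_ofEq_apply]
    rw [Basis.span_apply]
  refine ⟨(b'.toMatrix b).det, ?_, fun S => ?_⟩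
  · intro h0
    have h1 := congrArg Matrix.det (b.toMatrix_mul_toMatrix_flip b')
    rw [Matrix.det_mul, h0, mul_zero, Matrix.det_one] at h1
    exact zero_ne_one h1
  · rw [mul_comm, plucker, plucker, ← Matrix.det_mul]
    congr 1
    ext k j
    have h1 := congrArg Subtype.val (b'.sum_toMatrix_smul_self b j)
    simp only [Submodule.coe_sum, Submodule.coe_smul, hb, hb'] at h1
    rw [Matrix.mul_apply, Matrix.of_apply, ← h1, Finset.sum_apply]
    simp only [Pi.smul_apply, smul_eq_mul, Matrix.of_apply, mul_comm]

lemma plucker_cons_add_smul {s : ℕ} (x v : Fin m → K) (t : K) (w : Fin s → Fin m → K)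
    (S : Fin (s + 1) → Fin m) :
    plucker (Fin.cons (x + t • v) w : Fin (s + 1) → Fin m → K) S =
      plucker (Fin.cons x w : Fin (s + 1) → Fin m → K) S +
        t * plucker (Fin.cons v w : Fin (s + 1) → Fin m → K) S := by
  have h : ∀ y : Fin m → K, (Matrix.of fun k j => (Fin.cons y w : Fin (s + 1) → Fin m → K) j (S k)) =
      (Matrix.of fun k j => (Fin.cons x w : Fin (s + 1) → Fin m → K) j (S k)).updateCol 0
        (fun k => y (S k)) := by
    intro y
    ext k j
    refine Fin.cases ?_ (fun j => ?_) j
    · simp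
    · simp
  rw [plucker, plucker, plucker, h (x + t • v), h v, ← Matrix.det_updateCol_smul]
  conv_rhs => rw [h x]
  rw [Matrix.updateCol_idem]
  rw [← Matrix.det_updateCol_add]
  rfl

/-- If `x, v, w` are linearly independent, then the Plücker vectors of `(x, w)` and `(v, w)`
are not proportional. -/
lemma exists_minor_ne_zero {s : ℕ} {x v : Fin m → K} {w : Fin s → Fin m → K}
    (h : LinearIndependent K (Fin.cons x (Fin.cons v w : Fin (s + 1) → Fin m → K) :
      Fin (s + 2) → Fin m → K)) :
    ∃ S T, plucker (Fin.cons x w : Fin (s + 1) → Fin m → K) S *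
        plucker (Fin.cons v w : Fin (s + 1) → Fin m → K) T -
      plucker (Fin.cons x w : Fin (s + 1) → Fin m → K) T *
        plucker (Fin.cons v w : Fin (s + 1) → Fin m → K) S ≠ 0 := by
  set b : Fin (s + 2) → Fin m → K := Fin.cons x (Fin.cons v w : Fin (s + 1) → Fin m → K) with hb
  set p := plucker (Fin.cons x w : Fin (s + 1) → Fin m → K) with hp
  set q := plucker (Fin.cons v w : Fin (s + 1) → Fin m → K) with hq
  -- The rows of a left inverse yield linear forms `A` and `B` on Plücker vectors, dual to `(x, w)`
  -- and `(v, w)`: `A p = B q = 1` and `A q = B p = 0`. If all minors vanished, so would `(A p) (B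
  -- q) - (A q) (B p)`.
  obtain ⟨g, hg⟩ := (Fintype.linearCombination K b).exists_leftInverse_of_injective
    (LinearMap.ker_eq_bot.mpr h.fintypeLinearCombination_injective)
  have hgb : ∀ i, g (b i) = Pi.single i 1 := by
    intro i
    have := LinearMap.congr_fun hg (Pi.single i 1)
    simpa [Fintype.linearCombination_apply_single] using this
  set G := LinearMap.toMatrix' g
  have hdet : ∀ (r : Fin (s + 1) → Fin (s + 2)) (u : Fin (s + 1) → Fin m → K),
      (∑ S : Fin (s + 1) → Fin m, (∏ k, G (r k) (S k)) * plucker u S) =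
        (Matrix.of fun k j => g (u j) (r k)).det := by
    intro r u
    have h1 := det_mul_eq_sum_plucker (G.submatrix r id) u
    simp only [Matrix.submatrix_apply, id] at h1
    rw [← h1]
    congr 1
    ext k j
    rw [Matrix.of_apply, ← LinearMap.toMatrix'_mulVec]
    rfl
  let rx : Fin (s + 1) → Fin (s + 2) := Fin.cons 0 fun k => k.succ.succ
  have hx0 : ∀ k, g x k = if k = 0 then 1 else 0 := fun k => by
    rw [← Pi.single_apply (0 : Fin (s + 2)) (1 : K) k]
    exact congrFun (hgb 0) k
  have hv0 : ∀ k, g v k = if k = Fin.succ 0 then 1 else 0 := fun k => by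
    rw [← Pi.single_apply (Fin.succ 0 : Fin (s + 2)) (1 : K) k]
    exact congrFun (hgb (Fin.succ 0)) k
  have hw0 : ∀ i k, g (w i) k = if k = i.succ.succ then 1 else 0 := fun i k => by
    rw [← Pi.single_apply (i.succ.succ : Fin (s + 2)) (1 : K) k]
    exact congrFun (hgb i.succ.succ) k
  have e1 := hdet rx (Fin.cons x w)
  have e2 := hdet rx (Fin.cons v w)
  have e3 := hdet Fin.succ (Fin.cons x w)
  have e4 := hdet Fin.succ (Fin.cons v w)
  have d1 : (Matrix.of fun k j => g ((Fin.cons x w : Fin (s + 1) → Fin m → K) j) (rx k)) = 1 := by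
    ext k j
    refine Fin.cases ?_ (fun j => ?_) j <;> refine Fin.cases ?_ (fun k => ?_) k <;>
      simp only [Matrix.of_apply, rx, Fin.cons_zero, Fin.cons_succ, hx0, hw0, Matrix.one_apply,
        Fin.succ_inj, Fin.succ_ne_zero, (Fin.succ_ne_zero _).symm, if_true, if_false]
  have d4 : (Matrix.of fun k j =>
      g ((Fin.cons v w : Fin (s + 1) → Fin m → K) j) (Fin.succ k)) = 1 := by
    ext k j
    refine Fin.cases ?_ (fun j => ?_) j <;> refine Fin.cases ?_ (fun k => ?_) k <;>
      simp only [Matrix.of_apply, Fin.cons_zero, Fin.cons_succ, hv0, hw0, Matrix.one_apply,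
        Fin.succ_inj, Fin.succ_ne_zero, (Fin.succ_ne_zero _).symm, if_true, if_false]
  have d2 : (Matrix.of fun k j =>
      g ((Fin.cons v w : Fin (s + 1) → Fin m → K) j) (rx k)).det = 0 := by
    refine Matrix.det_eq_zero_of_column_eq_zero 0 fun k => ?_
    refine Fin.cases ?_ (fun k => ?_) k <;>
      simp only [Matrix.of_apply, rx, Fin.cons_zero, Fin.cons_succ, hv0,
        Fin.succ_inj, Fin.succ_ne_zero, (Fin.succ_ne_zero _).symm, if_false]
  have d3 : (Matrix.of fun k j =>
      g ((Fin.cons x w : Fin (s + 1) → Fin m → K) j) (Fin.succ k)).det = 0 := by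
    refine Matrix.det_eq_zero_of_column_eq_zero 0 fun k => ?_
    simp only [Matrix.of_apply, Fin.cons_zero, hx0, Fin.succ_ne_zero, if_false]
  rw [d1, Matrix.det_one] at e1
  rw [d4, Matrix.det_one] at e4
  rw [d2] at e2
  rw [d3] at e3
  by_contra! hall
  set A : (Fin (s + 1) → Fin m) → K := fun S => ∏ k, G (rx k) (S k)
  set B : (Fin (s + 1) → Fin m) → K := fun S => ∏ k, G (Fin.succ k) (S k)
  have h1 : (∑ S, A S * p S) * (∑ T, B T * q T) - (∑ S, A S * q S) * (∑ T, B T * p T) = 0 := by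
    rw [Finset.sum_mul_sum, Finset.sum_mul_sum, ← Finset.sum_sub_distrib]
    refine Finset.sum_eq_zero fun S _ => ?_
    rw [← Finset.sum_sub_distrib]
    refine Finset.sum_eq_zero fun T _ => ?_
    linear_combination A S * B T * hall S T
  rw [e1, e2, e3, e4] at h1
  simp at h1

end Plucker

/-! ### The class of a subspace and the content of its Plücker vector. -/

section Content

variable {R K : Type*} [CommRing R] [IsDedekindDomain R] [Field K] [Algebra R K]
  [IsFractionRing R K] {m : ℕ}

lemma exists_lattice_splitting {V : Submodule K (Fin m → K)} {c : ClassGroup R}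
    (hc : HasClass (lattice R V) c) :
    ∃ (s : ℕ) (I : nonZeroDivisors (Ideal R))
      (inc : (Fin s → R) × ↥(I : Ideal R) →ₗ[R] (Fin m → R))
      (ρ : (Fin m → R) →ₗ[R] (Fin s → R) × ↥(I : Ideal R)),
      ClassGroup.mk0 I = c ∧ LinearMap.range inc = lattice R V ∧ ∀ x, ρ (inc x) = x := by
  obtain ⟨I, hI, ⟨e⟩⟩ := hc
  obtain ⟨U', hU'⟩ := exists_isCompl_lattice (R := R) V
  refine ⟨_, I, (lattice R V).subtype.comp e.symm.toLinearMap,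
    e.toLinearMap.comp ((lattice R V).projectionOnto U' hU'), hI, ?_, fun x => ?_⟩
  · rw [LinearMap.range_comp_of_range_eq_top _ (LinearEquiv.range _), Submodule.range_subtype]
  · have := Submodule.projectionOnto_apply_left hU' (e.symm x)
    simp only [LinearMap.comp_apply, LinearEquiv.coe_coe, Submodule.subtype_apply]
    rw [this, e.apply_symm_apply]

/-- A basis of a subspace of `K^m` that is adapted to a decomposition `R^s ⊕ I` of its lattice,
together with a retraction. -/
lemma exists_adapted_basis {V : Submodule K (Fin m → K)} {c : ClassGroup R}
    (hc : HasClass (lattice R V) c) :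
    ∃ (s : ℕ) (I : nonZeroDivisors (Ideal R)) (u : Fin s ⊕ Unit → Fin m → K)
      (A : Matrix (Fin s ⊕ Unit) (Fin m) R), ClassGroup.mk0 I = c ∧ LinearIndependent K u ∧
      Submodule.span K (Set.range u) = V ∧ (∀ i, A (Sum.inr ()) i ∈ (I : Ideal R)) ∧
      (A.map (algebraMap R K) * Matrix.of fun i j => u j i) = 1 ∧
      (∀ j i, ∃ r, u (Sum.inl j) i = algebraMap R K r) ∧
      ∀ a ∈ (I : Ideal R), ∀ i, ∃ r, algebraMap R K a * u (Sum.inr ()) i = algebraMap R K r := by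
  obtain ⟨s, I, inc₀, ρ, hI, hrange, hρ⟩ := exists_lattice_splitting hc
  obtain ⟨i₀, hi₀, hi₀0⟩ := Submodule.exists_mem_ne_zero_of_ne_bot
    (mem_nonZeroDivisors_iff_ne_zero.mp I.2 : (I : Ideal R) ≠ ⊥)
  have hi₀' : algebraMap R K i₀ ≠ 0 := algebraMap_ne_zero hi₀0
  obtain ⟨inc, hinc⟩ : ∃ inc : (Fin s → R) × ↥(I : Ideal R) →ₗ[R] (Fin m → K),
      ∀ x, inc x = latticeInclusion R K m (inc₀ x) :=
    ⟨(latticeInclusion R K m).comp inc₀, fun _ => rfl⟩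
  have inc_smul : ∀ (a : R) x, inc (a • x) = algebraMap R K a • inc x := fun a x => by
    rw [map_smul, algebraMap_smul]
  have inc_mem : ∀ x, inc x ∈ V := fun x => by
    rw [hinc, ← mem_lattice, ← hrange]
    exact ⟨x, rfl⟩
  -- The image of `1` under the `K`-linear extension of the inclusion of `I`; it need not be
  -- integral, but its multiples by elements of `I` are.
  set y₀ : Fin m → K := (algebraMap R K i₀)⁻¹ • inc (0, ⟨i₀, hi₀⟩) with hy₀
  have hur : ∀ a (ha : a ∈ (I : Ideal R)), algebraMap R K a • y₀ = inc (0, ⟨a, ha⟩) := by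
    intro a ha
    have h1 : a • ((0, ⟨i₀, hi₀⟩) : (Fin s → R) × ↥(I : Ideal R)) =
        i₀ • ((0, ⟨a, ha⟩) : (Fin s → R) × ↥(I : Ideal R)) := by
      refine Prod.ext (by simp) (Subtype.ext ?_)
      simp [mul_comm]
    have h2 := congrArg inc h1
    rw [inc_smul, inc_smul] at h2
    rw [hy₀, smul_comm, h2, smul_smul, inv_mul_cancel₀ hi₀', one_smul]
  let u : Fin s ⊕ Unit → Fin m → K := Sum.elim (fun j => inc (Pi.single j 1, 0)) fun _ => y₀
  let co : (Fin s → R) × ↥(I : Ideal R) →ₗ[R] (Fin s ⊕ Unit → R) :=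
    LinearMap.pi (Sum.elim (fun j => (LinearMap.proj j).comp (LinearMap.fst R _ _))
      (fun _ => (I : Ideal R).subtype.comp (LinearMap.snd R _ _)))
  set A : Matrix (Fin s ⊕ Unit) (Fin m) R := LinearMap.toMatrix' (co.comp ρ) with hAdef
  have hA : ∀ (x : (Fin s → R) × ↥(I : Ideal R)) k,
      ∑ i, algebraMap R K (A k i) * inc x i = algebraMap R K (co x k) := by
    intro x k
    have h1 := congrFun (LinearMap.toMatrix'_mulVec (co.comp ρ) (inc₀ x)) k
    rw [LinearMap.comp_apply, hρ] at h1
    rw [← h1, ← hAdef, Matrix.mulVec, dotProduct, map_sum]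
    refine Finset.sum_congr rfl fun i _ => ?_
    rw [map_mul, hinc]
    rfl
  have hone : (A.map (algebraMap R K) * Matrix.of fun i j => u j i) = 1 := by
    ext k j
    rw [Matrix.mul_apply]
    rcases j with j | j
    · refine (hA (Pi.single j 1, 0) k).trans ?_
      rcases k with k | k
      · rw [Matrix.one_apply]
        simp [co, Pi.single_apply]
      · simp [co]
    · have h1 : ∀ i, A.map (algebraMap R K) k i * (Matrix.of fun i j => u j i) i (Sum.inr j) =
          (algebraMap R K i₀)⁻¹ * (algebraMap R K (A k i) * inc (0, ⟨i₀, hi₀⟩) i) := fun i => by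
        rw [mul_left_comm]
        rfl
      rw [Finset.sum_congr rfl fun i _ => h1 i, ← Finset.mul_sum, hA]
      rcases k with k | k
      · simp [co]
      · simp [co, hi₀']
  refine ⟨s, I, u, A, hI, ?_, ?_, fun i => ?_, hone, fun j i => ?_, fun a ha i => ?_⟩
  · rw [Fintype.linearIndependent_iff]
    intro g hg k
    have h1 : (Matrix.of fun i j => u j i).mulVec g = 0 := by
      rw [← hg]
      funext i
      simp only [Matrix.mulVec, dotProduct, Matrix.of_apply, Finset.sum_apply, Pi.smul_apply,
        smul_eq_mul, mul_comm]
    have h2 := congrArg (A.map (algebraMap R K)).mulVec h1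
    rw [Matrix.mulVec_mulVec, hone, Matrix.one_mulVec, Matrix.mulVec_zero] at h2
    exact congrFun h2 k
  · refine le_antisymm (Submodule.span_le.mpr ?_) ?_
    · rintro _ ⟨j, rfl⟩
      rcases j with j | j
      · exact inc_mem _
      · exact V.smul_mem _ (inc_mem _)
    · conv_lhs => rw [← span_latticeInclusion_lattice (R := R) V]
      refine Submodule.span_le.mpr ?_
      rintro _ ⟨y, hy, rfl⟩
      obtain ⟨⟨f, a⟩, rfl⟩ : y ∈ LinearMap.range inc₀ := hrange ▸ hy
      have h2 : (f, a) = (∑ j, f j • ((Pi.single j 1, 0) : (Fin s → R) × ↥(I : Ideal R))) +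
          (0, a) := by
        refine Prod.ext ?_ ?_
        · rw [Prod.fst_add, Prod.fst_sum, add_zero]
          funext j
          simp [Finset.sum_apply, Pi.single_apply]
        · simp [Prod.snd_sum]
      rw [SetLike.mem_coe, ← hinc, h2, map_add, map_sum, ← hur a a.2]
      refine add_mem (sum_mem fun j _ => ?_)
        (Submodule.smul_mem _ _ (Submodule.subset_span ⟨Sum.inr (), rfl⟩))
      rw [inc_smul]
      exact Submodule.smul_mem _ _ (Submodule.subset_span ⟨Sum.inl j, rfl⟩)
  · rw [hAdef, LinearMap.toMatrix'_apply]
    exact (ρ (Pi.single i 1)).2.2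
  · refine ⟨inc₀ (Pi.single j 1, 0) i, ?_⟩
    change inc (Pi.single j 1, 0) i = _
    rw [hinc]
    rfl
  · refine ⟨inc₀ (0, ⟨a, ha⟩) i, ?_⟩
    have := congrFun (hur a ha) i
    rw [hinc] at this
    exact this

/-- The class of a subspace is inverse to the class of the content ideal of its Plücker vector. -/
lemma isPrincipal_span_plucker_mul {ι : Type*} [Fintype ι] [DecidableEq ι]
    {V : Submodule K (Fin m → K)} {c : ClassGroup R}
    (hc : HasClass (lattice R V) c) {u : ι → Fin m → K} (hu : LinearIndependent K u)
    (huV : Submodule.span K (Set.range u) = V) {l : K} (hl : l ≠ 0) {p : (ι → Fin m) → R}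
    (hp : ∀ S, algebraMap R K (p S) = l * plucker u S) :
    ∃ h : Ideal.span (Set.range p) ∈ nonZeroDivisors (Ideal R),
      ClassGroup.mk0 ⟨_, h⟩ * c = 1 := by
  obtain ⟨s, I, u₀, A, hI, hu₀, hu₀V, hAI, hone, hl0, hr0⟩ := exists_adapted_basis hc
  have hcard : Fintype.card ι = Fintype.card (Fin s ⊕ Unit) := by
    rw [← finrank_span_eq_card hu, ← finrank_span_eq_card hu₀, huV, hu₀V]
  let σ : ι ≃ Fin s ⊕ Unit := Fintype.equivOfCardEq hcard
  have hu₀σ : LinearIndependent K (u₀ ∘ σ) := hu₀.comp _ σ.injective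
  obtain ⟨μ, hμ, hμS⟩ := exists_plucker_eq_mul hu hu₀σ (by
    rw [huV, σ.surjective.range_comp, hu₀V])
  have hpS : ∀ S, algebraMap R K (p S) = l * μ * plucker u₀ (S ∘ σ.symm) := fun S => by
    rw [hp, hμS, plucker_comp_equiv, mul_assoc]
  have hlμ : l * μ ≠ 0 := mul_ne_zero hl hμ
  -- the coefficients of the expansion of `1`
  let r : (Fin s ⊕ Unit → Fin m) → R := fun S => ∏ k, A k (S k)
  have hrI : ∀ S, r S ∈ (I : Ideal R) := fun S =>
    Ideal.mem_of_dvd _ (Finset.dvd_prod_of_mem _ (Finset.mem_univ (Sum.inr ()))) (hAI _)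
  have hsum : ∑ S, algebraMap R K (r S) * plucker u₀ S = 1 := by
    have h1 := det_mul_eq_sum_plucker (A.map (algebraMap R K)) u₀
    rw [hone, Matrix.det_one] at h1
    rw [h1]
    refine Finset.sum_congr rfl fun S _ => ?_
    simp [r]
  -- Absorbing `a` into the single column that may fail to be integral makes the whole determinant
  -- integral.
  have hint : ∀ S, ∀ a ∈ (I : Ideal R), ∃ x, algebraMap R K a * plucker u₀ S =
      algebraMap R K x := by
    intro S a ha
    choose L hL using fun j k => hl0 j (S k)
    choose M hM using fun k => hr0 a ha (S k)
    refine ⟨(Matrix.of fun k j => Sum.elim (fun j => L j k) (fun _ => M k) j).det, ?_⟩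
    rw [plucker, RingHom.map_det,
      ← Matrix.updateCol_eq_self (Matrix.of fun k j => u₀ j (S k)) (Sum.inr ()),
      ← Matrix.det_updateCol_smul]
    congr 1
    ext k j
    rcases j with j | j
    · simp [hL]
    · rw [Matrix.updateCol_self]
      exact hM k
  -- The scalar `l * μ`, written through the expansion of `1` so that it visibly lies in the product
  -- of the content and `I`. Conversely, each `p S * a` with `a ∈ I` is `l * μ` times an integral
  -- determinant, so this product is `(n)`.
  set n : R := ∑ S, r S * p (S ∘ σ) with hn
  have hnK : algebraMap R K n = l * μ := by
    rw [hn, map_sum]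
    simp only [map_mul, hpS]
    have : ∀ S : Fin s ⊕ Unit → Fin m, (S ∘ σ) ∘ σ.symm = S := fun S => by
      funext k; simp
    simp only [this]
    conv_rhs => rw [← mul_one (l * μ), ← hsum, Finset.mul_sum]
    refine Finset.sum_congr rfl fun S _ => by ring
  have hprod : Ideal.span (Set.range p) * (I : Ideal R) = Ideal.span {n} := by
    refine le_antisymm (Ideal.mul_le.mpr ?_) ((Ideal.span_singleton_le_iff_mem _).mpr ?_)
    · intro x hx a ha
      rw [Ideal.mem_span_singleton]
      have hle : Ideal.span (Set.range p) ≤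
          Submodule.comap (LinearMap.mulRight R a) (Ideal.span {n}) := by
        refine Ideal.span_le.mpr ?_
        rintro _ ⟨S, rfl⟩
        change p S * a ∈ Ideal.span {n}
        obtain ⟨y, hy⟩ := hint (S ∘ σ.symm) a ha
        rw [Ideal.mem_span_singleton]
        refine ⟨y, IsFractionRing.injective R K ?_⟩
        rw [map_mul, map_mul, hpS, hnK, ← hy]
        ring
      exact Ideal.mem_span_singleton.mp (hle hx)
    · refine sum_mem fun S _ => ?_
      rw [mul_comm (r S)]
      exact Ideal.mul_mem_mul (Ideal.subset_span ⟨_, rfl⟩) (hrI S)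
  have hn0 : n ≠ 0 := fun h => hlμ (by rw [← hnK, h, map_zero])
  have hne : Ideal.span (Set.range p) ≠ 0 := by
    intro h
    rw [h, zero_mul] at hprod
    exact hn0 (by simpa using hprod.symm)
  refine ⟨mem_nonZeroDivisors_iff_ne_zero.mpr hne, ?_⟩
  rw [← hI, ← map_mul]
  refine (ClassGroup.mk0_eq_one_iff
    (mul_mem (mem_nonZeroDivisors_iff_ne_zero.mpr hne) I.2)).mpr ?_
  exact ⟨⟨n, hprod⟩⟩

end Content

end SymplecticBuilding

/-! ### The effect of a transvection on the class -/

namespace SymplecticBuilding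

open Module

section SubspaceClass

variable {R K : Type*} [CommRing R] [IsDedekindDomain R] [Field K] [Algebra R K]
  [IsFractionRing R K] {m : ℕ}

lemma hasClass_lattice {V : Submodule K (Fin m → K)} (hV : V ≠ ⊥) :
    HasClass (lattice R V) (moduleClass R (lattice R V)) := by
  have : Nontrivial (lattice R V) := (Submodule.nontrivial_iff_ne_bot).mpr (lattice_ne_bot hV)
  exact hasClass_moduleClass _

/-- A transvection moves the integral Plücker vector of a subspace in a pencil. -/
lemma exists_integral_pencil {M : Submodule K (Fin m → K)} {v : Fin m → K}
    {φ : Dual K (Fin m → K)} (hφv : φ v = 0) (hv : v ∉ M) (hM : ¬ M ≤ LinearMap.ker φ) :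
    ∃ (s : ℕ) (p q : (Fin (s + 1) → Fin m) → R) (S T : Fin (s + 1) → Fin m),
      p S * q T - p T * q S ≠ 0 ∧
      (∃ h : Ideal.span (Set.range p) ∈ nonZeroDivisors (Ideal R),
        ClassGroup.mk0 ⟨_, h⟩ * moduleClass R (lattice R M) = 1) ∧
      ∀ a b : R, a ≠ 0 →
        ∃ h : Ideal.span (Set.range fun S => a * p S + b * q S) ∈ nonZeroDivisors (Ideal R),
          ClassGroup.mk0 ⟨_, h⟩ * moduleClass R (lattice R (M.map
            (LinearMap.transvection φ ((algebraMap R K b / algebraMap R K a) • v)))) = 1 := by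
  -- `M` is `K x ⊕ N` with `N = M ∩ ker φ`. The transvection fixes `N` and sends `x` to `x + t v`,
  -- so the Plücker vector of the image is affine in `t`.
  obtain ⟨x, hxM, hφx⟩ : ∃ x ∈ M, φ x = 1 := by
    obtain ⟨y, hyM, hy⟩ := SetLike.not_le_iff_exists.mp hM
    rw [LinearMap.mem_ker] at hy
    exact ⟨(φ y)⁻¹ • y, M.smul_mem _ hyM, by simp [hy]⟩
  let N : Submodule K (Fin m → K) := M ⊓ LinearMap.ker φ
  let s := finrank K N
  let w : Fin s → Fin m → K := fun i => (finBasis K N i : Fin m → K)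
  have hw : LinearIndependent K w :=
    (finBasis K N).linearIndependent.map' N.subtype N.ker_subtype
  have hwN : Submodule.span K (Set.range w) = N := by
    have h1 : Set.range w = N.subtype '' Set.range (finBasis K N) := by
      rw [← Set.range_comp]; rfl
    rw [h1, ← Submodule.map_span, (finBasis K N).span_eq, Submodule.map_top,
      Submodule.range_subtype]
  have hker : ∀ y ∈ N, φ y = 0 := fun y hy => hy.2
  have hwφ : ∀ i, φ (w i) = 0 := fun i => hker _ (finBasis K N i).2
  have hvw : LinearIndependent K (Fin.cons v w : Fin (s + 1) → Fin m → K) :=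
    linearIndependent_finCons.mpr ⟨hw, fun h => hv (hwN ▸ h : v ∈ N).1⟩
  have hxspan : ∀ {k : ℕ} (u : Fin k → Fin m → K), (∀ i, φ (u i) = 0) →
      x ∉ Submodule.span K (Set.range u) := by
    intro k u hu h
    have h1 : Submodule.span K (Set.range u) ≤ LinearMap.ker φ :=
      Submodule.span_le.mpr (by rintro _ ⟨i, rfl⟩; exact hu i)
    have h2 : φ x = 0 := h1 h
    rw [hφx] at h2
    exact one_ne_zero h2
  have hxvw : LinearIndependent K (Fin.cons x (Fin.cons v w : Fin (s + 1) → Fin m → K) :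
      Fin (s + 2) → Fin m → K) :=
    linearIndependent_finCons.mpr ⟨hvw, hxspan _ fun i => by
      refine Fin.cases ?_ (fun i => ?_) i
      · simpa using hφv
      · simpa using hwφ i⟩
  have hxw : LinearIndependent K (Fin.cons x w : Fin (s + 1) → Fin m → K) :=
    linearIndependent_finCons.mpr ⟨hw, hxspan _ hwφ⟩
  have hxwM : Submodule.span K (Set.range (Fin.cons x w : Fin (s + 1) → Fin m → K)) = M := by
    rw [Fin.range_cons, Submodule.span_insert, hwN]
    refine le_antisymm (sup_le ?_ inf_le_left) fun y hy => ?_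
    · rwa [Submodule.span_singleton_le_iff_mem]
    · refine Submodule.mem_sup.mpr ⟨φ y • x,
        Submodule.smul_mem _ _ (Submodule.mem_span_singleton_self x), y - φ y • x, ⟨?_, ?_⟩, ?_⟩
      · exact M.sub_mem hy (M.smul_mem _ hxM)
      · simp [hφx]
      · abel
  have hM0 : M ≠ ⊥ := by
    rintro rfl
    exact hM bot_le
  obtain ⟨S, T, hST⟩ := exists_minor_ne_zero hxvw
  set P := plucker (Fin.cons x w : Fin (s + 1) → Fin m → K) with hP
  set Q := plucker (Fin.cons v w : Fin (s + 1) → Fin m → K) with hQ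
  -- One denominator for both vectors: then `a p + b q` is `a d` times the Plücker vector of the
  -- image.
  obtain ⟨d, hd⟩ := IsLocalization.exist_integer_multiples_of_finite (nonZeroDivisors R)
    (Sum.elim P Q)
  have hd0 : algebraMap R K d ≠ 0 := algebraMap_ne_zero (nonZeroDivisors.coe_ne_zero d)
  choose p hp' using fun S => hd (Sum.inl S)
  choose q hq' using fun S => hd (Sum.inr S)
  have hp : ∀ S, algebraMap R K (p S) = algebraMap R K d * P S := fun S =>
    (hp' S).trans (Algebra.smul_def _ _)
  have hq : ∀ S, algebraMap R K (q S) = algebraMap R K d * Q S := fun S =>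
    (hq' S).trans (Algebra.smul_def _ _)
  refine ⟨s, p, q, S, T, fun h => hST ?_,
    isPrincipal_span_plucker_mul (hasClass_lattice hM0) hxw hxwM hd0 hp, fun a b ha => ?_⟩
  · have h1 := congrArg (algebraMap R K) h
    simp only [map_sub, map_mul, hp, hq, map_zero] at h1
    have h2 : (algebraMap R K d * algebraMap R K d) * (P S * Q T - P T * Q S) = 0 := by
      linear_combination h1
    exact (mul_eq_zero.mp h2).resolve_left (mul_ne_zero hd0 hd0)
  · have ha' : algebraMap R K a ≠ 0 := algebraMap_ne_zero ha
    set t := algebraMap R K b / algebraMap R K a with ht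
    have hta : algebraMap R K a * t = algebraMap R K b := mul_div_cancel₀ _ ha'
    have hφtv : φ (t • v) = 0 := by rw [map_smul, hφv, smul_zero]
    set τ := LinearMap.transvection φ (t • v) with hτ
    have hτinj : Function.Injective τ := (LinearEquiv.transvection hφtv).injective
    have hcomp : τ ∘ (Fin.cons x w : Fin (s + 1) → Fin m → K) = Fin.cons (x + t • v) w := by
      funext i
      refine Fin.cases ?_ (fun i => ?_) i
      · simp [τ, LinearMap.transvection.apply, hφx]
      · simp [τ, LinearMap.transvection.apply, hwφ]
    have hind : LinearIndependent K (Fin.cons (x + t • v) w : Fin (s + 1) → Fin m → K) := by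
      rw [← hcomp]
      exact hxw.map' τ (LinearMap.ker_eq_bot.mpr hτinj)
    have hspan : Submodule.span K (Set.range
        (Fin.cons (x + t • v) w : Fin (s + 1) → Fin m → K)) = M.map τ := by
      rw [← hcomp, Set.range_comp, ← Submodule.map_span, hxwM]
    have hτM0 : M.map τ ≠ ⊥ := fun h =>
      hM0 (Submodule.map_injective_of_injective hτinj (h.trans (Submodule.map_bot τ).symm))
    refine isPrincipal_span_plucker_mul (hasClass_lattice hτM0) hind hspan
      (mul_ne_zero ha' hd0) fun S => ?_
    rw [plucker_cons_add_smul, map_add, map_mul, map_mul, hp, hq, ← hta]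
    ring

/-- A function on subspaces with values in a group has the transvection property if, for a vector
`v` and a functional `φ` with `φ v = 0`, the values at finitely many subspaces that are moved by the
transvections along `v` can be multiplied simultaneously by any given element. -/
def TransvectionProperty {V C : Type*} [AddCommGroup V] [Module K V] [Mul C]
    (cls : Submodule K V → C) : Prop :=
  ∀ (x : C) (v : V) (φ : Dual K V), φ v = 0 → ∀ F : Finset (Submodule K V),
    (∀ M ∈ F, v ∉ M ∧ ¬ M ≤ LinearMap.ker φ) →
    ∃ t : K, ∀ M ∈ F, cls (M.map (LinearMap.transvection φ (t • v))) = cls M * x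

/-- Taking for `β` the product of the nonzero minors belonging to all `M ∈ F` lets one pair `a, b`
work for all of them. The ideal `J` is chosen in the class `x⁻¹` because the class of a subspace is
inverse to that of its content. -/
lemma transvectionProperty_moduleClass :
    TransvectionProperty fun V : Submodule K (Fin m → K) => moduleClass R (lattice R V) := by
  intro x v φ hφv F hF
  choose s p q S T hne hp hpq using fun M : F =>
    exists_integral_pencil (R := R) hφv (hF M M.2).1 (hF M M.2).2
  obtain ⟨J, a, b, hJ, ha, hspan, hb⟩ := exists_two_generators
    (Finset.prod_ne_zero_iff.mpr fun M (_ : M ∈ Finset.univ) => hne M) x⁻¹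
  refine ⟨algebraMap R K b / algebraMap R K a, fun M hM => ?_⟩
  obtain ⟨h1, e1⟩ := hp ⟨M, hM⟩
  obtain ⟨h2, e2⟩ := hpq ⟨M, hM⟩ a b ha
  have h3 := span_range_pencil (Finset.dvd_prod_of_mem _ (Finset.mem_univ (⟨M, hM⟩ : F))) hspan hb
  have h4 : (⟨_, h2⟩ : nonZeroDivisors (Ideal R)) = J * ⟨_, h1⟩ := Subtype.ext h3
  rw [h4, map_mul, hJ] at e2
  rw [mul_assoc, inv_mul_eq_one] at e2
  rw [e2, ← mul_assoc, mul_comm (moduleClass R (lattice R M)), e1, one_mul]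

end SubspaceClass

end SymplecticBuilding

/-! ### Adjusting classes by products of transvections -/

namespace SymplecticBuilding

open Module

section Adjust

/-- Multiplicative Möbius inversion: the value at a maximal element enters only the equation at that
element, so it can be chosen last. -/
lemma exists_prod_filter_le_eq {α C : Type*} [PartialOrder α] [CommGroup C] [DecidableLE α]
    (F : Finset α) (y : α → C) :
    ∃ x : α → C, ∀ U ∈ F, ∏ W ∈ F with W ≤ U, x W = y U := by
  classical
  induction F using Finset.strongInduction with
  | H F ih =>
    rcases F.eq_empty_or_nonempty with rfl | hne
    · exact ⟨y, by simp⟩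
    obtain ⟨a, ha, hmax⟩ := F.exists_maximal hne
    obtain ⟨x', hx'⟩ := ih (F.erase a) (Finset.erase_ssubset ha)
    refine ⟨Function.update x' a (y a / ∏ W ∈ F.erase a with W ≤ a, x' W), fun U hU => ?_⟩
    have hupd : ∀ U, ∏ W ∈ F.erase a with W ≤ U,
        Function.update x' a (y a / ∏ W ∈ F.erase a with W ≤ a, x' W) W =
          ∏ W ∈ F.erase a with W ≤ U, x' W := fun U => Finset.prod_congr rfl fun W hW =>
      Function.update_of_ne (Finset.ne_of_mem_erase (Finset.mem_filter.mp hW).1) _ _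
    have hF : ∀ U, F.filter (· ≤ U) = (insert a (F.erase a)).filter (· ≤ U) := fun U => by
      rw [Finset.insert_erase ha]
    by_cases hUa : U = a
    · subst hUa
      rw [hF, Finset.filter_insert, if_pos le_rfl, Finset.prod_insert (by simp), hupd,
        Function.update_self, div_mul_cancel]
    · have h1 : ¬ a ≤ U := fun h => hUa (le_antisymm (hmax hU h) h)
      rw [hF, Finset.filter_insert, if_neg h1, hupd]
      exact hx' U (Finset.mem_erase.mpr ⟨hUa, hU⟩)

variable {K V C : Type*} [Field K] [AddCommGroup V] [Module K V] [CommGroup C]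

/-- A vector space over an infinite field is not a finite union of proper subspaces. -/
lemma exists_mem_forall_notMem [Infinite K] (U : Submodule K V) (S : Finset (Submodule K V))
    (hS : ∀ W ∈ S, ¬ U ≤ W) : ∃ v ∈ U, ∀ W ∈ S, v ∉ W := by
  classical
  have h := Subspace.biUnion_ne_univ_of_top_notMem (k := K) (E := U)
    (s := S.image fun W => W.comap U.subtype) (by
      intro htop
      obtain ⟨W, hW, hWt⟩ := Finset.mem_image.mp htop
      refine hS W hW fun u hu => ?_
      have : (⟨u, hu⟩ : U) ∈ W.comap U.subtype := hWt ▸ Submodule.mem_top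
      exact this)
  obtain ⟨v, hv⟩ := (Set.ne_univ_iff_exists_notMem _).mp h
  refine ⟨v, v.2, fun W hW hvW => hv ?_⟩
  simp only [Set.mem_iUnion]
  exact ⟨_, Finset.mem_image_of_mem _ hW, hvW⟩

/-- The monoid generated by the transvections `x ↦ x + t Φ_v(x) v` with `v ∈ U₀`. -/
def transvectionMonoid (U₀ : Submodule K V) (Φ : V → Dual K V) : Submonoid (V ≃ₗ[K] V) :=
  Submonoid.closure {g | ∃ v ∈ U₀, ∃ t : K, ∀ x, g x = x + Φ v x • t • v}

variable {U₀ : Submodule K V} {Φ : V → Dual K V}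

lemma apply_of_mem_transvectionMonoid (hΦ : ∀ v ∈ U₀, ∀ u ∈ U₀, Φ v u = 0) {g : V ≃ₗ[K] V}
    (hg : g ∈ transvectionMonoid U₀ Φ) : ∀ u ∈ U₀, g u = u := by
  refine Submonoid.closure_induction (motive := fun g _ => ∀ u ∈ U₀, g u = u) ?_ ?_ ?_ hg
  · rintro g ⟨v, hv, t, h⟩ u hu
    rw [h, hΦ v hv u hu, zero_smul, add_zero]
  · exact fun u _ => rfl
  · intro g g' _ _ h h' u hu
    rw [LinearEquiv.mul_apply, h' u hu, h u hu]

lemma functional_apply_of_mem_transvectionMonoid (hΦ : ∀ v ∈ U₀, ∀ u ∈ U₀, Φ v u = 0)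
    {g : V ≃ₗ[K] V} (hg : g ∈ transvectionMonoid U₀ Φ) : ∀ v ∈ U₀, ∀ x, Φ v (g x) = Φ v x := by
  refine Submonoid.closure_induction (motive := fun g _ => ∀ v ∈ U₀, ∀ x, Φ v (g x) = Φ v x)
    ?_ ?_ ?_ hg
  · rintro g ⟨w, hw, t, h⟩ v hv x
    rw [h, map_add, map_smul, map_smul, hΦ v hv w hw, smul_zero, smul_zero, add_zero]
  · exact fun v _ x => rfl
  · intro g g' _ _ h h' v hv x
    rw [LinearEquiv.mul_apply, h v hv, h' v hv]

lemma map_transvection_of_mem {M : Submodule K V} {φ : Dual K V} {v : V} (hv : v ∈ M)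
    (hφ : φ v = 0) (t : K) : M.map (LinearMap.transvection φ (t • v)) = M := by
  refine le_antisymm ?_ fun x hx => ⟨x - φ x • t • v, ?_, ?_⟩
  · rintro _ ⟨x, hx, rfl⟩
    exact M.add_mem hx (M.smul_mem _ (M.smul_mem _ hv))
  · exact M.sub_mem hx (M.smul_mem _ (M.smul_mem _ hv))
  · simp [LinearMap.transvection.apply, hφ]

variable {cls : Submodule K V → C} {F : Finset (Submodule K V)}
  {M : Submodule K V → Submodule K V}

-- A transvection along `p.1` leaves the image of `M U` unchanged if `p.1 ∈ U`, and with a suitable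
-- parameter multiplies all the other classes by `p.2`. The hypotheses persist along the list:
-- products of such transvections fix `U₀` pointwise and preserve the functionals `Φ v`, so the
-- image of `M U` still meets `U₀` in `U` and stays outside the relevant kernels.
open Classical in
lemma exists_mem_transvectionMonoid_prod (hcls : TransvectionProperty cls)
    (hΦ : ∀ v ∈ U₀, ∀ u ∈ U₀, Φ v u = 0) (hM : ∀ U ∈ F, M U ⊓ U₀ = U)
    (hker : ∀ U ∈ F, ∀ v ∈ U₀, v ∉ U → ¬ M U ≤ LinearMap.ker (Φ v))
    (l : List (V × C)) (hl : ∀ p ∈ l, p.1 ∈ U₀) :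
    ∃ g ∈ transvectionMonoid U₀ Φ, ∀ U ∈ F, cls ((M U).map (g : V →ₗ[K] V)) =
      (l.map fun p => if p.1 ∈ U then 1 else p.2).prod * cls (M U) := by
  induction l with
  | nil =>
    refine ⟨1, one_mem _, fun U _ => ?_⟩
    rw [List.map_nil, List.prod_nil, one_mul]
    exact congrArg cls (Submodule.map_id _)
  | cons p l ih =>
    obtain ⟨g, hg, hgF⟩ := ih fun q hq => hl q (List.mem_cons_of_mem _ hq)
    have hp : p.1 ∈ U₀ := hl p List.mem_cons_self
    have hpp := hΦ p.1 hp p.1 hp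
    have hmem : ∀ U ∈ F, ∀ x ∈ U₀, x ∈ (M U).map (g : V →ₗ[K] V) ↔ x ∈ U := by
      intro U hU x hx
      have hgx := apply_of_mem_transvectionMonoid hΦ hg x hx
      constructor
      · rintro ⟨y, hy, hyx⟩
        have : y = x := g.injective (hyx.trans hgx.symm)
        rw [← hM U hU]
        exact ⟨this ▸ hy, hx⟩
      · intro hxU
        exact ⟨x, ((hM U hU).ge hxU).1, hgx⟩
    obtain ⟨t, ht⟩ := hcls p.2 p.1 (Φ p.1) hpp
      ((F.filter fun U => p.1 ∉ U).image fun U => (M U).map (g : V →ₗ[K] V)) (by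
        intro N hN
        obtain ⟨U, hU, rfl⟩ := Finset.mem_image.mp hN
        obtain ⟨hUF, hpU⟩ := Finset.mem_filter.mp hU
        refine ⟨fun h => hpU ((hmem U hUF _ hp).mp h), fun hle => hker U hUF _ hp hpU ?_⟩
        intro y hy
        rw [LinearMap.mem_ker, ← functional_apply_of_mem_transvectionMonoid hΦ hg _ hp]
        exact hle ⟨y, hy, rfl⟩)
    have htp : Φ p.1 (t • p.1) = 0 := by rw [map_smul, hpp, smul_zero]
    refine ⟨LinearEquiv.transvection htp * g,
      mul_mem (Submonoid.subset_closure ⟨p.1, hp, t, fun x => rfl⟩) hg, fun U hU => ?_⟩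
    have hmap : (M U).map ((LinearEquiv.transvection htp * g : V ≃ₗ[K] V) : V →ₗ[K] V) =
        ((M U).map (g : V →ₗ[K] V)).map (LinearMap.transvection (Φ p.1) (t • p.1)) := by
      rw [← Submodule.map_comp]
      rfl
    rw [hmap, List.map_cons, List.prod_cons, mul_assoc, ← hgF U hU]
    split_ifs with h
    · rw [one_mul, map_transvection_of_mem ((hmem U hU _ hp).mpr h) hpp]
    · rw [mul_comm]
      exact ht _ (Finset.mem_image_of_mem _ (Finset.mem_filter.mpr ⟨hU, h⟩))

/-- Given subspaces `M U` that meet `U₀` in distinct proper subspaces `U`, a product of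
transvections along `U₀` makes all their classes equal to a given one. -/
lemma exists_mem_transvectionMonoid_eq [Infinite K] (hcls : TransvectionProperty cls)
    (hΦ : ∀ v ∈ U₀, ∀ u ∈ U₀, Φ v u = 0) (hF : ∀ U ∈ F, U ≠ U₀) (hM : ∀ U ∈ F, M U ⊓ U₀ = U)
    (hker : ∀ U ∈ F, ∀ v ∈ U₀, v ∉ U → ¬ M U ≤ LinearMap.ker (Φ v)) (c : C) :
    ∃ g ∈ transvectionMonoid U₀ Φ, ∀ U ∈ F, cls ((M U).map (g : V →ₗ[K] V)) = c := by
  classical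
  have hle : ∀ U ∈ F, U ≤ U₀ := fun U hU => hM U hU ▸ inf_le_right
  -- A direction that moves every `M U`; it carries the global correction factor.
  obtain ⟨v₀, hv₀, hv₀F⟩ := exists_mem_forall_notMem U₀ F
    fun W hW h => hF W hW (le_antisymm (hle W hW) h)
  choose v hvU hvF using fun U => exists_mem_forall_notMem U (F.filter fun W => ¬ U ≤ W)
    fun W hW => (Finset.mem_filter.mp hW).2
  have hiff : ∀ W, ∀ U ∈ F, v W ∈ U ↔ W ≤ U := by
    intro W U hU
    constructor
    · intro h
      by_contra hWU
      exact hvF W U (Finset.mem_filter.mpr ⟨hU, hWU⟩) h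
    · exact fun h => h (hvU W)
  -- Transvecting along `v W` affects the `U` with `W ≰ U`. Together with the factor `(∏ x)⁻¹` along
  -- `v₀`, the class at `U` is divided by the product of the `x W` with `W ≤ U`, which therefore has
  -- to be `cls (M U) / c`.
  obtain ⟨x, hx⟩ := exists_prod_filter_le_eq F fun U => cls (M U) / c
  obtain ⟨g, hg, hgF⟩ := exists_mem_transvectionMonoid_prod hcls hΦ hM hker
    ((v₀, (∏ W ∈ F, x W)⁻¹) :: F.toList.map fun W => (v W, x W)) (by
      intro p hp
      rcases List.mem_cons.mp hp with rfl | hp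
      · exact hv₀
      · obtain ⟨W, hW, rfl⟩ := List.mem_map.mp hp
        exact hle W (Finset.mem_toList.mp hW) (hvU W))
  refine ⟨g, hg, fun U hU => ?_⟩
  have h1 : ((F.toList.map fun W => (v W, x W)).map fun p => if p.1 ∈ U then 1 else p.2).prod =
      ∏ W ∈ F with ¬ W ≤ U, x W := by
    rw [List.map_map, Finset.prod_map_toList, Finset.prod_filter]
    refine Finset.prod_congr rfl fun W _ => ?_
    simp only [Function.comp_apply, hiff W U hU, ite_not]
  rw [hgF U hU, List.map_cons, List.prod_cons, if_neg (hv₀F U hU), h1,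
    ← Finset.prod_filter_mul_prod_filter_not F (· ≤ U), hx U hU]
  rw [mul_inv_rev, inv_div, mul_right_comm (∏ W ∈ F with ¬ W ≤ U, x W)⁻¹, inv_mul_cancel, one_mul,
    div_mul_cancel]

end Adjust

end SymplecticBuilding

/-! ### Lifting cycles to the Tits building -/

namespace SymplecticBuilding

open Module

section Liftable

variable {α γ : Type*} {k : ℕ}

/-- The functions on tuples of colours that lift to a cycle supported on tuples satisfying `P`. -/
def liftable (P : (Fin k → α) → Prop) (col : α → γ) : AddSubgroup ((Fin k → γ) →₀ ℤ) where
  carrier := {y | ∃ z : (Fin k → α) →₀ ℤ, IsCycle z ∧ (∀ f ∈ z.support, P f) ∧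
    z.mapDomain (col ∘ ·) = y}
  zero_mem' := ⟨0, IsCycle.zero, by simp, Finsupp.mapDomain_zero⟩
  add_mem' := by
    classical
    rintro _ _ ⟨z, hz, hzP, rfl⟩ ⟨w, hw, hwP, rfl⟩
    refine ⟨z + w, hz.add hw, fun f hf => ?_, Finsupp.mapDomain_add⟩
    rcases Finset.mem_union.mp (Finsupp.support_add hf) with h | h
    · exact hzP f h
    · exact hwP f h
  neg_mem' := by
    rintro _ ⟨z, hz, hzP, rfl⟩
    refine ⟨-z, ?_, fun f hf => hzP f (Finsupp.support_neg z ▸ hf), ?_⟩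
    · rw [← neg_one_smul ℤ z]
      exact hz.smul _
    · rw [← neg_one_smul ℤ z, Finsupp.mapDomain_smul, neg_one_smul]

end Liftable

section Linear

variable {K V C : Type*} [Field K] [AddCommGroup V] [Module K V] [CommGroup C] {k : ℕ}

lemma exists_submodule_finrank_eq {W : Submodule K V} {d : ℕ} (hd : d ≤ finrank K W) :
    ∃ W' ≤ W, finrank K W' = d := by
  obtain ⟨v, hv⟩ := exists_linearIndependent_of_le_finrank hd
  refine ⟨(Submodule.span K (Set.range v)).map W.subtype, Submodule.map_subtype_le _ _, ?_⟩
  rw [Submodule.finrank_map_subtype_eq, finrank_span_eq_card hv, Fintype.card_fin]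

/-- Tuples of subspaces of `W` that increase and have dimensions `1, …, k`. -/
def IsFlagIn (W : Submodule K V) (f : Fin k → Submodule K V) : Prop :=
  Monotone f ∧ ∀ j, f j ≤ W ∧ finrank K (f j) = j + 1

lemma IsFlagIn.extendTuple_le {W : Submodule K V} {f : Fin k → Submodule K V} (hf : IsFlagIn W f)
    (i : ℕ) : extendTuple ⊥ W f i ≤ W := by
  unfold extendTuple
  split_ifs
  · exact bot_le
  · exact (hf.2 _).1
  · exact le_rfl

lemma IsFlagIn.finrank_extendTuple {W : Submodule K V} (hW : finrank K W = k + 1)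
    {f : Fin k → Submodule K V} (hf : IsFlagIn W f) {i : ℕ} (hi : i ≤ k + 1) :
    finrank K (extendTuple ⊥ W f i : Submodule K V) = i := by
  obtain rfl | ⟨j, rfl⟩ : i = 0 ∨ ∃ j, i = j + 1 := by cases i <;> simp
  · rw [extendTuple_zero, finrank_bot]
  · rcases lt_or_ge j k with hj | hj
    · rw [extendTuple_succ (i := ⟨j, hj⟩), (hf.2 _).2]
    · rw [extendTuple_of_lt _ _ _ (by omega), hW]
      omega

lemma IsFlagIn.extendTuple_mono {W : Submodule K V} {f : Fin k → Submodule K V}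
    (hf : IsFlagIn W f) {i j : ℕ} (hij : i ≤ j) :
    extendTuple ⊥ W f i ≤ extendTuple ⊥ W f j := by
  rcases Nat.eq_zero_or_pos i with rfl | hi
  · rw [extendTuple_zero]
    exact bot_le
  by_cases hj : j - 1 < k
  · rw [extendTuple, extendTuple, if_neg (by omega), if_neg (by omega), dif_pos hj,
      dif_pos (by omega)]
    exact hf.1 (Fin.mk_le_mk.mpr (by omega))
  · rw [extendTuple_of_lt (i := j) _ _ _ (by omega)]
    exact hf.extendTuple_le i

lemma map_eq_of_mem_transvectionMonoid {U₀ U : Submodule K V} {Φ : V → Dual K V}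
    (hΦ : ∀ v ∈ U₀, ∀ u ∈ U₀, Φ v u = 0) {g : V ≃ₗ[K] V} (hg : g ∈ transvectionMonoid U₀ Φ)
    (hU : U ≤ U₀) : U.map (g : V →ₗ[K] V) = U := by
  have h := apply_of_mem_transvectionMonoid hΦ hg
  refine le_antisymm ?_ fun x hx => ⟨x, hx, h x (hU hx)⟩
  rintro _ ⟨x, hx, rfl⟩
  rw [LinearEquiv.coe_coe, h x (hU hx)]
  exact hx

lemma apply_sub_mem_of_mem_transvectionMonoid {U₀ : Submodule K V} {Φ : V → Dual K V}
    {g : V ≃ₗ[K] V} (hg : g ∈ transvectionMonoid U₀ Φ) : ∀ x, g x - x ∈ U₀ := by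
  refine Submonoid.closure_induction (motive := fun g _ => ∀ x, g x - x ∈ U₀) ?_ ?_ ?_ hg
  · rintro g ⟨v, hv, t, h⟩ x
    rw [h, add_sub_cancel_left]
    exact U₀.smul_mem _ (U₀.smul_mem _ hv)
  · intro x
    simp
  · intro g g' _ _ h h' x
    have := U₀.add_mem (h (g' x)) (h' x)
    rwa [sub_add_sub_cancel] at this

variable [FiniteDimensional K V]

/-- Every cycle on `k`-tuples of colours lifts to the Tits building of a space of dimension
`k + 1`. -/
theorem mem_liftable_isFlagIn [Infinite K] {cls : Submodule K V → C}
    (hcls : TransvectionProperty cls) : ∀ (k : ℕ) (W : Submodule K V), finrank K W = k + 1 →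
    ∀ y : (Fin k → C) →₀ ℤ, IsCycle y → y ∈ liftable (IsFlagIn W) cls := by
  classical
  intro k
  induction k with
  | zero =>
    intro W _ y _
    refine ⟨y.mapDomain fun _ i => i.elim0, fun s => s.elim0,
      fun f _ => ⟨fun i => i.elim0, fun i => i.elim0⟩, ?_⟩
    rw [← Finsupp.mapDomain_comp]
    conv_rhs => rw [← Finsupp.mapDomain_id (v := y)]
    congr 1
    funext f
    exact Subsingleton.elim _ _
  | succ k ih =>
    intro W hW y hy
    obtain ⟨W', hW'W, hW'⟩ := exists_submodule_finrank_eq (W := W) (d := k + 1) (by omega)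
    obtain ⟨e, heW, heW'⟩ : ∃ e ∈ W, e ∉ W' := by
      refine SetLike.not_le_iff_exists.mp fun h => ?_
      have := Submodule.finrank_mono h
      omega
    obtain ⟨φ, hφe, hφW'⟩ := Submodule.exists_le_ker_of_notMem heW'
    refine isCycle_snoc_induction _ (cls W') (fun c y' hy' => ?_) hy
    obtain ⟨z, hz, hzF, hzy⟩ := ih W' hW' y' hy'
    -- The top members of the flags, of dimension `k` (so `⊥` if `k = 0`). Only their sums with the
    -- new line occur as last vertices of a prism path.
    let F : Finset (Submodule K V) := z.support.image fun f => extendTuple ⊥ W' f k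
    have hFle : ∀ U ∈ F, U ≤ W' := by
      intro U hU
      obtain ⟨f, hf, rfl⟩ := Finset.mem_image.mp hU
      exact (hzF f hf).extendTuple_le k
    have hFne : ∀ U ∈ F, U ≠ W' := by
      intro U hU h
      obtain ⟨f, hf, rfl⟩ := Finset.mem_image.mp hU
      have := (hzF f hf).finrank_extendTuple hW' (Nat.le_succ k)
      rw [h, hW'] at this
      omega
    have hΦ : ∀ v ∈ W', ∀ u ∈ W', (fun _ => φ : V → Dual K V) v u = 0 :=
      fun _ _ u hu => hφW' hu
    obtain ⟨g, hg, hgc⟩ := exists_mem_transvectionMonoid_eq (F := F) (U₀ := W')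
      (M := fun U => U ⊔ Submodule.span K {e}) hcls hΦ hFne (by
        intro U hU
        rw [sup_inf_assoc_of_le _ (hFle U hU)]
        have : Submodule.span K {e} ⊓ W' = ⊥ := by
          rw [← disjoint_iff, disjoint_comm]
          exact (Submodule.disjoint_span_singleton' (by rintro rfl; exact heW' W'.zero_mem)).mpr
            heW'
        rw [this, sup_bot_eq]) (by
        intro U hU v _ _ hle
        exact hφe (hle (Submodule.mem_sup_right (Submodule.mem_span_singleton_self e)))) c
    set e' := g e with he'
    have he'W' : e' ∉ W' := by
      intro h
      have h1 : g e = e := g.injective (apply_of_mem_transvectionMonoid hΦ hg _ h)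
      exact heW' (h1 ▸ h)
    have he'W : e' ∈ W := by
      have := W.add_mem (hW'W (apply_sub_mem_of_mem_transvectionMonoid hg e)) heW
      rwa [sub_add_cancel] at this
    let op : Submodule K V → Submodule K V := fun U => U ⊔ Submodule.span K {e'}
    have hopc : ∀ U ∈ F, cls (op U) = c := by
      intro U hU
      rw [← hgc U hU, Submodule.map_sup, map_eq_of_mem_transvectionMonoid hΦ hg (hFle U hU),
        Submodule.map_span, Set.image_singleton]
      rfl
    obtain ⟨Z, hZ, hZs, hZc⟩ := exists_isCycle_of_paths (fun a : Fin (k + 2) => (-1 : ℤ) ^ (a : ℕ))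
      (Fin.last (k + 1)) (isUnit_one.neg.pow _) (prismPath ⊥ W' op) cls W' c
      (isCycle_prismPath ⊥ W' op hz) (by
        intro f _
        rw [snoc_eq_extendTuple ⊥]
        funext t
        simp only [prismPath, Fin.val_last]
        rw [if_pos t.2]) (by
        intro a ha f hf
        have : ¬ (k : ℕ) < a := by
          have := Fin.val_lt_last ha
          omega
        simp only [prismPath, Fin.val_last, if_neg this]
        exact hopc _ (Finset.mem_image_of_mem _ hf))
    rw [hzy] at hZc
    refine ⟨Z, hZ, fun f' hf' => ?_, hZc⟩
    obtain ⟨a, f, hf, rfl⟩ := hZs f' hf'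
    have hfl := hzF f hf
    refine ⟨fun t t' htt => ?_, fun t => ⟨?_, ?_⟩⟩
    · have htt' : (t : ℕ) ≤ t' := htt
      simp only [prismPath]
      split_ifs with h1 h2
      · exact hfl.extendTuple_mono (by omega)
      · exact (hfl.extendTuple_mono (by omega)).trans le_sup_left
      · omega
      · exact sup_le_sup_right (hfl.extendTuple_mono htt') _
    · simp only [prismPath]
      split_ifs with h1
      · exact (hfl.extendTuple_le _).trans hW'W
      · refine sup_le ((hfl.extendTuple_le _).trans hW'W) ?_
        rwa [Submodule.span_singleton_le_iff_mem]
    · by_cases h1 : (t : ℕ) < a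
      · have : prismPath ⊥ W' op a f t = extendTuple ⊥ W' f (t + 1) := if_pos h1
        rw [this]
        exact hfl.finrank_extendTuple hW' (by omega)
      · have : prismPath ⊥ W' op a f t = extendTuple ⊥ W' f t ⊔ Submodule.span K {e'} := if_neg h1
        rw [this, Submodule.finrank_sup_span_singleton fun h => he'W' (hfl.extendTuple_le _ h),
          hfl.finrank_extendTuple hW' (by omega)]

end Linear

end SymplecticBuilding

/-! ### Lifting cycles to the isotropic building -/

namespace SymplecticBuilding

open Module

section Symplectic

variable {K V C : Type*} [Field K] [AddCommGroup V] [Module K V] [CommGroup C]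
  {ω : LinearMap.BilinForm K V}

lemma sup_span_singleton_le_orthogonal (hA : ω.IsAlt) {U : Submodule K V}
    (hU : U ≤ ω.orthogonal U) {e : V} (he : e ∈ ω.orthogonal U) :
    U ⊔ Submodule.span K {e} ≤ ω.orthogonal (U ⊔ Submodule.span K {e}) := by
  intro x hx y hy
  obtain ⟨u, hu, a, ha, rfl⟩ := Submodule.mem_sup.mp hx
  obtain ⟨u', hu', a', ha', rfl⟩ := Submodule.mem_sup.mp hy
  obtain ⟨r, rfl⟩ := Submodule.mem_span_singleton.mp ha
  obtain ⟨r', rfl⟩ := Submodule.mem_span_singleton.mp ha'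
  have h1 : ω u' u = 0 := hU hu u' hu'
  have h2 : ω u' e = 0 := he u' hu'
  have h3 : ω e u = 0 := hA.isRefl _ _ (he u hu)
  simp [h1, h2, h3, hA.self_eq_zero e]

lemma orthogonal_inf_orthogonal (A B : Submodule K V) :
    ω.orthogonal A ⊓ ω.orthogonal B = ω.orthogonal (A ⊔ B) := by
  refine le_antisymm ?_ (le_inf (LinearMap.BilinForm.orthogonal_le le_sup_left)
    (LinearMap.BilinForm.orthogonal_le le_sup_right))
  rintro x ⟨hA, hB⟩ y hy
  obtain ⟨a, ha, b, hb, rfl⟩ := Submodule.mem_sup.mp hy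
  have h1 : ω a x = 0 := hA a ha
  have h2 : ω b x = 0 := hB b hb
  simp [h1, h2]

lemma sup_orthogonal_inf_isotropic (hA : ω.IsAlt) {A B U L : Submodule K V}
    (hU : U ≤ ω.orthogonal U) (hL : L ≤ ω.orthogonal L) (hAB : A ≤ B) (hB : B ≤ U) :
    A ⊔ ω.orthogonal B ⊓ L ≤ ω.orthogonal (A ⊔ ω.orthogonal B ⊓ L) := by
  intro x hx y hy
  obtain ⟨a, ha, b, ⟨hb, hb'⟩, rfl⟩ := Submodule.mem_sup.mp hx
  obtain ⟨c, hc, d, ⟨hd, hd'⟩, rfl⟩ := Submodule.mem_sup.mp hy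
  have h1 : ω c a = 0 := hU (hB (hAB ha)) c (hB (hAB hc))
  have h2 : ω c b = 0 := hb c (hAB hc)
  have h3 : ω d a = 0 := hA.isRefl _ _ (hd a (hAB ha))
  have h4 : ω d b = 0 := hL hb' d hd'
  simp [h1, h2, h3, h4]

lemma form_apply_of_mem_transvectionMonoid (hA : ω.IsAlt) {U₀ : Submodule K V} {g : V ≃ₗ[K] V}
    (hg : g ∈ transvectionMonoid U₀ (fun v => ω v)) : ∀ x y, ω (g x) (g y) = ω x y := by
  refine Submonoid.closure_induction (motive := fun g _ => ∀ x y, ω (g x) (g y) = ω x y)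
    ?_ (fun _ _ => rfl) ?_ hg
  · rintro g ⟨v, -, t, h⟩ x y
    have h1 : ω x v = - ω v x := (hA.neg_eq v x).symm
    rw [h, h]
    simp only [map_add, map_smul, LinearMap.add_apply, LinearMap.smul_apply, smul_eq_mul, h1,
      hA.self_eq_zero v]
    ring
  · intro g g' _ _ h h' x y
    rw [LinearEquiv.mul_apply, LinearEquiv.mul_apply, h, h']

variable [FiniteDimensional K V]

/-- Hyperbolic planes are split off one at a time. Disjointness of `U ⊔ L` from its orthogonal says
that the form is nondegenerate on `U ⊔ L`, so its orthogonal is a complement, and a nonzero `e`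
there pairs nontrivially with some `f` in the same complement. -/
lemma exists_isotropic_pair (hA : ω.IsAlt) (hN : ω.Nondegenerate) (d : ℕ)
    (hd : 2 * d ≤ finrank K V) :
    ∃ U L : Submodule K V, U ≤ ω.orthogonal U ∧ L ≤ ω.orthogonal L ∧ finrank K U = d ∧
      finrank K L = d ∧ Disjoint (U ⊔ L) (ω.orthogonal (U ⊔ L)) := by
  induction d with
  | zero => exact ⟨⊥, ⊥, bot_le, bot_le, finrank_bot K V, finrank_bot K V, by simp⟩
  | succ d ih =>
    obtain ⟨U, L, hU, hL, hUd, hLd, hdis⟩ := ih (by omega)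
    have hcompl := (LinearMap.BilinForm.isCompl_orthogonal_iff_disjoint hA.isRefl).mpr hdis
    have hne : ω.orthogonal (U ⊔ L) ≠ ⊥ := by
      intro h
      have h1 := LinearMap.BilinForm.finrank_orthogonal hN (U ⊔ L)
      have h2 := Submodule.finrank_add_le_finrank_add_finrank U L
      rw [h, finrank_bot] at h1
      omega
    obtain ⟨e, he, he0⟩ := Submodule.exists_mem_ne_zero_of_ne_bot hne
    obtain ⟨y, hy⟩ : ∃ y, ω e y ≠ 0 := by
      by_contra! h
      exact he0 (hN.1 e h)
    obtain ⟨x, hx, f, hf, rfl⟩ := Submodule.mem_sup.mp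
      (hcompl.sup_eq_top ▸ Submodule.mem_top : y ∈ (U ⊔ L) ⊔ ω.orthogonal (U ⊔ L))
    have hex : ω e x = 0 := hA.isRefl _ _ (he x hx)
    have hef : ω e f ≠ 0 := by rwa [map_add, hex, zero_add] at hy
    have hfe : ω f e ≠ 0 := fun h => hef (hA.isRefl _ _ h)
    have hf0 : f ≠ 0 := by
      rintro rfl
      exact hef (map_zero _)
    have heU : e ∉ U := fun h => he0 (hdis.le_bot ⟨Submodule.mem_sup_left h, he⟩)
    have hfL : f ∉ L := fun h => hf0 (hdis.le_bot ⟨Submodule.mem_sup_right h, hf⟩)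
    refine ⟨U ⊔ Submodule.span K {e}, L ⊔ Submodule.span K {f},
      sup_span_singleton_le_orthogonal hA hU
        (LinearMap.BilinForm.orthogonal_le le_sup_left he),
      sup_span_singleton_le_orthogonal hA hL
        (LinearMap.BilinForm.orthogonal_le le_sup_right hf),
      by rw [Submodule.finrank_sup_span_singleton heU, hUd],
      by rw [Submodule.finrank_sup_span_singleton hfL, hLd], ?_⟩
    rw [sup_sup_sup_comm, Submodule.disjoint_def]
    intro z hz hz'
    have hz1 : z ∈ ω.orthogonal (U ⊔ L) := LinearMap.BilinForm.orthogonal_le le_sup_left hz'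
    have hez : ω e z = 0 := hz' e (Submodule.mem_sup_right
      (Submodule.mem_sup_left (Submodule.mem_span_singleton_self e)))
    have hfz : ω f z = 0 := hz' f (Submodule.mem_sup_right
      (Submodule.mem_sup_right (Submodule.mem_span_singleton_self f)))
    obtain ⟨h, hh, w, hw, rfl⟩ := Submodule.mem_sup.mp hz
    obtain ⟨a, ha, b, hb, rfl⟩ := Submodule.mem_sup.mp hw
    obtain ⟨r, rfl⟩ := Submodule.mem_span_singleton.mp ha
    obtain ⟨s, rfl⟩ := Submodule.mem_span_singleton.mp hb
    have heh : ω e h = 0 := hA.isRefl _ _ (he h hh)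
    have hfh : ω f h = 0 := hA.isRefl _ _ (hf h hh)
    have hs : s = 0 := by simpa [heh, hA.self_eq_zero e, hef] using hez
    have hr : r = 0 := by simpa [hfh, hA.self_eq_zero f, hfe] using hfz
    subst hs hr
    rw [zero_smul, zero_smul, add_zero, add_zero] at hz1 ⊢
    exact hdis.le_bot ⟨hh, hz1⟩

lemma orthogonal_eq_self_of_finrank (hN : ω.Nondegenerate) {L : Submodule K V}
    (hL : L ≤ ω.orthogonal L) (h : finrank K V = 2 * finrank K L) : ω.orthogonal L = L := by
  refine (Submodule.eq_of_le_of_finrank_le hL ?_).symm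
  rw [LinearMap.BilinForm.finrank_orthogonal hN]
  omega

/-- Because `L` is its own orthogonal, `B^⊥ ∩ L = (B + L)^⊥`, whose dimension is known; the sums
involved are direct since `U ∩ L = 0`. -/
lemma finrank_sup_orthogonal_inf (hN : ω.Nondegenerate) {A B U L : Submodule K V}
    (hL : ω.orthogonal L = L) (hUL : U ⊓ L = ⊥) (hAB : A ≤ B) (hB : B ≤ U)
    (h : finrank K V = 2 * finrank K L) :
    finrank K (A ⊔ ω.orthogonal B ⊓ L : Submodule K V) + finrank K B =
      finrank K A + finrank K L := by
  have h1 : finrank K (ω.orthogonal B ⊓ L : Submodule K V) =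
      finrank K V - finrank K (B ⊔ L : Submodule K V) := by
    rw [← LinearMap.BilinForm.finrank_orthogonal hN, ← orthogonal_inf_orthogonal, hL]
  have hBL : B ⊓ L = ⊥ := le_bot_iff.mp ((inf_le_inf_right L hB).trans hUL.le)
  have hAL : A ⊓ (ω.orthogonal B ⊓ L) = ⊥ :=
    le_bot_iff.mp ((inf_le_inf (hAB.trans hB) inf_le_right).trans hUL.le)
  have h2 := Submodule.finrank_sup_add_finrank_inf_eq B L
  have h3 := Submodule.finrank_sup_add_finrank_inf_eq A (ω.orthogonal B ⊓ L)
  rw [hBL, finrank_bot] at h2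
  rw [hAL, finrank_bot] at h3
  have h4 := Submodule.finrank_le (B ⊔ L)
  omega

/-- Increasing tuples of isotropic subspaces of dimensions `1, …, k`. -/
def IsIsotropicFlag (ω : LinearMap.BilinForm K V) {k : ℕ} (f : Fin k → Submodule K V) : Prop :=
  Monotone f ∧ ∀ j, f j ≤ ω.orthogonal (f j) ∧ finrank K (f j) = j + 1

/-- Along a word `U_i` grows and `U_j` shrinks, so both summands of `U_i + (U_j^⊥ ∩ L)` grow. After
`t + 1` steps, `d` of them down, the dimension is `(t + 1 - d) + (k + 1) - (k + 1 - d) = t + 1`. -/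
lemma isIsotropicFlag_wordPath (hA : ω.IsAlt) (hN : ω.Nondegenerate) {k : ℕ}
    (hV : finrank K V = 2 * (k + 1)) {U L : Submodule K V} (hU : U ≤ ω.orthogonal U)
    (hUd : finrank K U = k + 1) (hL : L ≤ ω.orthogonal L) (hLd : finrank K L = k + 1)
    (hUL : U ⊓ L = ⊥) (ε : Fin (k + 1) → Bool) {f : Fin k → Submodule K V} (hf : IsFlagIn U f) :
    IsIsotropicFlag ω (wordPath ⊥ U (fun A B => A ⊔ ω.orthogonal B ⊓ L) ε f) := by
  have hL' := orthogonal_eq_self_of_finrank hN hL (by rw [hV, hLd])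
  refine ⟨fun t t' htt => ?_, fun t => ⟨?_, ?_⟩⟩
  · have htt' : (t : ℕ) ≤ t' := htt
    have h1 := downSteps_mono ε (Nat.add_le_add_right htt' 1)
    have h2 := downSteps_le_add ε (t := t + 1) (d := t' - t) (by omega)
    rw [show (t : ℕ) + 1 + (t' - t) = t' + 1 by omega] at h2
    exact sup_le_sup (hf.extendTuple_mono (by omega)) (inf_le_inf_right _
      (LinearMap.BilinForm.orthogonal_le (hf.extendTuple_mono (by omega))))
  · exact sup_orthogonal_inf_isotropic hA hU hL (hf.extendTuple_mono (by omega))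
      (hf.extendTuple_le _)
  · have h1 := downSteps_le ε (t := t + 1) (by omega)
    have h2 := finrank_sup_orthogonal_inf hN hL' hUL
      (hf.extendTuple_mono (i := t + 1 - downSteps ε (t + 1))
        (j := k + 1 - downSteps ε (t + 1)) (by omega))
      (hf.extendTuple_le _) (by rw [hV, hLd])
    rw [hf.finrank_extendTuple hUd (by omega), hf.finrank_extendTuple hUd (by omega), hLd] at h2
    change finrank K (_ ⊔ _ : Submodule K V) = _
    omega

/-- Every cycle on `n`-tuples of colours lifts to the isotropic building of a symplectic space of
dimension `2n`. -/
theorem mem_liftable_isIsotropicFlag [Infinite K] {cls : Submodule K V → C}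
    (hcls : TransvectionProperty cls) (hA : ω.IsAlt) (hN : ω.Nondegenerate) {k : ℕ}
    (hV : finrank K V = 2 * (k + 1)) {y : (Fin (k + 1) → C) →₀ ℤ} (hy : IsCycle y) :
    y ∈ liftable (IsIsotropicFlag ω) cls := by
  classical
  obtain ⟨U₀, L, hU₀, hL, hU₀d, hLd, hdis⟩ := exists_isotropic_pair hA hN (k + 1) hV.ge
  have hU₀o := orthogonal_eq_self_of_finrank hN hU₀ (by rw [hV, hU₀d])
  have hLo := orthogonal_eq_self_of_finrank hN hL (by rw [hV, hLd])
  have hUL : U₀ ⊓ L = ⊥ := by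
    refine le_bot_iff.mp fun x hx => hdis.le_bot ⟨Submodule.mem_sup_left hx.1, ?_⟩
    rw [← orthogonal_inf_orthogonal, hU₀o, hLo]
    exact hx
  refine isCycle_snoc_induction _ (cls U₀) (fun c y' hy' => ?_) hy
  obtain ⟨z, hz, hzF, rfl⟩ := mem_liftable_isFlagIn hcls k U₀ hU₀d y' hy'
  -- Unlike in the linear case, flag members of every dimension from `0` to `k` are needed: a word
  -- with `d` down steps ends at `U_i + (U_i^⊥ ∩ L')` with `i = k + 1 - d`.
  let F : Finset (Submodule K V) := z.support.biUnion fun f =>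
    (Finset.range (k + 1)).image (extendTuple ⊥ U₀ f)
  have hFle : ∀ U ∈ F, U ≤ U₀ := by
    intro U hU
    obtain ⟨f, hf, hU⟩ := Finset.mem_biUnion.mp hU
    obtain ⟨i, -, rfl⟩ := Finset.mem_image.mp hU
    exact (hzF f hf).extendTuple_le i
  have hFne : ∀ U ∈ F, U ≠ U₀ := by
    intro U hU h
    obtain ⟨f, hf, hU⟩ := Finset.mem_biUnion.mp hU
    obtain ⟨i, hi, rfl⟩ := Finset.mem_image.mp hU
    have hi' := Finset.mem_range.mp hi
    have := (hzF f hf).finrank_extendTuple hU₀d hi'.le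
    rw [h, hU₀d] at this
    omega
  have hΦ : ∀ v ∈ U₀, ∀ u ∈ U₀, (fun v => ω v : V → Dual K V) v u = 0 :=
    fun v hv u hu => hU₀ hu v hv
  obtain ⟨g, hg, hgc⟩ := exists_mem_transvectionMonoid_eq (F := F) (U₀ := U₀)
    (M := fun U => U ⊔ ω.orthogonal U ⊓ L) hcls hΦ hFne (by
      intro U hU
      rw [sup_inf_assoc_of_le _ (hFle U hU), inf_assoc, inf_comm L, hUL, inf_bot_eq,
        sup_bot_eq]) (by
      intro U hU v hv hvU hle
      -- `U^⊥ ∩ L` is `(U + L)^⊥`, so a vector orthogonal to it lies in `U + L`, and `U₀ ∩ (U + L) =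
      -- U`.
      have h1 : v ∈ ω.orthogonal (ω.orthogonal (U ⊔ L)) := by
        intro x hx
        rw [← orthogonal_inf_orthogonal, hLo] at hx
        exact hA.isRefl _ _ (hle (Submodule.mem_sup_right hx))
      rw [LinearMap.BilinForm.orthogonal_orthogonal hN hA.isRefl] at h1
      obtain ⟨u, hu, l, hl, rfl⟩ := Submodule.mem_sup.mp h1
      have h2 : l ∈ U₀ ⊓ L :=
        ⟨(Submodule.add_mem_iff_right _ (hFle U hU hu)).mp hv, hl⟩
      rw [hUL, Submodule.mem_bot] at h2
      rw [h2, add_zero] at hvU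
      exact hvU hu) c
  have hgω := form_apply_of_mem_transvectionMonoid hA hg
  have hgU₀ := apply_of_mem_transvectionMonoid hΦ hg
  set L' := L.map (g : V →ₗ[K] V) with hL'def
  have hL' : L' ≤ ω.orthogonal L' := by
    rintro _ ⟨x, hx, rfl⟩ _ ⟨w, hw, rfl⟩
    exact (hgω w x).trans (hL hx w hw)
  have hL'd : finrank K L' = k + 1 := (LinearEquiv.finrank_map_eq g L).trans hLd
  have hUL' : U₀ ⊓ L' = ⊥ := by
    refine le_bot_iff.mp ?_
    rintro _ ⟨hx, x, hxL, rfl⟩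
    have h1 : g x = x := g.injective (hgU₀ _ hx)
    rw [← hUL]
    rw [LinearEquiv.coe_coe, h1] at hx ⊢
    exact ⟨hx, hxL⟩
  have hopc : ∀ U ∈ F, cls (U ⊔ ω.orthogonal U ⊓ L') = c := by
    intro U hU
    -- `g` is an isometry fixing `U` pointwise, so it preserves `U^⊥` and carries `U + (U^⊥ ∩ L)` to
    -- `U + (U^⊥ ∩ L')`.
    have h1 : (ω.orthogonal U).map (g : V →ₗ[K] V) = ω.orthogonal U := by
      refine Submodule.eq_of_le_of_finrank_eq ?_ (LinearEquiv.finrank_map_eq g _)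
      rintro _ ⟨x, hx, rfl⟩ u hu
      have h2 := hgω u x
      rw [hgU₀ u (hFle U hU hu)] at h2
      exact h2.trans (hx u hu)
    rw [← hgc U hU, Submodule.map_sup, map_eq_of_mem_transvectionMonoid hΦ hg (hFle U hU),
      Submodule.map_inf _ g.injective, h1]
  obtain ⟨Z, hZ, hZs, hZc⟩ := exists_isCycle_of_paths (wordSign (k := k)) (fun _ => false)
    (by rw [wordSign_const_false]; exact isUnit_one)
    (wordPath ⊥ U₀ fun A B => A ⊔ ω.orthogonal B ⊓ L') cls U₀ c (isCycle_wordPath _ _ _ hz) (by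
      intro f _
      rw [snoc_eq_extendTuple ⊥]
      funext t
      -- Without down steps `U_j` stays equal to `U₀`, and `U₀^⊥ ∩ L' = U₀ ∩ L' = 0`: the path is
      -- the flag followed by `U₀`.
      simp only [wordPath, downSteps_const_false, Nat.sub_zero]
      rw [extendTuple_of_lt _ _ _ (Nat.lt_succ_self k), hU₀o, hUL', sup_bot_eq]) (by
      intro ε hε f hf
      have h1 := downSteps_pos hε
      exact hopc _ (Finset.mem_biUnion.mpr ⟨f, hf, Finset.mem_image_of_mem _
        (Finset.mem_range.mpr (by simp only [Fin.val_last]; omega))⟩))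
  refine ⟨Z, hZ, fun f' hf' => ?_, hZc⟩
  obtain ⟨ε, f, hf, rfl⟩ := hZs f' hf'
  exact isIsotropicFlag_wordPath hA hN hV hU₀ hU₀d hL' hL'd hUL' ε (hzF f hf)

end Symplectic

end SymplecticBuilding

/-! ### Isotropic summands and isotropic subspaces -/

namespace SymplecticBuilding

open Module

section ExtendForm

variable {R K : Type*} [CommRing R] [Field K] [Algebra R K] {m : ℕ}
  {ω : LinearMap.BilinForm R (Fin m → R)}

lemma extendForm_latticeInclusion (x y : Fin m → R) :
    extendForm K ω (latticeInclusion R K m x) (latticeInclusion R K m y) =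
      algebraMap R K (ω x y) := by
  conv_rhs => rw [← Matrix.toBilin'_toMatrix' ω]
  simp only [extendForm, Matrix.toBilin'_apply, latticeInclusion_apply, Matrix.map_apply, map_sum,
    map_mul]

lemma extendForm_span_latticeInclusion {U : Submodule R (Fin m → R)}
    (hU : ∀ x ∈ U, ∀ y ∈ U, ω x y = 0) :
    ∀ x ∈ Submodule.span K (latticeInclusion R K m '' U),
      ∀ y ∈ Submodule.span K (latticeInclusion R K m '' U), extendForm K ω x y = 0 := by
  intro x hx y hy
  induction hx using Submodule.span_induction with
  | zero => simp
  | add x x' _ _ h h' => rw [map_add, LinearMap.add_apply, h, h', add_zero]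
  | smul a x _ h => rw [map_smul, LinearMap.smul_apply, h, smul_zero]
  | mem x hx =>
    obtain ⟨u, hu, rfl⟩ := hx
    induction hy using Submodule.span_induction with
    | zero => simp
    | add x x' _ _ h h' => rw [map_add, h, h', add_zero]
    | smul a x _ h => rw [map_smul, h, smul_zero]
    | mem y hy =>
      obtain ⟨v, hv, rfl⟩ := hy
      rw [extendForm_latticeInclusion, hU u hu v hv, map_zero]

variable [IsDomain R] [IsFractionRing R K]

lemma extendForm_isAlt (hω : ω.IsAlt) : (extendForm K ω).IsAlt := by
  intro x
  obtain ⟨d, hd, y, hy⟩ := exists_smul_eq_latticeInclusion (R := R) x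
  have h := extendForm_latticeInclusion (K := K) (ω := ω) y y
  have hd' : algebraMap R K d ≠ 0 := algebraMap_ne_zero hd
  simpa [hω.self_eq_zero y, hy, hd] using h

lemma extendForm_nondegenerate (hω : IsSymplectic ω) : (extendForm K ω).Nondegenerate := by
  have hleft : ∀ x, (∀ y, extendForm K ω x y = 0) → x = 0 := by
    intro x hx
    obtain ⟨d, hd, y, hy⟩ := exists_smul_eq_latticeInclusion (R := R) x
    have hd' : algebraMap R K d ≠ 0 := algebraMap_ne_zero hd
    have hy0 : y = 0 := by
      refine hω.isPerfPair.bijective_left.1 (LinearMap.ext fun z => ?_)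
      rw [map_zero, LinearMap.zero_apply]
      refine IsFractionRing.injective R K ?_
      rw [← extendForm_latticeInclusion, hy, map_smul, LinearMap.smul_apply, hx, smul_zero,
        map_zero]
    rw [hy0, map_zero] at hy
    exact (smul_eq_zero.mp hy.symm).resolve_left hd'
  exact ⟨hleft, fun y hy => hleft y fun x => (extendForm_isAlt hω.isAlt).isRefl _ _ (hy x)⟩

/-- Every vector of the `K`-span has a nonzero `R`-multiple in `U`, and a direct summand of `R^m`
contains `x` as soon as it contains a nonzero multiple of `x`. -/
lemma lattice_span_latticeInclusion {U : Submodule R (Fin m → R)} (hU : ∃ U', IsCompl U U') :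
    lattice R (Submodule.span K (latticeInclusion R K m '' U)) = U := by
  refine le_antisymm (fun x hx => ?_) fun x hx => Submodule.subset_span ⟨x, hx, rfl⟩
  have key : ∀ z ∈ Submodule.span K (latticeInclusion R K m '' U),
      ∃ d : R, d ≠ 0 ∧ ∃ u ∈ U, latticeInclusion R K m u = algebraMap R K d • z := by
    intro z hz
    induction hz using Submodule.span_induction with
    | mem z hz =>
      obtain ⟨u, hu, rfl⟩ := hz
      exact ⟨1, one_ne_zero, u, hu, by rw [map_one, one_smul]⟩
    | zero => exact ⟨1, one_ne_zero, 0, U.zero_mem, by simp⟩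
    | add z w _ _ hz hw =>
      obtain ⟨d, hd, u, hu, hdu⟩ := hz
      obtain ⟨e, he, v, hv, hev⟩ := hw
      refine ⟨d * e, mul_ne_zero hd he, e • u + d • v,
        U.add_mem (U.smul_mem _ hu) (U.smul_mem _ hv), ?_⟩
      rw [map_add, latticeInclusion_smul, latticeInclusion_smul, hdu, hev, smul_smul, smul_smul,
        map_mul, smul_add, mul_comm (algebraMap R K e)]
    | smul a z _ hz =>
      obtain ⟨d, hd, u, hu, hdu⟩ := hz
      obtain ⟨⟨b, s⟩, hbs⟩ := IsLocalization.surj (nonZeroDivisors R) a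
      refine ⟨s * d, mul_ne_zero (nonZeroDivisors.coe_ne_zero s) hd, b • u, U.smul_mem _ hu, ?_⟩
      have hbs' : a * algebraMap R K s = algebraMap R K b := hbs
      rw [latticeInclusion_smul, hdu, ← hbs', smul_smul, smul_smul, map_mul]
      congr 1
      ring
  obtain ⟨d, hd, u, hu, hdu⟩ := key _ hx
  rw [← latticeInclusion_smul] at hdu
  have hdx : d • x ∈ U := latticeInclusion_injective hdu ▸ hu
  obtain ⟨U', hU'⟩ := hU
  obtain ⟨a, ha, b, hb, rfl⟩ := Submodule.mem_sup.mp
    (hU'.sup_eq_top ▸ Submodule.mem_top : x ∈ U ⊔ U')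
  rw [smul_add, Submodule.add_mem_iff_right _ (U.smul_mem d ha)] at hdx
  have h0 : d • b ∈ U ⊓ U' := ⟨hdx, U'.smul_mem d hb⟩
  rw [hU'.inf_eq_bot, Submodule.mem_bot] at h0
  rw [(smul_eq_zero.mp h0).resolve_left hd, add_zero]
  exact ha

end ExtendForm

/-- Isotropic subspaces correspond to isotropic summands of the lattice. -/
noncomputable def latticeOrderIso {R K : Type*} [CommRing R] [IsDedekindDomain R] [Field K]
    [Algebra R K] [IsFractionRing R K] {m : ℕ} (ω : LinearMap.BilinForm R (Fin m → R)) :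
    IsotropicPoset (extendForm K ω) ≃o IsotropicPoset ω where
  toFun V := ⟨lattice R V.1, lattice_ne_bot V.2.1, exists_isCompl_lattice V.1, fun x hx y hy => by
    refine IsFractionRing.injective R K ?_
    rw [← extendForm_latticeInclusion, map_zero]
    exact V.2.2.2 _ hx _ hy⟩
  invFun U := ⟨Submodule.span K (latticeInclusion R K m '' U.1), by
    intro h
    apply U.2.1
    rw [← lattice_span_latticeInclusion (K := K) U.2.2.1, h, eq_bot_iff]
    intro x hx
    exact latticeInclusion_injective (K := K) (((Submodule.mem_bot K).mp hx).trans (map_zero _).symm),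
    Submodule.exists_isCompl _,
    extendForm_span_latticeInclusion U.2.2.2⟩
  left_inv V := Subtype.ext (span_latticeInclusion_lattice V.1)
  right_inv U := Subtype.ext (lattice_span_latticeInclusion U.2.2.1)
  map_rel_iff' {V W} := by
    constructor
    · intro h
      change V.1 ≤ W.1
      rw [← span_latticeInclusion_lattice (R := R) V.1, ← span_latticeInclusion_lattice (R := R) W.1]
      exact Submodule.span_mono (Set.image_mono h)
    · exact fun h x hx => h hx

/-! ### From isotropic flags to chains in the poset, and the finite-field case. -/

section Lift

lemma isCycle_of_mapDomain {α β : Type*} {k : ℕ} {φ : α → β} (hφ : Function.Injective φ)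
    {z : (Fin k → α) →₀ ℤ} (hz : IsCycle (z.mapDomain (φ ∘ ·))) : IsCycle z := by
  intro s
  have hinj : Function.Injective fun f : {j : Fin k // j ≠ s} → α => φ ∘ f := hφ.comp_left
  refine Finsupp.mapDomain_injective hinj ?_
  rw [Finsupp.mapDomain_zero, ← hz s, ← Finsupp.mapDomain_comp, ← Finsupp.mapDomain_comp]
  rfl

lemma exists_isCycle_isotropicPoset {K V C : Type*} [Field K] [Infinite K] [AddCommGroup V]
    [Module K V] [FiniteDimensional K V] [CommGroup C] {ω : LinearMap.BilinForm K V}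
    {cls : Submodule K V → C} (hcls : TransvectionProperty cls) (hA : ω.IsAlt)
    (hN : ω.Nondegenerate) {k : ℕ} (hV : finrank K V = 2 * (k + 1))
    {y : (Fin (k + 1) → C) →₀ ℤ} (hy : IsCycle y) :
    ∃ z : (Fin (k + 1) → IsotropicPoset ω) →₀ ℤ, IsCycle z ∧ (∀ f ∈ z.support, StrictMono f) ∧
      z.mapDomain ((fun U => cls U.1) ∘ ·) = y := by
  obtain ⟨z, hz, hzF, rfl⟩ := mem_liftable_isIsotropicFlag hcls hA hN hV hy
  have hinj : Function.Injective fun f : Fin (k + 1) → IsotropicPoset ω => Subtype.val ∘ f :=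
    Subtype.val_injective.comp_left
  have hval := Finsupp.mapDomain_comapDomain _ hinj z (fun f hf => by
    obtain ⟨-, hf2⟩ := hzF f hf
    refine ⟨fun j => ⟨f j, fun h => ?_, Submodule.exists_isCompl _,
      fun x hx y hy => (hf2 j).1 hy x hx⟩, rfl⟩
    have := (hf2 j).2
    rw [h, finrank_bot] at this
    omega)
  refine ⟨z.comapDomain _ hinj.injOn, isCycle_of_mapDomain Subtype.val_injective ?_,
    fun f hf => ?_, ?_⟩
  · exact hval.symm ▸ hz
  · obtain ⟨hf1, hf2⟩ := hzF (Subtype.val ∘ f) (by simpa using hf)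
    intro i j hij
    refine lt_of_le_of_ne (hf1 hij.le) fun h => ?_
    have h1 : finrank K (f i).1 = i + 1 := (hf2 i).2
    have h2 : finrank K (f j).1 = j + 1 := (hf2 j).2
    rw [h, h2] at h1
    have : (i : ℕ) < j := hij
    omega
  · conv_rhs => rw [← hval]
    rw [← Finsupp.mapDomain_comp]
    rfl

lemma isCycle_eq_zero_of_subsingleton {C : Type*} [Subsingleton C] {k : ℕ}
    {y : (Fin (k + 1) → C) →₀ ℤ} (hy : IsCycle y) : y = 0 :=
  Finsupp.mapDomain_injective (Function.injective_of_subsingleton (dropAt 0))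
    ((hy 0).trans Finsupp.mapDomain_zero.symm)

/-- If `K` is finite, then `R` is a finite domain, hence a field, and all its ideals are principal.
-/
lemma infinite_of_nontrivial_classGroup (R K : Type*) [CommRing R] [IsDedekindDomain R] [Field K]
    [Algebra R K] [IsFractionRing R K] [Nontrivial (ClassGroup R)] : Infinite K := by
  by_contra h
  have hK : Finite K := not_infinite_iff_finite.mp h
  have hR : Finite R := Finite.of_injective _ (IsFractionRing.injective R K)
  have hs := Ring.isField_iff_isSimpleOrder_ideal.mp (Finite.isField_of_domain R)
  have hP : IsPrincipalIdealRing R := ⟨fun I => by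
    rcases eq_bot_or_eq_top I with rfl | rfl
    · exact bot_isPrincipal
    · exact top_isPrincipal⟩
  have h1 : Fintype.card (ClassGroup R) = 1 := card_classGroup_eq_one
  have := Fintype.one_lt_card (α := ClassGroup R)
  omega

end Lift

lemma surjective_homologyMap_psi_comp {R K : Type*} [CommRing R] [IsDedekindDomain R]
    [Field K] [Algebra R K] [IsFractionRing R K] (q : ℕ)
    {ω : LinearMap.BilinForm R (Fin (2 * (q + 1)) → R)} (hω : IsSymplectic ω) :
    Function.Surjective (homologyMap (psi hω ∘ latticeOrderIso (K := K) ω)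
      ((psi_strictMono hω).comp (latticeOrderIso (K := K) ω).strictMono) q) := by
  refine surjective_homologyMap_of_lift _ _ fun y hy => ?_
  -- With a single colour the only cycle is zero. This case absorbs all finite `K`, where the choice
  -- of generic vectors is not available.
  rcases subsingleton_or_nontrivial (ClassGroup R) with h | h
  · exact ⟨0, IsCycle.zero, by simp, by
      rw [isCycle_eq_zero_of_subsingleton hy, Finsupp.mapDomain_zero]⟩
  · have := infinite_of_nontrivial_classGroup R K
    exact exists_isCycle_isotropicPoset transvectionProperty_moduleClass
      (extendForm_isAlt hω.isAlt) (extendForm_nondegenerate hω) (by simp) hy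

lemma exists_homology_xposet_equiv_finsupp (q : ℕ) {C : Type*} (c₀ : C) :
    Nonempty (ReducedHomology (XPoset (q + 1) C) q ≃ₗ[ℤ]
      ((Fin (q + 1) → {c : C // c ≠ c₀}) →₀ ℤ)) := by
  obtain ⟨e⟩ := exists_homology_xposet_equiv q C
  obtain ⟨e'⟩ := exists_cycleSubmodule_equiv c₀ (q + 1)
  exact ⟨e.trans e'⟩

lemma exists_finsupp_tuple_equiv {C : Type*} [Finite C] (c₀ : C) (n : ℕ) :
    Nonempty (((Fin n → {c : C // c ≠ c₀}) →₀ ℤ) ≃ₗ[ℤ] (Fin ((Nat.card C - 1) ^ n) → ℤ)) := by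
  classical
  have := Fintype.ofFinite C
  have hcard : Nat.card (Fin n → {c : C // c ≠ c₀}) = (Nat.card C - 1) ^ n := by
    rw [Nat.card_fun, Nat.card_eq_fintype_card (α := Fin n), Fintype.card_fin,
      Nat.card_eq_fintype_card, Nat.card_eq_fintype_card, Fintype.card_subtype_compl,
      Fintype.card_subtype_eq]
  exact ⟨(Finsupp.linearEquivFunOnFinite ℤ ℤ _).trans
    (LinearEquiv.funCongrLeft ℤ ℤ (Finite.equivFinOfCardEq hcard).symm)⟩

end SymplecticBuilding

theorem proposition3p1 {R K : Type*} [CommRing R] [IsDedekindDomain R]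
    [Field K] [Algebra R K] [IsFractionRing R K] (n : ℕ) (hn : 1 ≤ n)
    (ω : LinearMap.BilinForm R (Fin (2 * n) → R)) (hω : IsSymplectic ω) :
    -- `V ↦ V ∩ R^{2n}` is an isomorphism of posets, which identifies the Steinberg module with
    -- the homology of the poset of isotropic summands; `ψ` is surjective on homology
    (∃ Φ : IsotropicPoset (extendForm K ω) ≃o IsotropicPoset ω,
      (∀ V, (Φ V).1 = (V.1.restrictScalars R).comap (latticeInclusion R K (2 * n))) ∧
      Function.Bijective (homologyMap Φ Φ.strictMono (n - 1)) ∧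
      Function.Surjective (homologyMap (psi hω ∘ Φ)
        ((psi_strictMono hω).comp Φ.strictMono) (n - 1))) ∧
    Function.Surjective (homologyMap (psi hω) (psi_strictMono hω) (n - 1)) ∧
    -- the target is free abelian of rank `(|cl(R)| - 1)^n`, also when `cl(R)` is infinite
    Nonempty (ReducedHomology (XPoset n (ClassGroup R)) (n - 1) ≃ₗ[ℤ]
      ((Fin n → {c : ClassGroup R // c ≠ 1}) →₀ ℤ)) ∧
    (Finite (ClassGroup R) →
      Nonempty (ReducedHomology (XPoset n (ClassGroup R)) (n - 1) ≃ₗ[ℤ]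
        (Fin ((Nat.card (ClassGroup R) - 1) ^ n) → ℤ))) := by
  obtain ⟨q, rfl⟩ : ∃ q, n = q + 1 := ⟨n - 1, by omega⟩
  have hsurj := surjective_homologyMap_psi_comp (K := K) q hω
  obtain ⟨e⟩ := exists_homology_xposet_equiv_finsupp q (1 : ClassGroup R)
  refine ⟨⟨latticeOrderIso ω, fun _ => rfl, bijective_homologyMap_orderIso _ _, hsurj⟩, ?_, ⟨e⟩,
    fun _ => ?_⟩
  · intro x
    obtain ⟨w, hw⟩ := hsurj x
    exact ⟨_, (homologyMap_comp _ (latticeOrderIso (K := K) ω).strictMono _ _ q w).symm.trans hw⟩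
  · obtain ⟨e'⟩ := exists_finsupp_tuple_equiv (1 : ClassGroup R) (q + 1)
    exact ⟨e.trans e'⟩
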